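/- Let $\chi\in C_0^\infty(\mathbb R)$ be non-increasing on $[0,\infty)$ and let $v(x)=\chi(|x|)/|x|$ on $\mathbb R^3$ (so $v\ge 0$). Consider the Hartree equation $$ i\,\partial_t\phi+\Delta\phi-(v*|\phi|^2)\,\phi=0,\qquad \phi(0,\cdot)=\phi_0, \qquad x\in\mathbb R^3 .$$ By a global smooth solution we mean a function $\phi:[0,\infty)\times\mathbb R^3\to\mathbb C$ that is $C^\infty$ on $[0,\infty)\times\mathbb R^3$, satisfies the equation pointwise, and is bounded in $H^2(\mathbb R^3)$ on every bounded time interval. Put $W=v*|\phi|^2$, $\rho=\tfrac12|\phi|^2$, $p_j=\tfrac1{2i}(\phi\,\partial_j\overline\phi-\overline\phi\,\partial_j\phi)$, $e=|\nabla\phi|^2+W\rho$, and let $$E_c(t)=\int_{\mathbb R^3}\Big(\tfrac{|x|^2}{2}\rho+t\,x^jp_j+t^2e\Big)\,dx=t^2\int_{\mathbb R^3}\Big(\big|\nabla\big(e^{-i|x|^2/4t}\phi\big)\big|^2+W\rho\Big)\,dx$$ be the pseudoconformal energy (the second expression for $t>0$). Let $\phi$ be a global smooth solution such that $E_c(1)$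 is finite. Then there is a constant $C$, depending only on $\chi$ and on upper bounds for $\|\phi_0\|_{L^2}$ and $E_c(1)$, such that for all $t\ge 1$ $$\|\phi(t,\cdot)\|_{L^6(\mathbb R^3)}\le C\,t^{-3/4},\qquad \|\phi(t,\cdot)\|_{L^4(\mathbb R^3)}\le C\,t^{-9/16},$$ and $$\int_1^\infty\|\phi(t,\cdot)\|_{L^6(\mathbb R^3)}^2\,dt\le C,\qquad \int_1^\infty\|\phi(t,\cdot)\|_{L^4(\mathbb R^3)}^2\,dt\le C .$$ -/

import Mathlib

open MeasureTheory Set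
open scoped ContDiff ENNReal

noncomputable section

namespace Hartree

/-- Physical space `ℝ³` with its Euclidean norm and Lebesgue measure. -/
abbrev E3 : Type := EuclideanSpace ℝ (Fin 3)

/-- A decreasing cut-off profile `r ↦ χ(r)`: smooth, compactly supported and non-increasing on
`[0, ∞)`. In particular `χ ≥ 0` on `[0, ∞)`. -/
structure IsDecreasingCutoff (χ : ℝ → ℝ) : Prop where
  smooth : ContDiff ℝ ∞ χ
  compactSupport : HasCompactSupport χ
  decreasing : AntitoneOn χ (Ici 0)

/-- The truncated repulsive Coulomb potential `v(x) = χ(|x|) / |x|`. -/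
def potential (χ : ℝ → ℝ) (x : E3) : ℝ := χ ‖x‖ / ‖x‖

/-- The mean field `W = v * |f|²`. -/
def meanField (v : E3 → ℝ) (f : E3 → ℂ) (x : E3) : ℝ := ∫ y, v (x - y) * ‖f y‖ ^ 2

/-- The partial derivative `∇_j f`. -/
def partialDeriv (j : Fin 3) (f : E3 → ℂ) (x : E3) : ℂ :=
  fderiv ℝ f x (EuclideanSpace.single j 1)

/-- `φ(t, x)` is a global smooth solution of `i ∂ₜφ + Δφ - (v * |φ|²) φ = 0` with `φ(0) = φ₀`:
it is smooth on `[0, ∞) × ℝ³`, satisfies the equation pointwise, and `φ(t)` is bounded in the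
Sobolev space `H²(ℝ³)` on bounded time intervals. -/
structure IsGlobalSmoothSolution (v : E3 → ℝ) (φ₀ : E3 → ℂ) (φ : ℝ → E3 → ℂ) : Prop where
  smooth : ContDiffOn ℝ ∞ (fun z : ℝ × E3 => φ z.1 z.2) (Ici 0 ×ˢ univ)
  initial : φ 0 = φ₀
  equation : ∀ t : ℝ, 0 < t → ∀ x : E3,
    Complex.I * deriv (fun s => φ s x) t + Laplacian.laplacian (φ t) x
      - (meanField v (φ t) x : ℂ) * φ t x = 0
  sobolev : ∀ T : ℝ, ∃ B : ℝ, ∀ t ∈ Icc 0 T, ∀ k : ℕ, k ≤ 2 →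
    eLpNorm (iteratedFDeriv ℝ k (φ t)) 2 volume ≤ ENNReal.ofReal B

/-- The mass density `ρ = |f|² / 2`. -/
def massDensity (f : E3 → ℂ) (x : E3) : ℝ := (1 / 2) * ‖f x‖ ^ 2

/-- The momentum density `p_j = (1/2i) (f ∇_j f̄ - f̄ ∇_j f)`, which is a real number. -/
def momentumDensity (j : Fin 3) (f : E3 → ℂ) (x : E3) : ℝ :=
  (1 / (2 * Complex.I) *
    (f x * (starRingEnd ℂ) (partialDeriv j f x)
      - (starRingEnd ℂ) (f x) * partialDeriv j f x)).re

/-- The trace `σ = ∑_j σ_jj = 2 ∑_j |∇_j f|²` of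
`σ_jk = ∇_j f̄ ∇_k f + ∇_k f̄ ∇_j f`. -/
def stressTrace (f : E3 → ℂ) (x : E3) : ℝ := ∑ j : Fin 3, 2 * ‖partialDeriv j f x‖ ^ 2

/-- The energy density `e = σ / 2 + W ρ`. -/
def energyDensity (v : E3 → ℝ) (f : E3 → ℂ) (x : E3) : ℝ :=
  (1 / 2) * stressTrace f x + meanField v f x * massDensity f x

/-- The pseudoconformal energy density `e_c = (|x|² / 2) ρ + t x^j p_j + t² e` at time `t`. -/
def pseudoconformalDensity (v : E3 → ℝ) (φ : ℝ → E3 → ℂ) (t : ℝ) (x : E3) : ℝ :=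
  ‖x‖ ^ 2 / 2 * massDensity (φ t) x + t * ∑ j : Fin 3, x j * momentumDensity j (φ t) x
    + t ^ 2 * energyDensity v (φ t) x

/-- The pseudoconformal energy `E_c(t) = ∫ e_c(t, x) dx`; it is finite when the (non-negative, for
`v ≥ 0`) density is integrable. -/
def pseudoconformalEnergy (v : E3 → ℝ) (φ : ℝ → E3 → ℂ) (t : ℝ) : ℝ :=
  ∫ x, pseudoconformalDensity v φ t x

end Hartree

end

/-!
The transform `Ψ(t, y) = t^{3/2} exp(-i t |y|² / 4) φ(t, t y)` turns the equation into
`i ∂ₜΨ + t⁻² ΔΨ - (v(t ·) * |Ψ|²) Ψ = 0`, preserves the mass, and turns the pseudoconformal energy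
at time one into the sum of the kinetic energy `K = ∫ |∇Ψ|²` and of the interaction energy.
For every weight `w`, with `kₜ(x) = w(t) t² v(t x)`,
`d/dt (w K + ½ ∬ kₜ(x - y) |Ψ(x)|² |Ψ(y)|²) = w' K + ½ ∬ (∂ₜkₜ)(x - y) |Ψ(x)|² |Ψ(y)|²`.

For `w = t⁻¹` the right-hand side is non-positive since `t v(t x) = χ(t |x|) / |x|` decreases in
`t`; hence `K ≤ E t`. For `w = 1` the monotonicity of `χ` bounds it by
`∫ t v(t ·) ‖Ψ‖₄⁴ ≲ t⁻² ‖Ψ‖₄⁴`. Interpolating `L⁴` between the conserved mass and the Sobolev bound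
`‖Ψ‖₆ ≲ K^{1/2}`, the linear growth of `K` makes this `O(t^{-1/2})`, so that `K = O(t^{1/2})`.
The Sobolev inequality once more, undone through the transform, gives the decay in `L⁶`, and
interpolation with the mass gives the decay in `L⁴`.

The energy law is integrated against spatial cutoffs. Removing them requires second moments of
`φ`: they are finite at time one because the pseudoconformal energy is, and they stay finite by a
Gronwall argument based on the `H²` bounds.
-/

noncomputable section

namespace Hartree

open Filter Topology
open scoped NNReal ComplexConjugate

/-! ### Cut-off functions -/

section Cutoff

lemma norm_inv_nat_add_one_smul {W : Type*} [NormedAddCommGroup W] [NormedSpace ℝ W] (n : ℕ)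
    (x : W) : ‖(n + 1 : ℝ)⁻¹ • x‖ = ‖x‖ / (n + 1) := by
  rw [norm_smul, norm_inv, Real.norm_of_nonneg (by positivity), div_eq_inv_mul]

variable {V : Type*} [NormedAddCommGroup V] [NormedSpace ℝ V] [FiniteDimensional ℝ V]

variable (V) in
/-- A fixed smooth bump, equal to `1` on the unit ball and supported in the ball of radius `2`. -/
def unitBump : ContDiffBump (0 : V) := ⟨1, 2, one_pos, one_lt_two⟩

/-- The dilated cut-off `x ↦ η(x / (n + 1))`, where `η` is the unit bump; the shift makes it
meaningful for `n = 0`. -/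
def cutoff (n : ℕ) (x : V) : ℝ := unitBump V ((n + 1 : ℝ)⁻¹ • x)

variable (V) in
/-- The Lipschitz constant `sup |∇η|` of the unit bump. -/
def bumpSlope : ℝ := ⨆ x, ‖fderiv ℝ (unitBump V) x‖

lemma contDiff_cutoff {k : ℕ∞} (n : ℕ) : ContDiff ℝ k (cutoff n : V → ℝ) :=
  (unitBump V).contDiff.comp (contDiff_const_smul _)

lemma continuous_cutoff (n : ℕ) : Continuous (cutoff n : V → ℝ) :=
  (contDiff_cutoff (k := 0) n).continuous

lemma cutoff_nonneg (n : ℕ) (x : V) : 0 ≤ cutoff n x := (unitBump V).nonneg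

lemma cutoff_le_one (n : ℕ) (x : V) : cutoff n x ≤ 1 := (unitBump V).le_one

lemma norm_cutoff_le_one (n : ℕ) (x : V) : ‖cutoff n x‖ ≤ 1 := by
  rw [Real.norm_of_nonneg (cutoff_nonneg n x)]
  exact cutoff_le_one n x

lemma hasCompactSupport_cutoff (n : ℕ) : HasCompactSupport (cutoff n : V → ℝ) :=
  (unitBump V).hasCompactSupport.comp_smul (inv_ne_zero (by positivity))

lemma cutoff_eq_one {n : ℕ} {x : V} (hx : ‖x‖ ≤ n + 1) : cutoff n x = 1 := by
  refine (unitBump V).one_of_mem_closedBall ?_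
  rw [mem_closedBall_zero_iff, norm_inv_nat_add_one_smul]
  exact (div_le_one (by positivity)).2 hx

lemma cutoff_eventuallyEq_one (x : V) : ∀ᶠ n in atTop, cutoff n =ᶠ[𝓝 x] fun _ => 1 := by
  filter_upwards [eventually_ge_atTop ⌈‖x‖⌉₊] with n hn
  have hxn : ‖x‖ < n + 1 := (Nat.ceil_le.1 hn).trans_lt (lt_add_one _)
  filter_upwards [continuous_norm.continuousAt.eventually_lt_const hxn] with y hy
  exact cutoff_eq_one hy.le

lemma tendsto_cutoff (x : V) : Tendsto (fun n => cutoff n x) atTop (𝓝 1) :=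
  tendsto_const_nhds.congr' ((cutoff_eventuallyEq_one x).mono fun _ h => h.eq_of_nhds.symm)

lemma tendsto_fderiv_cutoff (x e : V) :
    Tendsto (fun n => fderiv ℝ (cutoff n) x e) atTop (𝓝 0) :=
  tendsto_const_nhds.congr' ((cutoff_eventuallyEq_one x).mono fun _ h => by simp [h.fderiv_eq])

lemma fderiv_cutoff (n : ℕ) (x : V) :
    fderiv ℝ (cutoff n) x = (n + 1 : ℝ)⁻¹ • fderiv ℝ (unitBump V) ((n + 1 : ℝ)⁻¹ • x) :=
  fderiv_comp_smul _

lemma norm_fderiv_unitBump_le (x : V) : ‖fderiv ℝ (unitBump V) x‖ ≤ bumpSlope V := by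
  obtain ⟨L, hL⟩ := ((unitBump V).hasCompactSupport.fderiv (𝕜 := ℝ)).exists_bound_of_continuous
    (((unitBump V).contDiff (n := 1)).continuous_fderiv one_ne_zero)
  exact le_ciSup (f := fun x => ‖fderiv ℝ (unitBump V) x‖) ⟨L, forall_mem_range.2 hL⟩ x

lemma bumpSlope_nonneg : 0 ≤ bumpSlope V := (norm_nonneg _).trans (norm_fderiv_unitBump_le 0)

lemma norm_fderiv_cutoff_le (n : ℕ) (x : V) :
    ‖fderiv ℝ (cutoff n) x‖ ≤ bumpSlope V / (n + 1) := by
  have hpos : (0 : ℝ) < n + 1 := by positivity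
  rw [fderiv_cutoff, norm_smul, norm_inv, Real.norm_of_nonneg hpos.le, div_eq_inv_mul]
  gcongr
  exact norm_fderiv_unitBump_le _

lemma norm_fderiv_cutoff_le_bumpSlope (n : ℕ) (x : V) :
    ‖fderiv ℝ (cutoff n) x‖ ≤ bumpSlope V :=
  (norm_fderiv_cutoff_le n x).trans (div_le_self bumpSlope_nonneg (by simp))

lemma fderiv_cutoff_eq_zero {n : ℕ} {x : V} (hx : 2 * (n + 1) < ‖x‖) :
    fderiv ℝ (cutoff n) x = 0 := by
  have hsupp : (n + 1 : ℝ)⁻¹ • x ∉ tsupport (unitBump V) := by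
    rw [(unitBump V).tsupport_eq, mem_closedBall_zero_iff, norm_inv_nat_add_one_smul, not_le,
      lt_div_iff₀ (by positivity)]
    exact hx
  rw [fderiv_cutoff, image_eq_zero_of_notMem_tsupport fun h => hsupp (tsupport_fderiv_subset ℝ h),
    smul_zero]

lemma norm_mul_norm_fderiv_cutoff_le (n : ℕ) (x : V) :
    ‖x‖ * ‖fderiv ℝ (cutoff n) x‖ ≤ 2 * bumpSlope V := by
  have hL := bumpSlope_nonneg (V := V)
  rcases le_or_gt ‖x‖ (2 * (n + 1)) with hx | hx
  · calc ‖x‖ * ‖fderiv ℝ (cutoff n) x‖ ≤ 2 * (n + 1) * (bumpSlope V / (n + 1)) := by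
          gcongr
          exact norm_fderiv_cutoff_le n x
      _ = 2 * bumpSlope V := by field_simp
  · rw [fderiv_cutoff_eq_zero hx, norm_zero, mul_zero]
    positivity

lemma norm_fderiv_cutoff_smul_le {F : Type*} [NormedAddCommGroup F] [NormedSpace ℝ F] {u : V → F}
    (hu : Differentiable ℝ u) (n : ℕ) (x : V) :
    ‖fderiv ℝ (fun x => cutoff n x • u x) x‖ ≤
      ‖fderiv ℝ u x‖ + bumpSlope V / (n + 1) * ‖u x‖ := by
  rw [fderiv_fun_smul ((contDiff_cutoff (k := 1) n).differentiable one_ne_zero x) (hu x)]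
  refine (norm_add_le _ _).trans (add_le_add ?_ ?_)
  · rw [norm_smul]
    exact mul_le_of_le_one_left (norm_nonneg _) (norm_cutoff_le_one n x)
  · rw [ContinuousLinearMap.norm_smulRight_apply]
    gcongr
    exact norm_fderiv_cutoff_le n x

end Cutoff

/-! ### The Sobolev inequality and interpolation -/

section Sobolev

variable {V F : Type*} [NormedAddCommGroup V] [NormedSpace ℝ V] [FiniteDimensional ℝ V]
  [MeasurableSpace V] [BorelSpace V] [NormedAddCommGroup F] [NormedSpace ℝ F]

lemma eLpNorm_fderiv_cutoff_smul_le (μ : Measure V) {u : V → F} (hu : ContDiff ℝ 1 u) {p : ℝ≥0∞}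
    (hp : 1 ≤ p) (n : ℕ) :
    eLpNorm (fderiv ℝ fun x => cutoff n x • u x) p μ ≤
      eLpNorm (fderiv ℝ u) p μ + ENNReal.ofReal (bumpSlope V / (n + 1)) * eLpNorm u p μ := by
  have hL := bumpSlope_nonneg (V := V)
  have hgrad : AEStronglyMeasurable (fun x => ‖fderiv ℝ u x‖) μ :=
    (hu.continuous_fderiv one_ne_zero).norm.aestronglyMeasurable
  have hval : AEStronglyMeasurable (fun x => bumpSlope V / (n + 1) * ‖u x‖) μ :=
    (hu.continuous.norm.const_mul _).aestronglyMeasurable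
  refine (eLpNorm_mono_real
    (norm_fderiv_cutoff_smul_le (hu.differentiable one_ne_zero) n)).trans ?_
  refine (eLpNorm_add_le hgrad hval hp).trans ?_
  rw [eLpNorm_norm]
  gcongr
  refine eLpNorm_le_mul_eLpNorm_of_ae_le_mul (ae_of_all _ fun x => ?_) p
  rw [norm_mul, norm_norm, Real.norm_of_nonneg (by positivity)]

/-- The compact support required by the Gagliardo–Nirenberg–Sobolev inequality is removed by
truncation: the error `‖u ∇η_n‖_p` is `O(1 / n)`. -/
lemma eLpNorm_le_eLpNorm_fderiv_of_eLpNorm_ne_top [FiniteDimensional ℝ F] (μ : Measure V)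
    [μ.IsAddHaarMeasure] {u : V → F} (hu : ContDiff ℝ 1 u) {p p' : ℝ≥0} (hp : 1 ≤ p)
    (hn : 0 < Module.finrank ℝ V) (hp' : (p' : ℝ)⁻¹ = (p : ℝ)⁻¹ - (Module.finrank ℝ V : ℝ)⁻¹)
    (hup : eLpNorm u p μ ≠ ⊤) :
    eLpNorm u p' μ ≤ SNormLESNormFDerivOfEqConst F μ p * eLpNorm (fderiv ℝ u) p μ := by
  have hcd : ∀ n, ContDiff ℝ 1 fun x => cutoff n x • u x := fun n => (contDiff_cutoff n).smul hu
  have htrunc : ∀ n : ℕ, eLpNorm (fun x => cutoff n x • u x) p' μ ≤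
      SNormLESNormFDerivOfEqConst F μ p * (eLpNorm (fderiv ℝ u) p μ
        + ENNReal.ofReal (bumpSlope V / (n + 1)) * eLpNorm u p μ) := fun n =>
    (eLpNorm_le_eLpNorm_fderiv_of_eq μ (hcd n) (hasCompactSupport_cutoff n).smul_right
      hp hn hp').trans (by gcongr; exact eLpNorm_fderiv_cutoff_smul_le μ hu (by simpa using hp) n)
  have herror : Tendsto (fun n : ℕ => ENNReal.ofReal (bumpSlope V / (n + 1)) * eLpNorm u p μ)
      atTop (𝓝 0) := by
    have h := tendsto_one_div_add_atTop_nhds_zero_nat (𝕜 := ℝ).const_mul (bumpSlope V)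
    simp only [mul_one_div, mul_zero] at h
    simpa using ENNReal.Tendsto.mul_const (ENNReal.tendsto_ofReal h) (Or.inr hup)
  have hlim := ENNReal.Tendsto.const_mul (herror.const_add (eLpNorm (fderiv ℝ u) p μ))
    (Or.inr (ENNReal.coe_ne_top (r := SNormLESNormFDerivOfEqConst F μ p)))
  rw [add_zero] at hlim
  refine (Lp.eLpNorm_lim_le_liminf_eLpNorm (fun n => (hcd n).continuous.aestronglyMeasurable) u
    (ae_of_all _ fun x => ?_)).trans
      ((liminf_le_liminf (Eventually.of_forall htrunc)).trans_eq hlim.liminf_eq)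
  simpa using (tendsto_cutoff x).smul_const (u x)

end Sobolev

lemma lintegral_enorm_pow {α F : Type*} [MeasurableSpace α] {μ : Measure α} [NormedAddCommGroup F]
    (f : α → F) {n : ℕ} (hn : n ≠ 0) : ∫⁻ x, ‖f x‖ₑ ^ n ∂μ = eLpNorm f n μ ^ n := by
  simpa using (eLpNorm_nnreal_pow_eq_lintegral (f := f) (μ := μ) (p := n)
    (by exact_mod_cast hn)).symm

lemma sum_smul_single {ι : Type*} [Fintype ι] [DecidableEq ι] (y : EuclideanSpace ℝ ι) :
    ∑ j, y j • EuclideanSpace.single j (1 : ℝ) = y := by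
  ext i
  simp [Finset.sum_apply, Pi.single_apply]

lemma norm_sq_le_sum_norm_sq_single {ι F : Type*} [Fintype ι] [DecidableEq ι]
    [NormedAddCommGroup F] [NormedSpace ℝ F] (L : EuclideanSpace ℝ ι →L[ℝ] F) :
    ‖L‖ ^ 2 ≤ ∑ j, ‖L (EuclideanSpace.single j 1)‖ ^ 2 := by
  have h0 : 0 ≤ ∑ j, ‖L (EuclideanSpace.single j 1)‖ ^ 2 := by positivity
  rw [← Real.le_sqrt (norm_nonneg _) h0]
  refine L.opNorm_le_bound (Real.sqrt_nonneg _) fun x => ?_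
  calc ‖L x‖ = ‖∑ j, x j • L (EuclideanSpace.single j 1)‖ := by
        conv_lhs => rw [← sum_smul_single x]
        simp only [map_sum, map_smul]
    _ ≤ ∑ j, ‖L (EuclideanSpace.single j 1)‖ * ‖x j‖ := by
        refine (norm_sum_le _ _).trans (Finset.sum_le_sum fun j _ => ?_)
        rw [norm_smul, mul_comm]
    _ ≤ √(∑ j, ‖L (EuclideanSpace.single j 1)‖ ^ 2) * √(∑ j, ‖x j‖ ^ 2) :=
        Real.sum_mul_le_sqrt_mul_sqrt _ _ _
    _ = _ := by rw [EuclideanSpace.norm_eq]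

/-- The constant in the Sobolev inequality `∫ |u|⁶ ≤ S (∫ |∇u|²)³` on `ℝ³`. -/
def sobolevConst : ℝ≥0 := SNormLESNormFDerivOfEqConst ℂ (volume : Measure E3) 2 ^ 6

lemma lintegral_enorm_pow_six_le {u : E3 → ℂ} (hu : ContDiff ℝ 1 u)
    (hu2 : ∫⁻ x, ‖u x‖ₑ ^ 2 ≠ ⊤) : ∫⁻ x, ‖u x‖ₑ ^ 6 ≤
      sobolevConst * (∫⁻ x, ENNReal.ofReal (∑ j, ‖partialDeriv j u x‖ ^ 2)) ^ 3 := by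
  have hu2' : eLpNorm u 2 volume ≠ ⊤ := by
    rw [lintegral_enorm_pow u two_ne_zero] at hu2
    exact fun h => hu2 (by simp [h])
  have hsob := eLpNorm_le_eLpNorm_fderiv_of_eLpNorm_ne_top volume hu (p := 2) (p' := 6)
    (by norm_num) (by simp) (by simp; norm_num) hu2'
  calc ∫⁻ x, ‖u x‖ₑ ^ 6 = eLpNorm u 6 volume ^ 6 := lintegral_enorm_pow u (by norm_num)
    _ ≤ (SNormLESNormFDerivOfEqConst ℂ (volume : Measure E3) 2
          * eLpNorm (fderiv ℝ u) 2 volume) ^ 6 := pow_le_pow_left' hsob 6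
    _ = sobolevConst * (∫⁻ x, ‖fderiv ℝ u x‖ₑ ^ 2) ^ 3 := by
        rw [lintegral_enorm_pow _ two_ne_zero, mul_pow, ← pow_mul, sobolevConst, ENNReal.coe_pow]
        rfl
    _ ≤ _ := by
        gcongr with x
        rw [← ofReal_norm, ← ENNReal.ofReal_pow (norm_nonneg _)]
        exact ENNReal.ofReal_le_ofReal (norm_sq_le_sum_norm_sq_single _)

lemma sq_lintegral_mul_le {α : Type*} [MeasurableSpace α] {μ : Measure α} {f g : α → ℝ≥0∞}
    (hf : AEMeasurable f μ) (hg : AEMeasurable g μ) :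
    (∫⁻ x, f x * g x ∂μ) ^ 2 ≤ (∫⁻ x, f x ^ 2 ∂μ) * ∫⁻ x, g x ^ 2 ∂μ := by
  have hsqrt : ∀ a : ℝ≥0∞, (a ^ 2) ^ (1 / 2 : ℝ) = a := fun a => by
    rw [← ENNReal.rpow_natCast_mul]
    norm_num
  have hsq : ∀ a : ℝ≥0∞, (a ^ (1 / 2 : ℝ)) ^ 2 = a := fun a => by
    rw [← ENNReal.rpow_mul_natCast]
    norm_num
  have h := ENNReal.lintegral_mul_norm_pow_le (hf.pow_const 2) (hg.pow_const 2)
    (p := 1 / 2) (q := 1 / 2) (by norm_num) (by norm_num) (by norm_num)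
  simp only [hsqrt] at h
  simpa only [mul_pow, hsq] using pow_le_pow_left' h 2

lemma sq_lintegral_pow_four_le {α : Type*} [MeasurableSpace α] {μ : Measure α} {f : α → ℝ≥0∞}
    (hf : AEMeasurable f μ) :
    (∫⁻ x, f x ^ 4 ∂μ) ^ 2 ≤ (∫⁻ x, f x ^ 2 ∂μ) * ∫⁻ x, f x ^ 6 ∂μ := by
  have h := sq_lintegral_mul_le hf (hf.pow_const 3)
  simpa only [← pow_succ', ← pow_mul] using h

lemma lintegral_pow_four_le_sqrt {α : Type*} [MeasurableSpace α] {μ : Measure α} {f : α → ℝ≥0∞}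
    (hf : AEMeasurable f μ) {D : ℝ}
    (hD : (∫⁻ x, f x ^ 2 ∂μ) * ∫⁻ x, f x ^ 6 ∂μ ≤ ENNReal.ofReal D) :
    ∫⁻ x, f x ^ 4 ∂μ ≤ ENNReal.ofReal (√D) := by
  refine (ENNReal.pow_le_pow_left_iff two_ne_zero).1
    (((sq_lintegral_pow_four_le hf).trans hD).trans ?_)
  rw [← ENNReal.ofReal_pow (Real.sqrt_nonneg _)]
  refine ENNReal.ofReal_le_ofReal ?_
  rcases le_total 0 D with h | h
  · rw [Real.sq_sqrt h]
  · exact h.trans (sq_nonneg _)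

/-! ### The potential and the interaction kernels -/

namespace IsDecreasingCutoff

variable {χ : ℝ → ℝ} (hχ : IsDecreasingCutoff χ)
include hχ

lemma nonneg {r : ℝ} (hr : 0 ≤ r) : 0 ≤ χ r := by
  obtain ⟨R, hR⟩ := hχ.compactSupport.isCompact.isBounded.subset_closedBall 0
  have h0 : χ (max r (R + 1)) = 0 := by
    refine image_eq_zero_of_notMem_tsupport fun h => ?_
    have hle : |max r (R + 1)| ≤ R := by simpa using hR h
    linarith [(le_abs_self _).trans hle, le_max_right r (R + 1)]
  rw [← h0]
  exact hχ.decreasing hr (hr.trans (le_max_left _ _)) (le_max_left _ _)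

lemma deriv_nonpos {r : ℝ} (hr : 0 < r) : deriv χ r ≤ 0 := by
  have h := hχ.decreasing.derivWithin_nonpos (x := r)
  rwa [derivWithin_of_mem_nhds (Ici_mem_nhds hr)] at h

lemma continuous_deriv : Continuous (deriv χ) := hχ.smooth.continuous_deriv (by simp)

lemma div_norm_le_potential {t : ℝ} (ht : 1 ≤ t) (x : E3) :
    χ (t * ‖x‖) / ‖x‖ ≤ potential χ x := by
  have hle : ‖x‖ ≤ t * ‖x‖ := le_mul_of_one_le_left (norm_nonneg x) ht
  rw [potential]
  gcongr
  exact hχ.decreasing (norm_nonneg x) ((norm_nonneg x).trans hle) hle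

lemma potential_nonneg (x : E3) : 0 ≤ potential χ x :=
  div_nonneg (hχ.nonneg (norm_nonneg _)) (norm_nonneg _)

lemma enorm_potential (x : E3) : ‖potential χ x‖ₑ = ENNReal.ofReal (potential χ x) :=
  Real.enorm_of_nonneg (hχ.potential_nonneg x)

lemma potential_smul_le {t : ℝ} (ht : 1 ≤ t) (x : E3) : potential χ (t • x) ≤ potential χ x := by
  have ht0 : 0 ≤ t := zero_le_one.trans ht
  refine le_trans ?_ (hχ.div_norm_le_potential ht x)
  rw [potential, norm_smul, Real.norm_of_nonneg ht0, mul_comm t ‖x‖, ← div_div]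
  exact div_le_self (div_nonneg (hχ.nonneg (by positivity)) (norm_nonneg x)) ht

lemma enorm_potential_smul_le {t : ℝ} (ht : 1 ≤ t) (x : E3) :
    ‖potential χ (t • x)‖ₑ ≤ ‖potential χ x‖ₑ := by
  rw [hχ.enorm_potential, hχ.enorm_potential]
  exact ENNReal.ofReal_le_ofReal (hχ.potential_smul_le ht x)

lemma measurable_potential : Measurable (potential χ) :=
  (hχ.smooth.continuous.comp continuous_norm).measurable.div continuous_norm.measurable

lemma integrable_potential : Integrable (potential χ) := by
  refine (integrable_fun_norm_addHaar volume (f := fun r => χ r / r)).2 ?_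
  have hc : Continuous fun r : ℝ => r * χ r := continuous_id.mul hχ.smooth.continuous
  refine ((hc.integrable_of_hasCompactSupport hχ.compactSupport.mul_left).integrableOn).congr_fun
    (fun r (hr : 0 < r) => ?_) measurableSet_Ioi
  simp only [finrank_euclideanSpace, Fintype.card_fin, Nat.reduceSub, smul_eq_mul]
  field_simp

lemma integrable_potential_sq : Integrable fun x => potential χ x ^ 2 := by
  refine (integrable_fun_norm_addHaar volume (f := fun r => (χ r / r) ^ 2)).2 ?_
  have hc : Continuous fun r : ℝ => χ r * χ r := hχ.smooth.continuous.mul hχ.smooth.continuous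
  refine ((hc.integrable_of_hasCompactSupport hχ.compactSupport.mul_left).integrableOn).congr_fun
    (fun r (hr : 0 < r) => ?_) measurableSet_Ioi
  simp only [finrank_euclideanSpace, Fintype.card_fin, Nat.reduceSub, smul_eq_mul]
  field_simp

lemma lintegral_potential_sq_ne_top : ∫⁻ x : E3, ‖potential χ x‖ₑ ^ 2 ≠ ⊤ := by
  simpa [HasFiniteIntegral, enorm_pow, lt_top_iff_ne_top] using hχ.integrable_potential_sq.2

end IsDecreasingCutoff

lemma potential_neg (χ : ℝ → ℝ) (x : E3) : potential χ (-x) = potential χ x := by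
  simp only [potential, norm_neg]

lemma sq_mul_potential_smul (χ : ℝ → ℝ) {t : ℝ} (ht : 0 < t) (x : E3) :
    t ^ 2 * potential χ (t • x) = t * χ (t * ‖x‖) / ‖x‖ := by
  rw [potential, norm_smul, Real.norm_of_nonneg ht.le]
  rcases eq_or_ne ‖x‖ 0 with hx | hx
  · simp [hx]
  · field_simp

/-- The kernel `w(t) t² v(t x)` of the weighted interaction energy: `t² v(t ·)` is the potential
seen by the pseudoconformal transform, and `w` is a time weight. -/
def kernel (χ w : ℝ → ℝ) (t : ℝ) (x : E3) : ℝ := w t * (t ^ 2 * potential χ (t • x))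

/-- The time derivative of `kernel χ w`. It vanishes at `x = 0` by the convention `a / 0 = 0`. -/
def kernelDeriv (χ w : ℝ → ℝ) (t : ℝ) (x : E3) : ℝ :=
  ((deriv w t * t + w t) * χ (t * ‖x‖) + w t * t * (deriv χ (t * ‖x‖) * ‖x‖)) / ‖x‖

section Kernel

variable {χ w : ℝ → ℝ} (hχ : IsDecreasingCutoff χ)

lemma kernelDeriv_zero (χ w : ℝ → ℝ) (t : ℝ) : kernelDeriv χ w t 0 = 0 := by simp [kernelDeriv]

lemma kernelDeriv_of_ne_zero (χ w : ℝ → ℝ) (t : ℝ) {x : E3} (hx : x ≠ 0) :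
    kernelDeriv χ w t x =
      (deriv w t * t + w t) * (χ (t * ‖x‖) / ‖x‖) + w t * t * deriv χ (t * ‖x‖) := by
  have : ‖x‖ ≠ 0 := norm_ne_zero_iff.2 hx
  rw [kernelDeriv]
  field_simp

include hχ

lemma hasDerivAt_kernel {t : ℝ} (ht : 0 < t) (hw : DifferentiableAt ℝ w t) (x : E3) :
    HasDerivAt (fun s => kernel χ w s x) (kernelDeriv χ w t x) t := by
  have hχ' : HasDerivAt (fun s => χ (s * ‖x‖)) (deriv χ (t * ‖x‖) * ‖x‖) t := by
    have := (hχ.smooth.differentiable (by simp) (t * ‖x‖)).hasDerivAt.scomp t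
      (hasDerivAt_mul_const ‖x‖)
    exact this.congr_deriv (by rw [smul_eq_mul, mul_comm])
  have hprod := ((hw.hasDerivAt.mul (hasDerivAt_id t)).mul hχ').div_const ‖x‖
  refine (hprod.congr_of_eventuallyEq ?_).congr_deriv ?_
  · filter_upwards [lt_mem_nhds ht] with s hs
    rw [kernel, sq_mul_potential_smul χ hs]
    simp only [Pi.mul_apply, id_eq]
    ring
  · simp [kernelDeriv]

lemma continuousOn_kernelDeriv {s : Set ℝ} (hw : ContinuousOn w s) (hw' : ContinuousOn (deriv w) s)
    (x : E3) : ContinuousOn (fun t => kernelDeriv χ w t x) s := by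
  have h1 := hχ.smooth.continuous
  have h2 := hχ.continuous_deriv
  unfold kernelDeriv
  fun_prop

lemma measurable_kernel (t : ℝ) : Measurable (kernel χ w t) := by
  have hv := hχ.measurable_potential
  unfold kernel
  fun_prop

lemma measurable_kernelDeriv (t : ℝ) : Measurable (kernelDeriv χ w t) := by
  have h := hχ.smooth.continuous
  unfold kernelDeriv
  fun_prop

lemma exists_abs_kernel_le {a b : ℝ} (ha : 1 ≤ a) (hw : ContinuousOn w (Icc a b)) :
    ∃ C : ℝ, 0 ≤ C ∧ ∀ t ∈ Icc a b, ∀ x : E3, |kernel χ w t x| ≤ C * potential χ x := by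
  obtain ⟨C, hC⟩ := isCompact_Icc.exists_bound_of_continuousOn
    (f := fun t => w t * t ^ 2) (by fun_prop : ContinuousOn _ (Icc a b))
  refine ⟨|C|, abs_nonneg C, fun t ht x => ?_⟩
  have hv := hχ.potential_nonneg (t • x)
  have hw2 : |w t * t ^ 2| ≤ |C| := (hC t ht).trans (le_abs_self C)
  have hle := hχ.potential_smul_le (ha.trans ht.1) x
  calc |kernel χ w t x| = |w t * t ^ 2| * potential χ (t • x) := by
        rw [kernel, ← mul_assoc, abs_mul, abs_of_nonneg hv]
    _ ≤ |C| * potential χ x := mul_le_mul hw2 hle hv (abs_nonneg C)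

lemma exists_abs_kernelDeriv_le {a b : ℝ} (ha : 1 ≤ a) (hw : ContinuousOn w (Icc a b))
    (hw' : ContinuousOn (deriv w) (Icc a b)) :
    ∃ C : ℝ, 0 ≤ C ∧ ∀ t ∈ Icc a b, ∀ x : E3,
      |kernelDeriv χ w t x| ≤ C * (potential χ x + 1) := by
  obtain ⟨L, hL⟩ := hχ.compactSupport.deriv.exists_bound_of_continuous hχ.continuous_deriv
  obtain ⟨C₁, hC₁⟩ := isCompact_Icc.exists_bound_of_continuousOn
    (f := fun t => deriv w t * t + w t) (by fun_prop : ContinuousOn _ (Icc a b))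
  obtain ⟨C₂, hC₂⟩ := isCompact_Icc.exists_bound_of_continuousOn
    (f := fun t => w t * t) (by fun_prop : ContinuousOn _ (Icc a b))
  have hL0 : 0 ≤ L := (norm_nonneg _).trans (hL 0)
  refine ⟨|C₁| + |C₂| * L, by positivity, fun t ht x => ?_⟩
  have hv := hχ.potential_nonneg x
  rcases eq_or_ne x 0 with rfl | hx
  · rw [kernelDeriv_zero, abs_zero]
    positivity
  have hdiv : |χ (t * ‖x‖) / ‖x‖| ≤ potential χ x := by
    have ht0 : 0 ≤ t := zero_le_one.trans (ha.trans ht.1)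
    rw [abs_of_nonneg (div_nonneg (hχ.nonneg (by positivity)) (norm_nonneg x))]
    exact hχ.div_norm_le_potential (ha.trans ht.1) x
  have hC₁t : |deriv w t * t + w t| ≤ |C₁| := (hC₁ t ht).trans (le_abs_self C₁)
  have hC₂t : |w t * t| ≤ |C₂| := (hC₂ t ht).trans (le_abs_self C₂)
  calc |kernelDeriv χ w t x|
      ≤ |deriv w t * t + w t| * |χ (t * ‖x‖) / ‖x‖| + |w t * t| * |deriv χ (t * ‖x‖)| := by
        rw [kernelDeriv_of_ne_zero χ w t hx, ← abs_mul, ← abs_mul]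
        exact abs_add_le _ _
    _ ≤ |C₁| * potential χ x + |C₂| * L :=
        add_le_add (mul_le_mul hC₁t hdiv (abs_nonneg _) (abs_nonneg C₁))
          (mul_le_mul hC₂t (hL _) (abs_nonneg _) (abs_nonneg C₂))
    _ ≤ (|C₁| + |C₂| * L) * (potential χ x + 1) := by
        nlinarith [abs_nonneg C₁, mul_nonneg (mul_nonneg (abs_nonneg C₂) hL0) hv]

lemma kernelDeriv_one_le {t : ℝ} (ht : 0 < t) (x : E3) :
    kernelDeriv χ (fun _ => 1) t x ≤ t * potential χ (t • x) := by
  rcases eq_or_ne x 0 with rfl | hx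
  · simp [kernelDeriv_zero, potential]
  have hχ' : t * deriv χ (t * ‖x‖) ≤ 0 :=
    mul_nonpos_of_nonneg_of_nonpos ht.le (hχ.deriv_nonpos (mul_pos ht (norm_pos_iff.2 hx)))
  have hdiv : t * (χ (t * ‖x‖) / (t * ‖x‖)) = χ (t * ‖x‖) / ‖x‖ := by field_simp
  rw [kernelDeriv_of_ne_zero _ _ _ hx, potential, norm_smul, Real.norm_of_nonneg ht.le]
  simp only [deriv_const, zero_mul, zero_add, one_mul, hdiv]
  linarith

/-- For `w = 1 / t` the weighted kernel is `χ (t |x|) / |x|`, which decreases in time because `χ`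
does. -/
lemma kernelDeriv_inv_nonpos {t : ℝ} (ht : 0 < t) (x : E3) :
    kernelDeriv χ (fun s => s⁻¹) t x ≤ 0 := by
  rcases eq_or_ne x 0 with rfl | hx
  · rw [kernelDeriv_zero]
  rw [kernelDeriv_of_ne_zero _ _ _ hx, deriv_inv]
  have hcancel : -(t ^ 2)⁻¹ * t + t⁻¹ = 0 := by field_simp; ring
  rw [hcancel, zero_mul, zero_add, inv_mul_cancel₀ ht.ne', one_mul]
  exact hχ.deriv_nonpos (mul_pos ht (norm_pos_iff.2 hx))

end Kernel

/-! ### Balance laws on slabs -/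

/-- Space-time at positive times. -/
def posTime : Set (ℝ × E3) := Ioi 0 ×ˢ univ

/-- The unit vector of `ℝ × ℝ³` in the time direction. -/
def timeDir : ℝ × E3 := (1, 0)

/-- The unit vector of `ℝ × ℝ³` in the `j`-th space direction. -/
def spaceDir (j : Fin 3) : ℝ × E3 := (0, EuclideanSpace.single j 1)

/-- Lebesgue measure on the slab `(a, b] × ℝ³`. -/
def slab (a b : ℝ) : Measure (ℝ × E3) := (volume.restrict (Ioc a b)).prod volume

/-- The source term of the balance law `∂ₜF = div G + source F G`. -/
def source (F : ℝ × E3 → ℝ) (G : Fin 3 → ℝ × E3 → ℝ) (z : ℝ × E3) : ℝ :=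
  fderiv ℝ F z timeDir - ∑ j, fderiv ℝ (G j) z (spaceDir j)

lemma isOpen_posTime : IsOpen posTime := isOpen_Ioi.prod isOpen_univ

lemma mem_posTime {t : ℝ} (ht : 0 < t) (x : E3) : (t, x) ∈ posTime := ⟨ht, mem_univ _⟩

lemma ae_slab_mem_posTime {a b : ℝ} (ha : 0 ≤ a) : ∀ᵐ z ∂(slab a b), z ∈ posTime := by
  have hpos : ∀ᵐ t ∂(volume.restrict (Ioc a b)), 0 < t :=
    (ae_restrict_mem measurableSet_Ioc).mono fun t ht => ha.trans_lt ht.1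
  exact (Measure.quasiMeasurePreserving_fst.ae hpos).mono fun z hz => ⟨hz, mem_univ _⟩

section Slice

variable {F : Type*} [NormedAddCommGroup F] [NormedSpace ℝ F] {f : ℝ × E3 → F} {n : WithTop ℕ∞}

lemma differentiableAt_of_contDiffOn (hf : ContDiffOn ℝ n f posTime) (hn : n ≠ 0) {z : ℝ × E3}
    (hz : z ∈ posTime) : DifferentiableAt ℝ f z :=
  (hf.contDiffAt (isOpen_posTime.mem_nhds hz)).differentiableAt hn

lemma hasFDerivAt_slice (hf : ContDiffOn ℝ n f posTime) (hn : n ≠ 0) {t : ℝ} (ht : 0 < t) (x : E3) :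
    HasFDerivAt (fun y => f (t, y)) ((fderiv ℝ f (t, x)).comp (ContinuousLinearMap.inr ℝ ℝ E3)) x :=
  (differentiableAt_of_contDiffOn hf hn (mem_posTime ht x)).hasFDerivAt.comp x
    (hasFDerivAt_prodMk_right t x)

lemma fderiv_slice (hf : ContDiffOn ℝ n f posTime) (hn : n ≠ 0) {t : ℝ} (ht : 0 < t) (x : E3)
    (j : Fin 3) : fderiv ℝ (fun y => f (t, y)) x (EuclideanSpace.single j 1) =
      fderiv ℝ f (t, x) (spaceDir j) := by
  rw [(hasFDerivAt_slice hf hn ht x).fderiv]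
  rfl

lemma hasDerivAt_slice (hf : ContDiffOn ℝ n f posTime) (hn : n ≠ 0) {t : ℝ} (ht : 0 < t)
    (x : E3) : HasDerivAt (fun s => f (s, x)) (fderiv ℝ f (t, x) timeDir) t := by
  have h : HasFDerivAt (fun s => f (s, x)) _ t :=
    (differentiableAt_of_contDiffOn hf hn (mem_posTime ht x)).hasFDerivAt.comp t
      (hasFDerivAt_prodMk_left t x)
  exact h.hasDerivAt

lemma contDiff_slice (hf : ContDiffOn ℝ n f posTime) {t : ℝ} (ht : 0 < t) :
    ContDiff ℝ n (fun y => f (t, y)) :=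
  contDiffOn_univ.1 (hf.comp (contDiff_prodMk_right t).contDiffOn fun y _ => mem_posTime ht y)

lemma continuousOn_fderiv_apply (hf : ContDiffOn ℝ n f posTime) (hn : 1 ≤ n)
    (v : ℝ × E3) : ContinuousOn (fun z => fderiv ℝ f z v) posTime :=
  (hf.continuousOn_fderiv_of_isOpen isOpen_posTime hn).clm_apply continuousOn_const

lemma contDiffOn_fderiv_apply (hf : ContDiffOn ℝ ∞ f posTime) (v : ℝ × E3) :
    ContDiffOn ℝ ∞ (fun z => fderiv ℝ f z v) posTime :=
  (hf.fderiv_of_isOpen isOpen_posTime (by simp)).clm_apply contDiffOn_const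

end Slice

lemma integral_sub_integral_eq {X : Type*} [MeasurableSpace X] {μ : Measure X} [SFinite μ]
    {F F' : ℝ → X → ℝ} {a b : ℝ} (hab : a ≤ b)
    (hF : ∀ x, ∀ t ∈ Icc a b, HasDerivAt (fun s => F s x) (F' t x) t)
    (hF' : ∀ x, ContinuousOn (fun t => F' t x) (Icc a b))
    (hint : Integrable (fun z : ℝ × X => F' z.1 z.2) ((volume.restrict (Ioc a b)).prod μ))
    (ha : Integrable (F a) μ) (hb : Integrable (F b) μ) :
    (∫ x, F b x ∂μ) - ∫ x, F a x ∂μ = ∫ z, F' z.1 z.2 ∂((volume.restrict (Ioc a b)).prod μ) := by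
  rw [integral_prod_symm _ hint, ← integral_sub hb ha]
  refine integral_congr_ae (ae_of_all _ fun x => ?_)
  simp only
  rw [← intervalIntegral.integral_of_le hab]
  exact (intervalIntegral.integral_eq_sub_of_hasDerivAt
    (fun t ht => hF x t (uIcc_of_le hab ▸ ht)) ((hF' x).intervalIntegrable_of_Icc hab)).symm

lemma integral_fderiv_eq_zero_of_hasCompactSupport {V F : Type*} [NormedAddCommGroup V]
    [NormedSpace ℝ V] [FiniteDimensional ℝ V] [MeasurableSpace V] [BorelSpace V]
    [NormedAddCommGroup F] [NormedSpace ℝ F] {μ : Measure V} [μ.IsAddHaarMeasure] {g : V → F}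
    (hg : ContDiff ℝ 1 g) (hgc : HasCompactSupport g) (v : V) : ∫ x, fderiv ℝ g x v ∂μ = 0 := by
  have hg' : Continuous fun x => fderiv ℝ g x v :=
    (hg.continuous_fderiv one_ne_zero).clm_apply continuous_const
  have h := integral_smul_fderiv_eq_neg_fderiv_smul_of_integrable (𝕜 := ℝ) (μ := μ)
    (f := fun _ => 1) (g := g) (v := v) (by simp) (by
      simpa using hg'.integrable_of_hasCompactSupport (hgc.fderiv_apply (𝕜 := ℝ) v))
    (by simpa using hg.continuous.integrable_of_hasCompactSupport hgc)
    (fun x _ => differentiableAt_const _) (fun x _ => hg.differentiable one_ne_zero x)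
  simpa using h

section Support

variable {f : ℝ × E3 → ℝ} {K : Set E3} {a b : ℝ}

lemma integrable_slab_of_continuousOn (ha : 0 < a) (hf : ContinuousOn f posTime) (hK : IsCompact K)
    (hfK : ∀ t, ∀ x ∉ K, f (t, x) = 0) : Integrable f (slab a b) := by
  have hsub : Icc a b ×ˢ K ⊆ posTime := fun z hz => ⟨ha.trans_le hz.1.1, mem_univ _⟩
  have hcompact : IntegrableOn f (Icc a b ×ˢ K) :=
    (hf.mono hsub).integrableOn_compact (isCompact_Icc.prod hK)
  have hfull : IntegrableOn f (Icc a b ×ˢ univ) :=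
    hcompact.of_forall_sdiff_eq_zero (measurableSet_Icc.prod MeasurableSet.univ)
      fun z hz => hfK z.1 z.2 fun hzK => hz.2 ⟨hz.1.1, hzK⟩
  have hslab : slab a b = volume.restrict (Ioc a b ×ˢ univ) := by
    rw [slab, Measure.volume_eq_prod, ← Measure.prod_restrict, Measure.restrict_univ]
  rw [hslab]
  exact hfull.mono_set (prod_mono Ioc_subset_Icc_self le_rfl)

lemma fderiv_eq_zero_of_notMem (hK : IsClosed K) (hfK : ∀ t, ∀ x ∉ K, f (t, x) = 0) (t : ℝ) {x : E3}
    (hx : x ∉ K) : fderiv ℝ f (t, x) = 0 := by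
  have hf0 : f =ᶠ[𝓝 (t, x)] fun _ => 0 := by
    filter_upwards [continuous_snd.continuousAt.preimage_mem_nhds (hK.isOpen_compl.mem_nhds hx)]
      with z hz using hfK z.1 z.2 hz
  rw [hf0.fderiv_eq, fderiv_fun_const, Pi.zero_apply]

lemma integrable_slab_fderiv (ha : 0 < a) (hf : ContDiffOn ℝ 1 f posTime) (hK : IsCompact K)
    (hfK : ∀ t, ∀ x ∉ K, f (t, x) = 0) (v : ℝ × E3) :
    Integrable (fun z => fderiv ℝ f z v) (slab a b) :=
  integrable_slab_of_continuousOn ha (continuousOn_fderiv_apply hf le_rfl v) hK fun t x hx => by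
    rw [fderiv_eq_zero_of_notMem hK.isClosed hfK t hx, zero_apply]

lemma integral_slab_fderiv_spaceDir (ha : 0 < a) (hf : ContDiffOn ℝ 1 f posTime) (hK : IsCompact K)
    (hfK : ∀ t, ∀ x ∉ K, f (t, x) = 0) (j : Fin 3) :
    ∫ z, fderiv ℝ f z (spaceDir j) ∂(slab a b) = 0 := by
  have hint := integrable_slab_fderiv (b := b) ha hf hK hfK (spaceDir j)
  rw [slab] at hint ⊢
  rw [integral_prod _ hint]
  refine setIntegral_eq_zero_of_forall_eq_zero fun t ht => ?_
  have ht0 : 0 < t := ha.trans ht.1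
  simp only [← fderiv_slice hf one_ne_zero ht0]
  exact integral_fderiv_eq_zero_of_hasCompactSupport (contDiff_slice hf ht0)
    (HasCompactSupport.intro hK fun x hx => hfK t x hx) _

lemma integral_slab_fderiv_timeDir (ha : 0 < a) (hab : a ≤ b) (hf : ContDiffOn ℝ 1 f posTime)
    (hK : IsCompact K) (hfK : ∀ t, ∀ x ∉ K, f (t, x) = 0) :
    ∫ z, fderiv ℝ f z timeDir ∂(slab a b) = (∫ x, f (b, x)) - ∫ x, f (a, x) := by
  have hslice : ∀ {t : ℝ}, 0 < t → Integrable fun x => f (t, x) := fun {t} ht =>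
    (contDiff_slice hf ht).continuous.integrable_of_hasCompactSupport
      (HasCompactSupport.intro hK fun x hx => hfK t x hx)
  exact (integral_sub_integral_eq (F := fun t x => f (t, x)) hab
    (fun x t ht => hasDerivAt_slice hf one_ne_zero (ha.trans_le ht.1) x)
    (fun x => (continuousOn_fderiv_apply hf le_rfl timeDir).comp (by fun_prop)
      fun t ht => mem_posTime (ha.trans_le ht.1) x)
    (integrable_slab_fderiv ha hf hK hfK timeDir) (hslice ha) (hslice (ha.trans_le hab))).symm

end Support

section Balance

variable {F : ℝ × E3 → ℝ} {G : Fin 3 → ℝ × E3 → ℝ} (hF : ContDiffOn ℝ 1 F posTime)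
  (hG : ∀ j, ContDiffOn ℝ 1 (G j) posTime) {a b : ℝ}
include hF hG

lemma continuousOn_source : ContinuousOn (source F G) posTime :=
  (continuousOn_fderiv_apply hF le_rfl _).sub
    (continuousOn_finsetSum _ fun j _ => continuousOn_fderiv_apply (hG j) le_rfl _)

lemma source_mul {η : E3 → ℝ} (hη : ContDiff ℝ 1 η) {z : ℝ × E3} (hz : z ∈ posTime) :
    source (fun z => η z.2 * F z) (fun j z => η z.2 * G j z) z =
      η z.2 * source F G z - ∑ j, fderiv ℝ η z.2 (EuclideanSpace.single j 1) * G j z := by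
  have hη' : HasFDerivAt (fun z : ℝ × E3 => η z.2)
      ((fderiv ℝ η z.2).comp (ContinuousLinearMap.snd ℝ ℝ E3)) z :=
    (hη.differentiable one_ne_zero z.2).hasFDerivAt.comp z hasFDerivAt_snd
  have hmul : ∀ {f : ℝ × E3 → ℝ}, ContDiffOn ℝ 1 f posTime → ∀ v : ℝ × E3,
      fderiv ℝ (fun z => η z.2 * f z) z v = η z.2 * fderiv ℝ f z v + fderiv ℝ η z.2 v.2 * f z :=
    fun {f} hf v => by
      have h : HasFDerivAt (fun z => η z.2 * f z) _ z :=
        hη'.mul (differentiableAt_of_contDiffOn hf one_ne_zero hz).hasFDerivAt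
      rw [h.fderiv]
      simp [mul_comm]
  simp only [source, hmul hF, hmul (hG _), timeDir, spaceDir, map_zero, zero_mul, add_zero,
    Finset.sum_add_distrib, mul_sub, Finset.mul_sum]
  ring

variable (ha : 0 < a)
include ha

lemma integrable_source_of_isCompact {K : Set E3} (hK : IsCompact K)
    (hFK : ∀ t, ∀ x ∉ K, F (t, x) = 0) (hGK : ∀ j t, ∀ x ∉ K, G j (t, x) = 0) :
    Integrable (source F G) (slab a b) :=
  (integrable_slab_fderiv ha hF hK hFK _).sub
    (integrable_finsetSum _ fun j _ => integrable_slab_fderiv ha (hG j) hK (hGK j) _)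

lemma integrable_weighted_source {η : E3 → ℝ} (hη : ContDiff ℝ 1 η) (hηc : HasCompactSupport η) :
    Integrable (fun z => η z.2 * source F G z
      - ∑ j, fderiv ℝ η z.2 (EuclideanSpace.single j 1) * G j z) (slab a b) := by
  have hη2 : ContDiffOn ℝ 1 (fun z : ℝ × E3 => η z.2) posTime := (hη.comp contDiff_snd).contDiffOn
  have hη0 : ∀ x ∉ tsupport η, η x = 0 := fun x hx => image_eq_zero_of_notMem_tsupport hx
  refine (integrable_source_of_isCompact (b := b) (hη2.mul hF) (fun j => hη2.mul (hG j)) ha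
    hηc.isCompact (fun t x hx => ?_) fun j t x hx => ?_).congr
      ((ae_slab_mem_posTime ha.le).mono fun z hz => source_mul hF hG hη hz)
  all_goals simp [hη0 x hx]

variable (hab : a ≤ b)
include hab

lemma balance_of_isCompact {K : Set E3} (hK : IsCompact K)
    (hFK : ∀ t, ∀ x ∉ K, F (t, x) = 0) (hGK : ∀ j t, ∀ x ∉ K, G j (t, x) = 0) :
    (∫ x, F (b, x)) - ∫ x, F (a, x) = ∫ z, source F G z ∂(slab a b) := by
  have hint := fun j => integrable_slab_fderiv (b := b) ha (hG j) hK (hGK j) (spaceDir j)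
  simp only [source]
  rw [integral_sub (integrable_slab_fderiv ha hF hK hFK _)
      (integrable_finsetSum _ fun j _ => hint j),
    integral_finsetSum _ fun j _ => hint j, integral_slab_fderiv_timeDir ha hab hF hK hFK]
  simp only [fun j => integral_slab_fderiv_spaceDir (b := b) ha (hG j) hK (hGK j) j,
    Finset.sum_const_zero, sub_zero]

lemma weighted_balance {η : E3 → ℝ} (hη : ContDiff ℝ 1 η) (hηc : HasCompactSupport η) :
    (∫ x, η x * F (b, x)) - ∫ x, η x * F (a, x) = ∫ z, (η z.2 * source F G z
      - ∑ j, fderiv ℝ η z.2 (EuclideanSpace.single j 1) * G j z) ∂(slab a b) := by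
  have hη2 : ContDiffOn ℝ 1 (fun z : ℝ × E3 => η z.2) posTime := (hη.comp contDiff_snd).contDiffOn
  have hη0 : ∀ x ∉ tsupport η, η x = 0 := fun x hx => image_eq_zero_of_notMem_tsupport hx
  rw [balance_of_isCompact (hη2.mul hF) (fun j => hη2.mul (hG j)) ha hab hηc.isCompact
    (fun t x hx => by simp [hη0 x hx]) fun j t x hx => by simp [hη0 x hx]]
  exact integral_congr_ae ((ae_slab_mem_posTime ha.le).mono fun z hz => source_mul hF hG hη hz)

end Balance

lemma tendsto_integral_cutoff_mul {V : Type*} [NormedAddCommGroup V] [NormedSpace ℝ V]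
    [FiniteDimensional ℝ V] [MeasurableSpace V] [BorelSpace V] {μ : Measure V} {f : V → ℝ}
    (hf : Integrable f μ) :
    Tendsto (fun n => ∫ x, cutoff n x * f x ∂μ) atTop (𝓝 (∫ x, f x ∂μ)) := by
  refine tendsto_integral_of_dominated_convergence (fun x => ‖f x‖) (fun n => ?_) hf.norm
    (fun n => ae_of_all _ fun x => ?_) (ae_of_all _ fun x => ?_)
  · exact (continuous_cutoff n).aestronglyMeasurable.mul hf.aestronglyMeasurable
  · rw [norm_mul]
    exact mul_le_of_le_one_left (norm_nonneg _) (norm_cutoff_le_one n x)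
  · simpa using (tendsto_cutoff x).mul_const (f x)

lemma norm_fderiv_cutoff_single_mul_le (n : ℕ) (j : Fin 3) (x : E3) (g : ℝ) :
    ‖fderiv ℝ (cutoff n) x (EuclideanSpace.single j 1) * g‖ ≤
      3 * bumpSlope E3 * ‖g / (1 + ‖x‖)‖ := by
  have hslope : (1 + ‖x‖) * ‖fderiv ℝ (cutoff n) x‖ ≤ 3 * bumpSlope E3 := by
    linarith [norm_fderiv_cutoff_le_bumpSlope n x, norm_mul_norm_fderiv_cutoff_le n x]
  have hpos : 0 < 1 + ‖x‖ := by positivity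
  rw [norm_mul, norm_div, Real.norm_of_nonneg hpos.le, mul_div_left_comm, mul_comm]
  refine mul_le_mul_of_nonneg_left ?_ (norm_nonneg g)
  rw [le_div_iff₀ hpos, mul_comm]
  refine (mul_le_mul_of_nonneg_left ?_ hpos.le).trans hslope
  simpa using (fderiv ℝ (cutoff n) x).le_opNorm (EuclideanSpace.single j 1)

/-- Since `|∇η_n| = O(1 / (1 + |x|))`, the flux only has to be integrable against that weight. -/
lemma balance {F : ℝ × E3 → ℝ} {G : Fin 3 → ℝ × E3 → ℝ} (hF : ContDiffOn ℝ 1 F posTime)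
    (hG : ∀ j, ContDiffOn ℝ 1 (G j) posTime) {a b : ℝ} (ha : 0 < a) (hab : a ≤ b)
    (hFa : Integrable fun x => F (a, x)) (hFb : Integrable fun x => F (b, x))
    (hGint : ∀ j, Integrable (fun z => G j z / (1 + ‖z.2‖)) (slab a b))
    (hsource : Integrable (source F G) (slab a b)) :
    (∫ x, F (b, x)) - ∫ x, F (a, x) = ∫ z, source F G z ∂(slab a b) := by
  have hbal := fun n => weighted_balance hF hG ha hab (contDiff_cutoff (k := 1) n)
    (hasCompactSupport_cutoff n)
  refine tendsto_nhds_unique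
    ((tendsto_integral_cutoff_mul hFb).sub (tendsto_integral_cutoff_mul hFa)) ?_
  simp only [hbal]
  refine tendsto_integral_of_dominated_convergence
    (fun z => ‖source F G z‖ + ∑ j, 3 * bumpSlope E3 * ‖G j z / (1 + ‖z.2‖)‖) (fun n => ?_)
    (hsource.norm.add (integrable_finsetSum _ fun j _ => (hGint j).norm.const_mul _))
    (fun n => ae_of_all _ fun z => ?_) (ae_of_all _ fun z => ?_)
  · exact (integrable_weighted_source hF hG ha (contDiff_cutoff (k := 1) n)
      (hasCompactSupport_cutoff n)).aestronglyMeasurable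
  · refine (norm_sub_le _ _).trans (add_le_add ?_ ((norm_sum_le _ _).trans
      (Finset.sum_le_sum fun j _ => norm_fderiv_cutoff_single_mul_le n j z.2 _)))
    rw [norm_mul]
    exact mul_le_of_le_one_left (norm_nonneg _) (norm_cutoff_le_one n _)
  · have hflux : Tendsto (fun n => ∑ j, fderiv ℝ (cutoff n) z.2 (EuclideanSpace.single j 1) * G j z)
        atTop (𝓝 (∑ j : Fin 3, 0 * G j z)) :=
      tendsto_finsetSum _ fun j _ => (tendsto_fderiv_cutoff z.2 _).mul_const _
    simpa using ((tendsto_cutoff z.2).mul_const (source F G z)).sub hflux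

/-! ### Densities and currents -/

section ConjMul

variable {X : Type*} [NormedAddCommGroup X] [NormedSpace ℝ X] {f g : X → ℂ} {z : X}

lemma hasFDerivAt_conj_mul {f' g' : X →L[ℝ] ℂ} (hf : HasFDerivAt f f' z)
    (hg : HasFDerivAt g g' z) :
    HasFDerivAt (fun y => conj (f y) * g y)
      (conj (f z) • g' + g z • (Complex.conjCLE : ℂ →L[ℝ] ℂ).comp f') z :=
  ((Complex.conjCLE : ℂ →L[ℝ] ℂ).hasFDerivAt.comp z hf).mul hg

lemma fderiv_re_conj_mul (hf : DifferentiableAt ℝ f z) (hg : DifferentiableAt ℝ g z) (v : X) :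
    fderiv ℝ (fun y => (conj (f y) * g y).re) z v =
      (conj (f z) * fderiv ℝ g z v).re + (conj (fderiv ℝ f z v) * g z).re := by
  have h : HasFDerivAt (fun y => (conj (f y) * g y).re) _ z := Complex.reCLM.hasFDerivAt.comp z
    (hasFDerivAt_conj_mul hf.hasFDerivAt hg.hasFDerivAt)
  rw [h.fderiv]
  simp [mul_comm]

lemma fderiv_im_conj_mul (hf : DifferentiableAt ℝ f z) (hg : DifferentiableAt ℝ g z) (v : X) :
    fderiv ℝ (fun y => (conj (f y) * g y).im) z v =
      (conj (f z) * fderiv ℝ g z v).im + (conj (fderiv ℝ f z v) * g z).im := by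
  have h : HasFDerivAt (fun y => (conj (f y) * g y).im) _ z := Complex.imCLM.hasFDerivAt.comp z
    (hasFDerivAt_conj_mul hf.hasFDerivAt hg.hasFDerivAt)
  rw [h.fderiv]
  simp [mul_comm]

lemma re_conj_mul_self (a : ℂ) : (conj a * a).re = ‖a‖ ^ 2 := by
  rw [Complex.conj_mul']
  exact_mod_cast rfl

lemma im_conj_mul_self (a : ℂ) : (conj a * a).im = 0 := by
  rw [Complex.conj_mul']
  exact_mod_cast rfl

lemma re_conj_mul_comm (a b : ℂ) : (conj a * b).re = (conj b * a).re := by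
  simp [mul_comm]

lemma fderiv_norm_sq (hf : DifferentiableAt ℝ f z) (v : X) :
    fderiv ℝ (fun y => ‖f y‖ ^ 2) z v = 2 * (conj (f z) * fderiv ℝ f z v).re := by
  simp only [← re_conj_mul_self]
  rw [fderiv_re_conj_mul hf hf, re_conj_mul_comm (fderiv ℝ f z v), two_mul]

variable {n : WithTop ℕ∞} {s : Set X}

lemma contDiffOn_conj_mul (hf : ContDiffOn ℝ n f s) (hg : ContDiffOn ℝ n g s) :
    ContDiffOn ℝ n (fun y => conj (f y) * g y) s :=
  ((Complex.conjCLE : ℂ →L[ℝ] ℂ).contDiff.comp_contDiffOn hf).mul hg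

lemma contDiffOn_re_conj_mul (hf : ContDiffOn ℝ n f s) (hg : ContDiffOn ℝ n g s) :
    ContDiffOn ℝ n (fun y => (conj (f y) * g y).re) s :=
  Complex.reCLM.contDiff.comp_contDiffOn (contDiffOn_conj_mul hf hg)

lemma contDiffOn_im_conj_mul (hf : ContDiffOn ℝ n f s) (hg : ContDiffOn ℝ n g s) :
    ContDiffOn ℝ n (fun y => (conj (f y) * g y).im) s :=
  Complex.imCLM.contDiff.comp_contDiffOn (contDiffOn_conj_mul hf hg)

lemma contDiffOn_norm_sq (hf : ContDiffOn ℝ n f s) : ContDiffOn ℝ n (fun y => ‖f y‖ ^ 2) s := by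
  simp only [← re_conj_mul_self]
  exact contDiffOn_re_conj_mul hf hf

end ConjMul

/-- The time derivative of a function on space-time. -/
def dt (Φ : ℝ × E3 → ℂ) (z : ℝ × E3) : ℂ := fderiv ℝ Φ z timeDir

/-- The `j`-th space derivative of a function on space-time. -/
def dx (j : Fin 3) (Φ : ℝ × E3 → ℂ) (z : ℝ × E3) : ℂ := fderiv ℝ Φ z (spaceDir j)

/-- The spatial Laplacian of a function on space-time. -/
def lap (Φ : ℝ × E3 → ℂ) (z : ℝ × E3) : ℂ := ∑ j, dx j (dx j Φ) z

/-- The current of the mass density `|Φ|²` of a Schrödinger wave. -/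
def massCurrent (Φ : ℝ × E3 → ℂ) (j : Fin 3) (z : ℝ × E3) : ℝ := -2 * (conj (Φ z) * dx j Φ z).im

/-- The kinetic energy density `|∇Φ|²`. -/
def kineticDensity (Φ : ℝ × E3 → ℂ) (z : ℝ × E3) : ℝ := ∑ j, ‖dx j Φ z‖ ^ 2

/-- The current of the kinetic energy density. -/
def kineticCurrent (Φ : ℝ × E3 → ℂ) (j : Fin 3) (z : ℝ × E3) : ℝ :=
  2 * (conj (dx j Φ z) * dt Φ z).re

section TimeWeight

variable {n : WithTop ℕ∞} {w : ℝ → ℝ} (hw : ContDiffOn ℝ n w (Ioi 0)) {F : ℝ × E3 → ℝ}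
  (hF : ContDiffOn ℝ n F posTime)
include hw hF

lemma contDiffOn_time_mul : ContDiffOn ℝ n (fun z => w z.1 * F z) posTime :=
  (hw.comp contDiff_fst.contDiffOn fun _ hz => hz.1).mul hF

lemma fderiv_time_mul (hn : n ≠ 0) {z : ℝ × E3} (hz : z ∈ posTime) (v : ℝ × E3) :
    fderiv ℝ (fun z => w z.1 * F z) z v = w z.1 * fderiv ℝ F z v + deriv w z.1 * v.1 * F z := by
  have h1 : HasDerivAt w (deriv w z.1) z.1 :=
    ((hw.contDiffAt (Ioi_mem_nhds hz.1)).differentiableAt hn).hasDerivAt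
  have h2 : HasFDerivAt (fun z : ℝ × E3 => w z.1) _ z := h1.hasFDerivAt.comp z hasFDerivAt_fst
  have h3 : HasFDerivAt (fun z : ℝ × E3 => w z.1 * F z) _ z :=
    h2.mul (differentiableAt_of_contDiffOn hF hn hz).hasFDerivAt
  rw [h3.fderiv]
  simp only [smul_eq_mul, add_apply, smul_apply, ContinuousLinearMap.comp_apply,
    ContinuousLinearMap.coe_fst', ContinuousLinearMap.toSpanSingleton_apply]
  ring

lemma source_time_mul {G : Fin 3 → ℝ × E3 → ℝ} (hG : ∀ j, ContDiffOn ℝ n (G j) posTime)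
    (hn : n ≠ 0) {z : ℝ × E3} (hz : z ∈ posTime) :
    source (fun z => w z.1 * F z) (fun j z => w z.1 * G j z) z =
      deriv w z.1 * F z + w z.1 * source F G z := by
  simp only [source, fderiv_time_mul hw hF hn hz, fun j => fderiv_time_mul hw (hG j) hn hz,
    timeDir, spaceDir, mul_one, mul_zero, zero_mul, add_zero, ← Finset.mul_sum]
  ring

end TimeWeight

section Currents

variable {Φ : ℝ × E3 → ℂ} (h : ContDiffOn ℝ ∞ Φ posTime) {z : ℝ × E3} (hz : z ∈ posTime)
include h

lemma contDiffOn_dt : ContDiffOn ℝ ∞ (dt Φ) posTime := contDiffOn_fderiv_apply h _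

lemma contDiffOn_dx (j : Fin 3) : ContDiffOn ℝ ∞ (dx j Φ) posTime := contDiffOn_fderiv_apply h _

lemma contDiffOn_massCurrent (j : Fin 3) : ContDiffOn ℝ ∞ (massCurrent Φ j) posTime :=
  contDiffOn_const.mul (contDiffOn_im_conj_mul h (contDiffOn_dx h j))

lemma contDiffOn_kineticDensity : ContDiffOn ℝ ∞ (kineticDensity Φ) posTime :=
  ContDiffOn.sum fun j _ => contDiffOn_norm_sq (contDiffOn_dx h j)

lemma contDiffOn_kineticCurrent (j : Fin 3) : ContDiffOn ℝ ∞ (kineticCurrent Φ j) posTime :=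
  contDiffOn_const.mul (contDiffOn_re_conj_mul (contDiffOn_dx h j) (contDiffOn_dt h))

include hz

lemma dt_dx_comm (j : Fin 3) : dt (dx j Φ) z = dx j (dt Φ) z := by
  have hs := (h.contDiffAt (isOpen_posTime.mem_nhds hz)).isSymmSndFDerivAt
    (by simpa using WithTop.coe_le_coe.2 (le_top (a := (2 : ℕ∞))))
  have hd : DifferentiableAt ℝ (fderiv ℝ Φ) z := differentiableAt_of_contDiffOn (n := ∞)
    (h.fderiv_of_isOpen isOpen_posTime (by simp)) (by simp) hz
  have hsnd : ∀ v w, fderiv ℝ (fun y => fderiv ℝ Φ y v) z w = fderiv ℝ (fderiv ℝ Φ) z w v :=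
    fun v w => by
      rw [fderiv_clm_apply hd (differentiableAt_const v)]
      simp
  exact (hsnd _ _).trans ((hs _ _).trans (hsnd _ _).symm)

lemma fderiv_massCurrent (j : Fin 3) :
    fderiv ℝ (massCurrent Φ j) z (spaceDir j) = -2 * (conj (Φ z) * dx j (dx j Φ) z).im := by
  have hd {F : ℝ × E3 → ℂ} (hF : ContDiffOn ℝ ∞ F posTime) : DifferentiableAt ℝ F z :=
    differentiableAt_of_contDiffOn hF (by simp) hz
  unfold massCurrent
  rw [fderiv_const_mul (differentiableAt_of_contDiffOn (contDiffOn_im_conj_mul h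
    (contDiffOn_dx h j)) (by simp) hz), smul_apply, fderiv_im_conj_mul (hd h)
    (hd (contDiffOn_dx h j)), smul_eq_mul, ← dx, ← dx, im_conj_mul_self, add_zero]

lemma fderiv_kineticCurrent (j : Fin 3) : fderiv ℝ (kineticCurrent Φ j) z (spaceDir j) =
    2 * (conj (dx j Φ z) * dt (dx j Φ) z).re + 2 * (conj (dx j (dx j Φ) z) * dt Φ z).re := by
  have hd {F : ℝ × E3 → ℂ} (hF : ContDiffOn ℝ ∞ F posTime) : DifferentiableAt ℝ F z :=
    differentiableAt_of_contDiffOn hF (by simp) hz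
  unfold kineticCurrent
  rw [fderiv_const_mul (differentiableAt_of_contDiffOn (contDiffOn_re_conj_mul
    (contDiffOn_dx h j) (contDiffOn_dt h)) (by simp) hz), smul_apply, fderiv_re_conj_mul
    (hd (contDiffOn_dx h j)) (hd (contDiffOn_dt h)), smul_eq_mul, mul_add, dt_dx_comm h hz]
  rfl

lemma fderiv_kineticDensity : fderiv ℝ (kineticDensity Φ) z timeDir =
    ∑ j, 2 * (conj (dx j Φ z) * dt (dx j Φ) z).re := by
  have hdx := contDiffOn_dx h
  unfold kineticDensity
  rw [fderiv_fun_sum fun j _ => differentiableAt_of_contDiffOn (contDiffOn_norm_sq (hdx j))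
    (by simp) hz, sum_apply]
  exact Finset.sum_congr rfl fun j _ =>
    fderiv_norm_sq (differentiableAt_of_contDiffOn (hdx j) (by simp) hz) timeDir

lemma source_mass_eq_zero {V : ℝ} (heq : Complex.I * dt Φ z + lap Φ z - V * Φ z = 0) :
    source (fun z => ‖Φ z‖ ^ 2) (massCurrent Φ) z = 0 := by
  have hdt : dt Φ z = Complex.I * (lap Φ z - V * Φ z) := by
    linear_combination (-Complex.I) * heq + (dt Φ z) * Complex.I_mul_I
  have hre : (conj (Φ z) * dt Φ z).re = -(conj (Φ z) * lap Φ z).im := by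
    rw [hdt]
    simp only [Complex.mul_re, Complex.mul_im, Complex.conj_re, Complex.conj_im, Complex.I_re,
      Complex.I_im, Complex.sub_re, Complex.sub_im, Complex.ofReal_re, Complex.ofReal_im]
    ring
  simp only [source, fderiv_massCurrent h hz,
    fderiv_norm_sq (differentiableAt_of_contDiffOn h (by simp) hz)]
  rw [← dt, hre, ← Finset.mul_sum, ← Complex.im_sum, ← Finset.mul_sum, ← lap]
  ring

lemma source_kinetic : source (kineticDensity Φ) (kineticCurrent Φ) z =
    -(2 * (conj (lap Φ z) * dt Φ z).re) := by
  have hlap : (conj (lap Φ z) * dt Φ z).re = ∑ j, (conj (dx j (dx j Φ) z) * dt Φ z).re := by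
    rw [lap, map_sum, Finset.sum_mul, Complex.re_sum]
  simp only [source, fderiv_kineticCurrent h hz, fderiv_kineticDensity h hz, hlap,
    Finset.sum_add_distrib, Finset.mul_sum]
  ring

end Currents

/-! ### The pseudoconformal transformation -/

/-- The modulation `t^{3/2} exp(-i t |y|² / 4)`. -/
def modulation (z : ℝ × E3) : ℂ :=
  ((z.1 ^ (3 / 2 : ℝ) : ℝ) : ℂ) * Complex.exp (-(Complex.I * ((z.1 * ‖z.2‖ ^ 2 / 4 : ℝ) : ℂ)))

/-- The dilation `(t, y) ↦ (t, t y)`. -/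
def dilation (z : ℝ × E3) : ℝ × E3 := (z.1, z.1 • z.2)

/-- The pseudoconformal transform `t^{3/2} exp(-i t |y|² / 4) f(t, t y)`. -/
def pseudoconformal (f : ℝ × E3 → ℂ) (z : ℝ × E3) : ℂ := modulation z * f (dilation z)

/-- The operator conjugate to `dx j` under the pseudoconformal transform. -/
def conjDx (j : Fin 3) (f : ℝ × E3 → ℂ) (z : ℝ × E3) : ℂ :=
  -(Complex.I * ((z.2 j / 2 : ℝ) : ℂ)) * f z + z.1 * dx j f z

/-- The operator conjugate to `dt` under the pseudoconformal transform. -/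
def conjDt (f : ℝ × E3 → ℂ) (z : ℝ × E3) : ℂ :=
  (((3 / (2 * z.1) : ℝ) : ℂ) - Complex.I * ((‖z.2‖ ^ 2 / (4 * z.1 ^ 2) : ℝ) : ℂ)) * f z + dt f z
    + ∑ j, ((z.2 j / z.1 : ℝ) : ℂ) * dx j f z

lemma dilation_mem {z : ℝ × E3} (hz : z ∈ posTime) : dilation z ∈ posTime := ⟨hz.1, mem_univ _⟩

lemma contDiff_dilation {n : WithTop ℕ∞} : ContDiff ℝ n dilation :=
  contDiff_fst.prodMk (contDiff_fst.smul contDiff_snd)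

lemma hasFDerivAt_dilation (z : ℝ × E3) : HasFDerivAt dilation
    ((ContinuousLinearMap.fst ℝ ℝ E3).prod (z.1 • ContinuousLinearMap.snd ℝ ℝ E3
      + (ContinuousLinearMap.fst ℝ ℝ E3).smulRight z.2)) z :=
  hasFDerivAt_fst.prodMk (hasFDerivAt_fst.fun_smul hasFDerivAt_snd)

lemma contDiffOn_modulation : ContDiffOn ℝ ∞ modulation posTime := by
  have hphase : ContDiff ℝ ∞ fun z : ℝ × E3 => z.1 * ‖z.2‖ ^ 2 / 4 :=
    (contDiff_fst.mul (contDiff_snd.norm_sq ℝ)).div_const 4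
  exact (Complex.ofRealCLM.contDiff.comp_contDiffOn
    (contDiff_fst.contDiffOn.rpow_const_of_ne fun z hz => ne_of_gt hz.1)).mul
    (contDiff_const.mul (Complex.ofRealCLM.contDiff.comp hphase)).neg.cexp.contDiffOn

lemma norm_modulation {z : ℝ × E3} (hz : z ∈ posTime) : ‖modulation z‖ = z.1 ^ (3 / 2 : ℝ) := by
  have hphase : -(Complex.I * ((z.1 * ‖z.2‖ ^ 2 / 4 : ℝ) : ℂ)) =
      ((-(z.1 * ‖z.2‖ ^ 2 / 4) : ℝ) : ℂ) * Complex.I := by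
    push_cast
    ring
  rw [modulation, hphase, norm_mul, Complex.norm_exp_ofReal_mul_I, Complex.norm_real,
    Real.norm_of_nonneg (Real.rpow_nonneg (le_of_lt hz.1) _), mul_one]

lemma norm_sq_modulation {z : ℝ × E3} (hz : z ∈ posTime) : ‖modulation z‖ ^ 2 = z.1 ^ 3 := by
  rw [norm_modulation hz, ← Real.rpow_natCast, ← Real.rpow_mul (le_of_lt hz.1)]
  norm_num

lemma dt_modulation {z : ℝ × E3} (hz : z ∈ posTime) : dt modulation z =
    modulation z * (((3 / (2 * z.1) : ℝ) : ℂ) - Complex.I * ((‖z.2‖ ^ 2 / 4 : ℝ) : ℂ)) := by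
  obtain ⟨t, y⟩ := z
  have ht : 0 < t := hz.1
  have hpow : HasDerivAt (fun s : ℝ => s ^ (3 / 2 : ℝ)) (t ^ (3 / 2 : ℝ) * (3 / (2 * t))) t := by
    refine (Real.hasDerivAt_rpow_const (Or.inl ht.ne')).congr_deriv ?_
    rw [Real.rpow_sub ht, Real.rpow_one]
    field_simp
  have hphase : HasDerivAt (fun s : ℝ => s * ‖y‖ ^ 2 / 4) (‖y‖ ^ 2 / 4) t := by
    simpa using ((hasDerivAt_id t).mul_const (‖y‖ ^ 2)).div_const 4
  have hprod := hpow.ofReal_comp.mul (hphase.ofReal_comp.const_mul Complex.I).neg.cexp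
  refine (hasDerivAt_slice contDiffOn_modulation (by simp) ht y).unique (hprod.congr_deriv ?_)
  simp only [modulation, Pi.neg_apply]
  push_cast
  ring

lemma dx_modulation {z : ℝ × E3} (hz : z ∈ posTime) (j : Fin 3) : dx j modulation z =
    modulation z * (-(Complex.I * ((z.1 * z.2 j / 2 : ℝ) : ℂ))) := by
  obtain ⟨t, y⟩ := z
  have ht : 0 < t := hz.1
  have hphase : HasFDerivAt (fun x : E3 => t * ‖x‖ ^ 2 / 4) _ y :=
    ((hasStrictFDerivAt_norm_sq y).hasFDerivAt.const_mul t).mul_const (4 : ℝ)⁻¹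
  have hphase' : HasFDerivAt (fun x : E3 => ((t * ‖x‖ ^ 2 / 4 : ℝ) : ℂ)) _ y :=
    Complex.ofRealCLM.hasFDerivAt.comp y hphase
  have hmod : HasFDerivAt (fun x : E3 => modulation (t, x)) _ y :=
    (hphase'.const_mul Complex.I).neg.cexp.const_mul ((t ^ (3 / 2 : ℝ) : ℝ) : ℂ)
  have hinner : inner ℝ y (EuclideanSpace.single j (1 : ℝ)) = y j := by
    simp [EuclideanSpace.inner_single_right]
  rw [dx, ← fderiv_slice contDiffOn_modulation (by simp) ht, hmod.fderiv]
  simp only [Complex.ofReal_div, Complex.ofReal_mul, Complex.ofReal_pow, Complex.ofReal_ofNat,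
    Pi.neg_apply, ContinuousLinearMap.comp_smulₛₗ, map_inv₀, Real.ringHom_apply,
    ContinuousLinearMap.comp_smul, smul_neg, Complex.coe_smul, neg_apply, smul_apply,
    ContinuousLinearMap.comp_apply, coe_innerSL_apply, hinner, Complex.ofRealCLM_apply,
    nsmul_eq_mul, Nat.cast_ofNat, Complex.real_smul, Complex.ofReal_inv, smul_eq_mul, modulation,
    mul_neg, neg_inj]
  ring

lemma sum_smul_spaceDir (y : E3) : ∑ j, y j • spaceDir j = (0, y) := by
  refine Prod.ext ?_ ?_
  · simp [Prod.fst_sum, spaceDir]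
  · rw [Prod.snd_sum]
    exact sum_smul_single y

section Transform

variable {f : ℝ × E3 → ℂ} (hf : ContDiffOn ℝ ∞ f posTime)
include hf

lemma contDiffOn_pseudoconformal : ContDiffOn ℝ ∞ (pseudoconformal f) posTime :=
  contDiffOn_modulation.mul (hf.comp contDiff_dilation.contDiffOn fun _ hz => dilation_mem hz)

lemma contDiffOn_conjDx (j : Fin 3) : ContDiffOn ℝ ∞ (conjDx j f) posTime := by
  have hcoord : ContDiff ℝ ∞ fun z : ℝ × E3 => z.2 j / 2 := by fun_prop
  exact ((contDiff_const.mul (Complex.ofRealCLM.contDiff.comp hcoord)).neg.contDiffOn.mul hf).add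
    ((Complex.ofRealCLM.contDiff.comp contDiff_fst).contDiffOn.mul (contDiffOn_dx hf j))

variable {z : ℝ × E3} (hz : z ∈ posTime)
include hz

lemma fderiv_pseudoconformal (v : ℝ × E3) : fderiv ℝ (pseudoconformal f) z v =
    fderiv ℝ modulation z v * f (dilation z)
      + modulation z * fderiv ℝ f (dilation z) (v.1, z.1 • v.2 + v.1 • z.2) := by
  have hmod := (differentiableAt_of_contDiffOn contDiffOn_modulation (by simp) hz).hasFDerivAt
  have hcomp := (differentiableAt_of_contDiffOn hf (by simp) (dilation_mem hz)).hasFDerivAt.comp z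
    (hasFDerivAt_dilation z)
  have hprod : HasFDerivAt (pseudoconformal f) _ z := hmod.mul hcomp
  rw [hprod.fderiv]
  simp only [add_apply, smul_apply, ContinuousLinearMap.comp_apply,
    ContinuousLinearMap.prod_apply, ContinuousLinearMap.coe_fst', ContinuousLinearMap.coe_snd',
    ContinuousLinearMap.smulRight_apply, smul_eq_mul]
  ring

lemma dt_pseudoconformal : dt (pseudoconformal f) z = pseudoconformal (conjDt f) z := by
  have ht : z.1 ≠ 0 := ne_of_gt hz.1
  have hv : (timeDir.1, z.1 • timeDir.2 + timeDir.1 • z.2) = timeDir + ∑ j, z.2 j • spaceDir j := by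
    simp [sum_smul_spaceDir, timeDir]
  have hfst : (dilation z).1 = z.1 := rfl
  have hnorm : ‖(dilation z).2‖ ^ 2 / (4 * (dilation z).1 ^ 2) = ‖z.2‖ ^ 2 / 4 := by
    simp only [dilation, norm_smul, mul_pow, Real.norm_eq_abs, sq_abs]
    field_simp
  have hcoord : ∀ j, (dilation z).2 j / (dilation z).1 = z.2 j := fun j => by
    simp only [dilation, PiLp.smul_apply, smul_eq_mul]
    field_simp
  rw [dt, fderiv_pseudoconformal hf hz, ← dt, dt_modulation hz, hv, map_add, map_sum,
    pseudoconformal, conjDt, hnorm, hfst]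
  simp only [← hfst, hcoord, map_smul, dt, dx, Complex.real_smul]
  ring

lemma dx_pseudoconformal (j : Fin 3) :
    dx j (pseudoconformal f) z = pseudoconformal (conjDx j f) z := by
  have hv : ((spaceDir j).1, z.1 • (spaceDir j).2 + (spaceDir j).1 • z.2) = z.1 • spaceDir j := by
    simp [spaceDir]
  have hcoord : (dilation z).2 j = z.1 * z.2 j := rfl
  have hfst : (dilation z).1 = z.1 := rfl
  rw [dx, fderiv_pseudoconformal hf hz, ← dx, dx_modulation hz, hv, pseudoconformal, conjDx,
    hcoord, hfst, map_smul, dx, Complex.real_smul]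
  ring

lemma dx_dx_pseudoconformal (j : Fin 3) :
    dx j (dx j (pseudoconformal f)) z = pseudoconformal (conjDx j (conjDx j f)) z := by
  have hev : dx j (pseudoconformal f) =ᶠ[𝓝 z] pseudoconformal (conjDx j f) :=
    (isOpen_posTime.eventually_mem hz).mono fun y hy => dx_pseudoconformal hf hy j
  rw [← dx_pseudoconformal (contDiffOn_conjDx hf j) hz, dx, hev.fderiv_eq, ← dx]

lemma dx_conjDx (j : Fin 3) : dx j (conjDx j f) z =
    -(Complex.I / 2) * f z - Complex.I * ((z.2 j / 2 : ℝ) : ℂ) * dx j f z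
      + z.1 * dx j (dx j f) z := by
  obtain ⟨t, y⟩ := z
  have ht : 0 < t := hz.1
  have hcoord : HasFDerivAt (fun x : E3 => x j / 2) _ y :=
    (EuclideanSpace.proj j : E3 →L[ℝ] ℝ).hasFDerivAt.mul_const (2 : ℝ)⁻¹
  have hcoord' : HasFDerivAt (fun x : E3 => ((x j / 2 : ℝ) : ℂ)) _ y :=
    Complex.ofRealCLM.hasFDerivAt.comp y hcoord
  have hconj : HasFDerivAt (fun x : E3 => conjDx j f (t, x)) _ y :=
    ((hcoord'.const_mul Complex.I).neg.mul (hasFDerivAt_slice hf (by simp) ht y)).add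
      ((hasFDerivAt_slice (contDiffOn_dx hf j) (by simp) ht y).const_mul (t : ℂ))
  rw [dx, ← fderiv_slice (contDiffOn_conjDx hf j) (by simp) ht, hconj.fderiv]
  simp only [Complex.ofReal_div, Complex.ofReal_ofNat, Pi.neg_apply,
    ContinuousLinearMap.comp_smulₛₗ, map_inv₀, Real.ringHom_apply, smul_neg, add_apply, smul_apply,
    ContinuousLinearMap.comp_apply, ContinuousLinearMap.inr_apply, smul_eq_mul, neg_mul, neg_apply,
    PiLp.proj_apply, PiLp.single_eq_same, Complex.ofRealCLM_apply, Complex.ofReal_one,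
    Complex.real_smul, Complex.ofReal_inv, mul_one, dx, spaceDir, add_left_inj]
  ring

lemma schrodinger_pseudoconformal :
    Complex.I * dt (pseudoconformal f) z + ((z.1 ^ 2 : ℝ) : ℂ)⁻¹ * lap (pseudoconformal f) z =
      modulation z * (Complex.I * dt f (dilation z) + lap f (dilation z)) := by
  have htc : (z.1 : ℂ) ≠ 0 := by exact_mod_cast ne_of_gt hz.1
  have hfst : (dilation z).1 = z.1 := rfl
  have hnorm : ‖(dilation z).2‖ ^ 2 = ∑ j, (dilation z).2 j ^ 2 := EuclideanSpace.real_norm_sq_eq _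
  rw [dt_pseudoconformal hf hz, lap]
  simp only [dx_dx_pseudoconformal hf hz, pseudoconformal, conjDt, hnorm,
    dx_conjDx hf (dilation_mem hz), lap, conjDx, Fin.sum_univ_three, hfst]
  push_cast
  field_simp
  ring

end Transform

/-! ### Bilinear estimates -/

lemma mul_le_sq_add_sq (a b : ℝ≥0∞) : a * b ≤ a ^ 2 + b ^ 2 := by
  rcases le_total a b with h | h
  · calc a * b ≤ b ^ 2 := by rw [sq]; gcongr
      _ ≤ a ^ 2 + b ^ 2 := le_add_self
  · calc a * b ≤ a ^ 2 := by rw [sq]; gcongr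
      _ ≤ a ^ 2 + b ^ 2 := le_self_add

lemma lintegral_mul_le_sq_add_sq {X : Type*} [MeasurableSpace X] {μ : Measure X} {f g : X → ℝ≥0∞}
    (hf : Measurable f) : ∫⁻ x, f x * g x ∂μ ≤ (∫⁻ x, f x ^ 2 ∂μ) + ∫⁻ x, g x ^ 2 ∂μ := by
  rw [← lintegral_add_left (hf.pow_const 2)]
  exact lintegral_mono fun x => mul_le_sq_add_sq _ _

section Convolution

variable {V : Type*} [AddCommGroup V] [MeasurableSpace V] [MeasurableAdd₂ V] [MeasurableNeg V]
  {μ : Measure V} [SFinite μ] [μ.IsAddLeftInvariant] [μ.IsNegInvariant] {k f g : V → ℝ≥0∞}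
  (hk : Measurable k) (hf : Measurable f)
include hk hf

lemma lintegral_kernel_le_left (hg : Measurable g) :
    ∫⁻ p : V × V, k (p.1 - p.2) * (f p.1 * g p.2) ∂(μ.prod μ) ≤
      ((∫⁻ x, k x ^ 2 ∂μ) + ∫⁻ x, g x ^ 2 ∂μ) * ∫⁻ x, f x ∂μ := by
  rw [lintegral_prod _ (by fun_prop), ← lintegral_const_mul _ hf]
  refine lintegral_mono fun x => ?_
  calc ∫⁻ y, k (x - y) * (f x * g y) ∂μ = f x * ∫⁻ y, k (x - y) * g y ∂μ := by
        simp only [← lintegral_const_mul (f x) (f := fun y => k (x - y) * g y) (by fun_prop),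
          mul_left_comm]
    _ ≤ f x * ((∫⁻ y, k (x - y) ^ 2 ∂μ) + ∫⁻ y, g y ^ 2 ∂μ) := by
        gcongr
        exact lintegral_mul_le_sq_add_sq (by fun_prop)
    _ = ((∫⁻ x, k x ^ 2 ∂μ) + ∫⁻ x, g x ^ 2 ∂μ) * f x := by
        rw [lintegral_sub_left_eq_self (fun y => k y ^ 2), mul_comm]

lemma lintegral_kernel_le_right (hg : Measurable g) :
    ∫⁻ p : V × V, k (p.1 - p.2) * (f p.1 * g p.2) ∂(μ.prod μ) ≤
      ((∫⁻ x, k x ^ 2 ∂μ) + ∫⁻ x, f x ^ 2 ∂μ) * ∫⁻ x, g x ∂μ := by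
  rw [← lintegral_neg_eq_self (fun x => k x ^ 2), ← lintegral_prod_swap]
  refine le_of_eq_of_le (lintegral_congr fun p => ?_)
    (lintegral_kernel_le_left (k := fun x => k (-x)) (by fun_prop) hg hf)
  rw [Prod.fst_swap, Prod.snd_swap, neg_sub, mul_comm (f p.2)]

lemma lintegral_kernel_sq_le : ∫⁻ p : V × V, k (p.1 - p.2) * (f p.1 * f p.2) ∂(μ.prod μ) ≤
    2 * (∫⁻ x, k x ∂μ) * ∫⁻ x, f x ^ 2 ∂μ := by
  have hfst : ∫⁻ p : V × V, k (p.1 - p.2) * f p.1 ^ 2 ∂(μ.prod μ) =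
      (∫⁻ x, k x ∂μ) * ∫⁻ x, f x ^ 2 ∂μ := by
    rw [lintegral_prod _ (by fun_prop), ← lintegral_const_mul _ (by fun_prop)]
    refine lintegral_congr fun x => ?_
    dsimp only
    rw [lintegral_mul_const _ (by fun_prop), lintegral_sub_left_eq_self k]
  have hsnd : ∫⁻ p : V × V, k (p.1 - p.2) * f p.2 ^ 2 ∂(μ.prod μ) =
      (∫⁻ x, k x ∂μ) * ∫⁻ x, f x ^ 2 ∂μ := by
    rw [lintegral_prod_symm _ (by fun_prop), ← lintegral_const_mul _ (by fun_prop)]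
    refine lintegral_congr fun x => ?_
    dsimp only
    rw [lintegral_mul_const _ (by fun_prop), lintegral_sub_right_eq_self k]
  calc ∫⁻ p : V × V, k (p.1 - p.2) * (f p.1 * f p.2) ∂(μ.prod μ)
      ≤ ∫⁻ p : V × V, (k (p.1 - p.2) * f p.1 ^ 2 + k (p.1 - p.2) * f p.2 ^ 2) ∂(μ.prod μ) :=
        lintegral_mono fun p => by
          rw [← mul_add]
          exact mul_le_mul_right (mul_le_sq_add_sq _ _) _
    _ = 2 * (∫⁻ x, k x ∂μ) * ∫⁻ x, f x ^ 2 ∂μ := by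
        rw [lintegral_add_left (by fun_prop), hfst, hsnd]
        ring

end Convolution

/-- The integrand `k(x - y) f(x) g(y)` of a bilinear interaction through a kernel. -/
def pairing (k f g : E3 → ℝ) (p : E3 × E3) : ℝ := k (p.1 - p.2) * (f p.1 * g p.2)

/-- A bound for `∬ |k(x - y) f(x) g(y)|` when `|k| ≤ C (v + 1)` and the `L¹` norms of `f` and `g`,
as well as the squared `L²` norm of one of them, are at most `A`. -/
def bilinearBound (χ : ℝ → ℝ) (C : ℝ) (A : ℝ≥0∞) : ℝ≥0∞ :=
  ENNReal.ofReal C * (((∫⁻ x : E3, ‖potential χ x‖ₑ ^ 2) + A) * A + A * A)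

section Pairing

variable {k f g : E3 → ℝ}

lemma measurable_pairing (hk : Measurable k) (hf : Measurable f) (hg : Measurable g) :
    Measurable (pairing k f g) := by
  unfold pairing
  fun_prop

lemma integral_pairing_comm (hk : ∀ x, k (-x) = k x) :
    ∫ p, pairing k f g p = ∫ p, pairing k g f p := by
  rw [Measure.volume_eq_prod, ← integral_prod_swap]
  refine integral_congr_ae (ae_of_all _ fun p => ?_)
  simp only [pairing, Prod.fst_swap, Prod.snd_swap]
  rw [← neg_sub, hk, mul_comm (f p.2)]

lemma integral_pairing_snd (x : E3) :
    ∫ y, pairing k f g (x, y) = (∫ y, k (x - y) * g y) * f x := by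
  rw [← integral_mul_const]
  refine integral_congr_ae (ae_of_all _ fun y => ?_)
  simp only [pairing]
  ring

lemma integrable_convolution_mul (h : Integrable (pairing k f g)) :
    Integrable fun x => (∫ y, k (x - y) * g y) * f x := by
  simp only [← integral_pairing_snd]
  exact Integrable.integral_prod_left h

lemma integral_pairing (h : Integrable (pairing k f g)) :
    ∫ p, pairing k f g p = ∫ x, (∫ y, k (x - y) * g y) * f x := by
  simp only [← integral_pairing_snd]
  exact integral_prod _ h

end Pairing

section Bilinear

variable {χ : ℝ → ℝ} (hχ : IsDecreasingCutoff χ) {A : ℝ≥0∞} {C : ℝ}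
include hχ

lemma bilinearBound_ne_top (hA : A ≠ ⊤) : bilinearBound χ C A ≠ ⊤ := by
  have := hχ.lintegral_potential_sq_ne_top
  rw [bilinearBound]
  finiteness

variable {k : E3 → ℝ} (hkC : ∀ x, |k x| ≤ C * (potential χ x + 1))
include hkC

lemma enorm_kernel_le (x : E3) : ‖k x‖ₑ ≤ ENNReal.ofReal C * (‖potential χ x‖ₑ + 1) := by
  have h0 := hχ.potential_nonneg x
  rw [Real.enorm_eq_ofReal_abs, hχ.enorm_potential, ← ENNReal.ofReal_one,
    ← ENNReal.ofReal_add h0 zero_le_one, ← ENNReal.ofReal_mul' (by positivity)]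
  exact ENNReal.ofReal_le_ofReal (hkC x)

variable {f g : E3 → ℝ} (hf : Measurable f) (hg : Measurable g)
include hf hg

lemma lintegral_enorm_pairing_le :
    ∫⁻ p, ‖pairing k f g p‖ₑ ≤ ENNReal.ofReal C *
      ((∫⁻ p : E3 × E3, ‖potential χ (p.1 - p.2)‖ₑ * (‖f p.1‖ₑ * ‖g p.2‖ₑ))
        + (∫⁻ x, ‖f x‖ₑ) * ∫⁻ x, ‖g x‖ₑ) := by
  have hv := hχ.measurable_potential
  calc ∫⁻ p, ‖pairing k f g p‖ₑ
      ≤ ∫⁻ p : E3 × E3, ENNReal.ofReal C * (‖potential χ (p.1 - p.2)‖ₑ * (‖f p.1‖ₑ * ‖g p.2‖ₑ)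
          + ‖f p.1‖ₑ * ‖g p.2‖ₑ) := by
        refine lintegral_mono fun p => ?_
        simp only [pairing, enorm_mul]
        calc _ ≤ ENNReal.ofReal C * (‖potential χ (p.1 - p.2)‖ₑ + 1) * (‖f p.1‖ₑ * ‖g p.2‖ₑ) := by
              gcongr
              exact enorm_kernel_le hχ hkC _
          _ = _ := by ring
    _ = _ := by
        rw [lintegral_const_mul _ (by fun_prop), lintegral_add_right _ (by fun_prop),
          Measure.volume_eq_prod, lintegral_prod_mul (f := fun x => ‖f x‖ₑ) (g := fun x => ‖g x‖ₑ)
            (by fun_prop) (by fun_prop)]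

variable (hf1 : ∫⁻ x, ‖f x‖ₑ ≤ A) (hg1 : ∫⁻ x, ‖g x‖ₑ ≤ A)
include hf1 hg1

lemma lintegral_enorm_pairing_le_left (hg2 : ∫⁻ x, ‖g x‖ₑ ^ 2 ≤ A) :
    ∫⁻ p, ‖pairing k f g p‖ₑ ≤ bilinearBound χ C A := by
  refine (lintegral_enorm_pairing_le hχ hkC hf hg).trans ?_
  rw [bilinearBound]
  gcongr
  refine (lintegral_kernel_le_left hχ.measurable_potential.enorm hf.enorm hg.enorm).trans ?_
  gcongr

lemma lintegral_enorm_pairing_le_right (hf2 : ∫⁻ x, ‖f x‖ₑ ^ 2 ≤ A) :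
    ∫⁻ p, ‖pairing k f g p‖ₑ ≤ bilinearBound χ C A := by
  refine (lintegral_enorm_pairing_le hχ hkC hf hg).trans ?_
  rw [bilinearBound]
  gcongr
  refine (lintegral_kernel_le_right hχ.measurable_potential.enorm hf.enorm hg.enorm).trans ?_
  gcongr

end Bilinear

/-! ### The energy law for the transformed equation -/

lemma enorm_norm_sq (c : ℂ) : ‖‖c‖ ^ 2‖ₑ = ‖c‖ₑ ^ 2 := by rw [enorm_pow, enorm_norm]

lemma enorm_two : ‖(2 : ℝ)‖ₑ = 2 := by
  rw [Real.enorm_of_nonneg zero_le_two, ENNReal.ofReal_ofNat]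

lemma enorm_re_conj_mul_le (c d : ℂ) : ‖(conj c * d).re‖ₑ ≤ ‖c‖ₑ * ‖d‖ₑ := by
  rw [← enorm_mul, enorm_le_iff_norm_le, norm_mul, ← Complex.norm_conj c, ← norm_mul]
  exact Complex.abs_re_le_norm _

lemma integrable_prod_of_lintegral_le {X : Type*} [MeasurableSpace X] {μ : Measure X} [SFinite μ]
    {a b : ℝ} {f : ℝ × X → ℝ} (hm : AEStronglyMeasurable f ((volume.restrict (Ioc a b)).prod μ))
    {C : ℝ≥0∞} (hC : C ≠ ⊤) (h : ∀ t ∈ Ioc a b, ∫⁻ x, ‖f (t, x)‖ₑ ∂μ ≤ C) :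
    Integrable f ((volume.restrict (Ioc a b)).prod μ) := by
  refine ⟨hm, ?_⟩
  rw [HasFiniteIntegral, lintegral_prod _ hm.enorm]
  refine (setLIntegral_mono measurable_const h).trans_lt ?_
  rw [setLIntegral_const]
  exact ENNReal.mul_lt_top hC.lt_top (by simp)

lemma aestronglyMeasurable_prod_of_continuousOn {X : Type*} [MeasurableSpace X]
    [TopologicalSpace X] [BorelSpace X] [SecondCountableTopology X] {μ : Measure X} [SFinite μ]
    {a b : ℝ} (ha : 0 ≤ a) {f : ℝ × X → ℝ} (hf : ContinuousOn f (Ioi 0 ×ˢ univ)) :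
    AEStronglyMeasurable f ((volume.restrict (Ioc a b)).prod μ) := by
  have hrestrict : (volume.restrict (Ioc a b)).prod μ =
      (volume.prod μ).restrict (Ioc a b ×ˢ univ) := by
    rw [← Measure.prod_restrict, Measure.restrict_univ]
  rw [hrestrict]
  exact (hf.mono (prod_mono (fun t ht => ha.trans_lt ht.1) le_rfl)).aestronglyMeasurable
    (measurableSet_Ioc.prod MeasurableSet.univ)

lemma continuous_slice {F : Type*} [TopologicalSpace F] {f : ℝ × E3 → F}
    (hf : ContinuousOn f posTime) {t : ℝ} (ht : 0 < t) : Continuous fun y => f (t, y) :=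
  continuousOn_univ.1 (hf.comp (by fun_prop) fun x _ => mem_posTime ht x)

/-- The mass distribution `|Ψ|²` at a fixed time. -/
def density (Ψ : ℝ × E3 → ℂ) (t : ℝ) (y : E3) : ℝ := ‖Ψ (t, y)‖ ^ 2

/-- The time derivative of `|Ψ|²`. -/
def densityRate (Ψ : ℝ × E3 → ℂ) (t : ℝ) (y : E3) : ℝ := 2 * (conj (Ψ (t, y)) * dt Ψ (t, y)).re

/-- The mean field of the transformed equation. -/
def scaledField (χ : ℝ → ℝ) (Ψ : ℝ × E3 → ℂ) (z : ℝ × E3) : ℝ :=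
  ∫ y, potential χ (z.1 • (z.2 - y)) * density Ψ z.1 y

/-- The kinetic part of the pseudoconformal energy. -/
def kinetic (Ψ : ℝ × E3 → ℂ) (t : ℝ) : ℝ := ∫ y, kineticDensity Ψ (t, y)

/-- The self-interaction energy of the mass distribution `|Ψ|²` through a kernel. -/
def interaction (k : E3 → ℝ) (Ψ : ℝ × E3 → ℂ) (t : ℝ) : ℝ :=
  1 / 2 * ∫ p, pairing k (density Ψ t) (density Ψ t) p

/-- The smooth solutions of the pseudoconformally transformed Hartree equation. -/
structure IsScaledSolution (χ : ℝ → ℝ) (Ψ : ℝ × E3 → ℂ) : Prop where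
  smooth : ContDiffOn ℝ ∞ Ψ posTime
  equation : ∀ z ∈ posTime, Complex.I * dt Ψ z + ((z.1 ^ 2 : ℝ) : ℂ)⁻¹ * lap Ψ z
    - (scaledField χ Ψ z : ℂ) * Ψ z = 0

/-- Bounds on the time interval `[a, b]` under which the energy law may be integrated over all of
space. The time derivative of the transformed solution grows in space, whence its weight. -/
structure Controlled (Ψ : ℝ × E3 → ℂ) (a b : ℝ) (B : ℝ≥0) : Prop where
  weighted : ∀ t ∈ Icc a b, ∫⁻ y, ‖(1 + ‖y‖) • Ψ (t, y)‖ₑ ^ 2 ≤ B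
  grad : ∀ t ∈ Icc a b, ∀ j, ∫⁻ y, ‖dx j Ψ (t, y)‖ₑ ^ 2 ≤ B
  time : ∀ t ∈ Icc a b, ∫⁻ y, ‖(1 + ‖y‖)⁻¹ • dt Ψ (t, y)‖ₑ ^ 2 ≤ B
  four : ∀ t ∈ Icc a b, ∫⁻ y, ‖Ψ (t, y)‖ₑ ^ 4 ≤ B

section Density

variable {Ψ : ℝ × E3 → ℂ} (h : ContDiffOn ℝ ∞ Ψ posTime)

lemma enorm_densityRate_le (t : ℝ) (y : E3) : ‖densityRate Ψ t y‖ₑ ≤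
    2 * (‖(1 + ‖y‖) • Ψ (t, y)‖ₑ ^ 2 + ‖(1 + ‖y‖)⁻¹ • dt Ψ (t, y)‖ₑ ^ 2) := by
  have hy : 1 + ‖y‖ ≠ 0 := by positivity
  rw [densityRate, enorm_mul, enorm_two]
  gcongr
  calc ‖(conj (Ψ (t, y)) * dt Ψ (t, y)).re‖ₑ ≤ ‖Ψ (t, y)‖ₑ * ‖dt Ψ (t, y)‖ₑ :=
        enorm_re_conj_mul_le _ _
    _ = ‖(1 + ‖y‖) • Ψ (t, y)‖ₑ * ‖(1 + ‖y‖)⁻¹ • dt Ψ (t, y)‖ₑ := by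
        rw [← enorm_mul, ← enorm_mul, smul_mul_smul_comm, mul_inv_cancel₀ hy, one_smul]
    _ ≤ _ := mul_le_sq_add_sq _ _

include h

lemma continuousOn_density : ContinuousOn (fun z : ℝ × E3 => density Ψ z.1 z.2) posTime :=
  (contDiffOn_norm_sq h).continuousOn

lemma continuousOn_densityRate : ContinuousOn (fun z : ℝ × E3 => densityRate Ψ z.1 z.2) posTime :=
  (contDiffOn_const.mul (contDiffOn_re_conj_mul h (contDiffOn_dt h))).continuousOn

lemma hasDerivAt_density {t : ℝ} (ht : 0 < t) (y : E3) :
    HasDerivAt (fun s => density Ψ s y) (densityRate Ψ t y) t := by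
  have hslice := hasDerivAt_slice (contDiffOn_norm_sq h) (by simp) ht y
  rwa [fderiv_norm_sq (differentiableAt_of_contDiffOn h (by simp) (mem_posTime ht y))] at hslice

lemma measurable_density {t : ℝ} (ht : 0 < t) : Measurable (density Ψ t) :=
  (continuous_slice (continuousOn_density h) ht).measurable

lemma measurable_densityRate {t : ℝ} (ht : 0 < t) : Measurable (densityRate Ψ t) :=
  (continuous_slice (continuousOn_densityRate h) ht).measurable

end Density

section Bounds

variable {χ : ℝ → ℝ} (hχ : IsDecreasingCutoff χ) {Ψ : ℝ × E3 → ℂ} (h : ContDiffOn ℝ ∞ Ψ posTime)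
  {a b : ℝ} (ha : 1 ≤ a) {B : ℝ≥0} (hB : Controlled Ψ a b B) {t : ℝ} (ht : t ∈ Icc a b)
include hB ht

lemma Controlled.lintegral_density_le : ∫⁻ y, ‖density Ψ t y‖ₑ ≤ B := by
  refine (lintegral_mono fun y => ?_).trans (hB.weighted t ht)
  rw [density, enorm_norm_sq, enorm_smul]
  gcongr
  refine le_mul_of_one_le_left zero_le ?_
  rw [Real.enorm_of_nonneg (by positivity), ← ENNReal.ofReal_one]
  exact ENNReal.ofReal_le_ofReal (le_add_of_nonneg_right (norm_nonneg y))

lemma Controlled.lintegral_density_sq_le : ∫⁻ y, ‖density Ψ t y‖ₑ ^ 2 ≤ B := by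
  refine le_trans (le_of_eq (lintegral_congr fun y => ?_)) (hB.four t ht)
  rw [density, enorm_norm_sq, ← pow_mul]

include ha h

lemma Controlled.lintegral_densityRate_le : ∫⁻ y, ‖densityRate Ψ t y‖ₑ ≤ 4 * B := by
  have hΨ : Continuous fun y => Ψ (t, y) :=
    continuous_slice h.continuousOn (by linarith [ht.1])
  have hmeas : Measurable fun y : E3 => ‖(1 + ‖y‖) • Ψ (t, y)‖ₑ ^ 2 :=
    ((continuous_const.add continuous_norm).smul hΨ).enorm.measurable.pow_const 2
  refine (lintegral_mono fun y => enorm_densityRate_le t y).trans ?_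
  rw [lintegral_const_mul' _ _ (by simp), lintegral_add_left hmeas]
  calc _ ≤ 2 * ((B : ℝ≥0∞) + B) := by
        gcongr
        · exact hB.weighted t ht
        · exact hB.time t ht
    _ = 4 * B := by ring

lemma Controlled.integrable_kineticDensity : Integrable fun y => kineticDensity Ψ (t, y) := by
  refine integrable_finsetSum _ fun j _ => ⟨?_, ?_⟩
  · exact ((continuous_slice (contDiffOn_dx h j).continuousOn
      (by linarith [ht.1])).norm.pow 2).aestronglyMeasurable
  · simp only [HasFiniteIntegral, enorm_norm_sq]
    exact (hB.grad t ht j).trans_lt ENNReal.coe_lt_top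

omit h
include hχ

lemma Controlled.enorm_scaledField_le (y : E3) :
    ‖scaledField χ Ψ (t, y)‖ₑ ≤ (∫⁻ x : E3, ‖potential χ x‖ₑ ^ 2) + B := by
  have hv := hχ.measurable_potential
  refine (enorm_integral_le_lintegral_enorm _).trans ?_
  calc ∫⁻ x, ‖potential χ (t • (y - x)) * density Ψ t x‖ₑ
      ≤ ∫⁻ x, ‖potential χ (y - x)‖ₑ * ‖density Ψ t x‖ₑ := by
        refine lintegral_mono fun x => ?_
        rw [enorm_mul]
        gcongr
        exact hχ.enorm_potential_smul_le (ha.trans ht.1) _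
    _ ≤ (∫⁻ x : E3, ‖potential χ (y - x)‖ₑ ^ 2) + ∫⁻ x, ‖density Ψ t x‖ₑ ^ 2 :=
        lintegral_mul_le_sq_add_sq (by fun_prop)
    _ ≤ _ := by
        rw [lintegral_sub_left_eq_self (fun y => ‖potential χ y‖ₑ ^ 2)]
        gcongr
        exact hB.lintegral_density_sq_le ht

end Bounds

/-- The source of the weighted kinetic energy density. -/
def kineticSource (χ w : ℝ → ℝ) (Ψ : ℝ × E3 → ℂ) (z : ℝ × E3) : ℝ :=
  deriv w z.1 * kineticDensity Ψ z
    - w z.1 * (z.1 ^ 2 * (scaledField χ Ψ z * densityRate Ψ z.1 z.2))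

lemma exists_enorm_le_on_Icc {w : ℝ → ℝ} {a b : ℝ} (hw : ContinuousOn w (Icc a b)) :
    ∃ C : ℝ≥0, ∀ t ∈ Icc a b, ‖w t‖ₑ ≤ C := by
  obtain ⟨C, hC⟩ := isCompact_Icc.exists_bound_of_continuousOn hw
  refine ⟨C.toNNReal, fun t ht => ?_⟩
  rw [← ofReal_norm]
  exact ENNReal.ofReal_le_ofReal (hC t ht)

lemma Icc_subset_Ioi_zero {a b : ℝ} (ha : 1 ≤ a) : Icc a b ⊆ Ioi (0 : ℝ) := fun _ ht =>
  zero_lt_one.trans_le (ha.trans ht.1)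

section KineticSource

variable {χ : ℝ → ℝ} {Ψ : ℝ × E3 → ℂ} (h : IsScaledSolution χ Ψ) {w : ℝ → ℝ}
include h

lemma IsScaledSolution.re_conj_lap_mul_dt {z : ℝ × E3} (hz : z ∈ posTime) :
    2 * (conj (lap Ψ z) * dt Ψ z).re = z.1 ^ 2 * (scaledField χ Ψ z * densityRate Ψ z.1 z.2) := by
  have ht : (z.1 : ℂ) ≠ 0 := by exact_mod_cast ne_of_gt hz.1
  have hlap : lap Ψ z = ((z.1 ^ 2 : ℝ) : ℂ) * (scaledField χ Ψ z * Ψ z - Complex.I * dt Ψ z) := by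
    have heq := h.equation z hz
    push_cast at heq ⊢
    field_simp at heq
    linear_combination heq
  have him : (conj (Complex.I * dt Ψ z) * dt Ψ z).re = 0 := by
    simp only [map_mul, Complex.conj_I, Complex.mul_re, Complex.mul_im, Complex.neg_re,
      Complex.neg_im, Complex.I_re, Complex.I_im, Complex.conj_re, Complex.conj_im]
    ring
  rw [hlap, map_mul, Complex.conj_ofReal, mul_assoc, Complex.re_ofReal_mul, map_sub, sub_mul,
    Complex.sub_re, him, map_mul, Complex.conj_ofReal, mul_assoc, Complex.re_ofReal_mul,
    densityRate]
  ring

lemma IsScaledSolution.source_kinetic (hw : ContDiffOn ℝ 1 w (Ioi 0)) {z : ℝ × E3}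
    (hz : z ∈ posTime) :
    source (fun z => w z.1 * kineticDensity Ψ z) (fun j z => w z.1 * kineticCurrent Ψ j z) z =
      kineticSource χ w Ψ z := by
  rw [source_time_mul hw ((contDiffOn_kineticDensity h.smooth).of_le (by simp))
    (fun j => (contDiffOn_kineticCurrent h.smooth j).of_le (by simp)) one_ne_zero hz,
    Hartree.source_kinetic h.smooth hz, h.re_conj_lap_mul_dt hz, kineticSource]
  ring

lemma IsScaledSolution.continuousOn_kineticSource (hw : ContDiffOn ℝ 1 w (Ioi 0)) :
    ContinuousOn (kineticSource χ w Ψ) posTime :=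
  (continuousOn_source (contDiffOn_time_mul hw
    ((contDiffOn_kineticDensity h.smooth).of_le (by simp))) fun j => contDiffOn_time_mul hw
      ((contDiffOn_kineticCurrent h.smooth j).of_le (by simp))).congr
    fun _ hz => (h.source_kinetic hw hz).symm

end KineticSource

section KineticBalance

variable {χ : ℝ → ℝ} {Ψ : ℝ × E3 → ℂ} {a b : ℝ} (ha : 1 ≤ a) {B : ℝ≥0} (hB : Controlled Ψ a b B)
  {w : ℝ → ℝ}
include ha hB

section FixedTime

variable (h : ContDiffOn ℝ ∞ Ψ posTime) {t : ℝ} (ht : t ∈ Icc a b) {C C' : ℝ≥0}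
  (hC : ‖w t‖ₑ ≤ C)
include h ht hC

lemma Controlled.lintegral_kineticSource_le (hχ : IsDecreasingCutoff χ) (hC' : ‖deriv w t‖ₑ ≤ C') :
    ∫⁻ y, ‖kineticSource χ w Ψ (t, y)‖ₑ ≤ C' * (3 * B) + C * (ENNReal.ofReal (b ^ 2)
      * (((∫⁻ x : E3, ‖potential χ x‖ₑ ^ 2) + B) * (4 * B))) := by
  have ht0 : 0 < t := Icc_subset_Ioi_zero ha ht
  have hdx : ∀ j, Measurable fun y => ‖dx j Ψ (t, y)‖ₑ ^ 2 := fun j =>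
    (continuous_slice (contDiffOn_dx h j).continuousOn ht0).enorm.measurable.pow_const 2
  have hrate : Measurable fun y => ‖densityRate Ψ t y‖ₑ := (measurable_densityRate h ht0).enorm
  calc ∫⁻ y, ‖kineticSource χ w Ψ (t, y)‖ₑ
      ≤ ∫⁻ y, (C' * (∑ j, ‖dx j Ψ (t, y)‖ₑ ^ 2) + C * (ENNReal.ofReal (b ^ 2)
          * (((∫⁻ x : E3, ‖potential χ x‖ₑ ^ 2) + B) * ‖densityRate Ψ t y‖ₑ))) := by
        refine lintegral_mono fun y => enorm_sub_le.trans (add_le_add ?_ ?_)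
        · rw [enorm_mul]
          gcongr
          exact (enorm_sum_le _ _).trans (by simp only [enorm_norm_sq, le_refl])
        · simp only [enorm_mul]
          gcongr
          · rw [Real.enorm_of_nonneg (by positivity)]
            exact ENNReal.ofReal_le_ofReal (by gcongr; exact ht.2)
          · exact hB.enorm_scaledField_le hχ ha ht y
    _ ≤ _ := by
        rw [lintegral_add_right _ (by fun_prop), lintegral_const_mul _ (by fun_prop),
          lintegral_const_mul _ (by fun_prop), lintegral_const_mul _ (by fun_prop),
          lintegral_const_mul _ hrate, lintegral_finsetSum _ fun j _ => hdx j]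
        gcongr
        · exact (Finset.sum_le_sum fun j _ => hB.grad t ht j).trans (by simp)
        · exact hB.lintegral_densityRate_le h ha ht

lemma Controlled.lintegral_kineticCurrent_le (j : Fin 3) :
    ∫⁻ y, ‖w t * kineticCurrent Ψ j (t, y) / (1 + ‖y‖)‖ₑ ≤ C * (2 * (B + B)) := by
  have hdx : Measurable fun y => ‖dx j Ψ (t, y)‖ₑ :=
    (continuous_slice (contDiffOn_dx h j).continuousOn (Icc_subset_Ioi_zero ha ht)).enorm.measurable
  calc _ ≤ ∫⁻ y, C * (2 * (‖dx j Ψ (t, y)‖ₑ * ‖(1 + ‖y‖)⁻¹ • dt Ψ (t, y)‖ₑ)) := by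
        refine lintegral_mono fun y => ?_
        have hdiv : w t * kineticCurrent Ψ j (t, y) / (1 + ‖y‖) =
            w t * (2 * (conj (dx j Ψ (t, y)) * ((1 + ‖y‖)⁻¹ • dt Ψ (t, y))).re) := by
          rw [kineticCurrent, mul_smul_comm, Complex.smul_re, smul_eq_mul]
          ring
        rw [hdiv, enorm_mul, enorm_mul, enorm_two]
        gcongr
        exact enorm_re_conj_mul_le _ _
    _ ≤ _ := by
        rw [lintegral_const_mul' _ _ (by finiteness), lintegral_const_mul' _ _ (by finiteness)]
        gcongr
        refine (lintegral_mul_le_sq_add_sq hdx).trans ?_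
        gcongr
        · exact hB.grad t ht j
        · exact hB.time t ht

end FixedTime

variable (hw : ContDiffOn ℝ 1 w (Ioi 0))
include hw

lemma Controlled.integrable_kineticSource (hχ : IsDecreasingCutoff χ) (h : IsScaledSolution χ Ψ) :
    Integrable (kineticSource χ w Ψ) (slab a b) := by
  have hpos : Icc a b ⊆ Ioi 0 := Icc_subset_Ioi_zero ha
  obtain ⟨C, hC⟩ := exists_enorm_le_on_Icc (hw.continuousOn.mono hpos)
  obtain ⟨C', hC'⟩ := exists_enorm_le_on_Icc
    ((hw.continuousOn_deriv_of_isOpen isOpen_Ioi le_rfl).mono hpos)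
  have hV := hχ.lintegral_potential_sq_ne_top
  exact integrable_prod_of_lintegral_le (aestronglyMeasurable_prod_of_continuousOn (by linarith)
    (h.continuousOn_kineticSource hw)) (by finiteness) fun t ht =>
      hB.lintegral_kineticSource_le ha h.smooth (Ioc_subset_Icc_self ht)
        (hC t (Ioc_subset_Icc_self ht)) hχ (hC' t (Ioc_subset_Icc_self ht))

lemma Controlled.integrable_kineticCurrent (h : ContDiffOn ℝ ∞ Ψ posTime) (j : Fin 3) :
    Integrable (fun z => w z.1 * kineticCurrent Ψ j z / (1 + ‖z.2‖)) (slab a b) := by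
  obtain ⟨C, hC⟩ := exists_enorm_le_on_Icc (hw.continuousOn.mono (Icc_subset_Ioi_zero ha))
  have hcont := (contDiffOn_time_mul hw
    ((contDiffOn_kineticCurrent h j).of_le (by simp))).continuousOn
  exact integrable_prod_of_lintegral_le (aestronglyMeasurable_prod_of_continuousOn (by linarith)
    (hcont.div (by fun_prop) fun z _ => by positivity)) (by finiteness) fun t ht =>
      hB.lintegral_kineticCurrent_le ha h (Ioc_subset_Icc_self ht)
        (hC t (Ioc_subset_Icc_self ht)) j

lemma Controlled.kinetic_balance (hχ : IsDecreasingCutoff χ) (h : IsScaledSolution χ Ψ)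
    (hab : a ≤ b) : w b * kinetic Ψ b - w a * kinetic Ψ a =
      ∫ z, kineticSource χ w Ψ z ∂(slab a b) := by
  have hae := (ae_slab_mem_posTime (b := b) (zero_le_one.trans ha)).mono
    fun z hz => h.source_kinetic hw hz
  rw [kinetic, kinetic, ← integral_const_mul, ← integral_const_mul, ← integral_congr_ae hae]
  exact balance (contDiffOn_time_mul hw ((contDiffOn_kineticDensity h.smooth).of_le (by simp)))
    (fun j => contDiffOn_time_mul hw ((contDiffOn_kineticCurrent h.smooth j).of_le (by simp)))
    (by linarith) hab ((hB.integrable_kineticDensity h.smooth ha ⟨le_rfl, hab⟩).const_mul (w a))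
    ((hB.integrable_kineticDensity h.smooth ha ⟨hab, le_rfl⟩).const_mul (w b))
    (hB.integrable_kineticCurrent ha hw h.smooth)
    ((hB.integrable_kineticSource ha hw hχ h).congr (EventuallyEq.symm hae))

end KineticBalance

/-- The time derivative of the weighted interaction density. -/
def interactionRate (χ w : ℝ → ℝ) (Ψ : ℝ × E3 → ℂ) (t : ℝ) (p : E3 × E3) : ℝ :=
  1 / 2 * pairing (kernelDeriv χ w t) (density Ψ t) (density Ψ t) p
    + 1 / 2 * (pairing (kernel χ w t) (densityRate Ψ t) (density Ψ t) p
      + pairing (kernel χ w t) (density Ψ t) (densityRate Ψ t) p)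

section Pairing

variable {χ : ℝ → ℝ} (hχ : IsDecreasingCutoff χ) {Ψ : ℝ × E3 → ℂ} {a b : ℝ} (ha : 1 ≤ a)
  {B : ℝ≥0} (hB : Controlled Ψ a b B) (h : ContDiffOn ℝ ∞ Ψ posTime) {t : ℝ} (ht : t ∈ Icc a b)
  {k : E3 → ℝ} {C : ℝ} (hkC : ∀ x, |k x| ≤ C * (potential χ x + 1))

lemma le_four_mul {x y : ℝ≥0∞} (hx : x ≤ y) : x ≤ 4 * y :=
  hx.trans (le_mul_of_one_le_left zero_le (by norm_num))

include hχ ha hB h ht hkC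

lemma Controlled.lintegral_density_density_le :
    ∫⁻ p, ‖pairing k (density Ψ t) (density Ψ t) p‖ₑ ≤ bilinearBound χ C (4 * B) :=
  lintegral_enorm_pairing_le_left hχ hkC (measurable_density h (Icc_subset_Ioi_zero ha ht))
    (measurable_density h (Icc_subset_Ioi_zero ha ht)) (le_four_mul (hB.lintegral_density_le ht))
    (le_four_mul (hB.lintegral_density_le ht)) (le_four_mul (hB.lintegral_density_sq_le ht))

lemma Controlled.lintegral_rate_density_le :
    ∫⁻ p, ‖pairing k (densityRate Ψ t) (density Ψ t) p‖ₑ ≤ bilinearBound χ C (4 * B) :=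
  lintegral_enorm_pairing_le_left hχ hkC (measurable_densityRate h (Icc_subset_Ioi_zero ha ht))
    (measurable_density h (Icc_subset_Ioi_zero ha ht)) (hB.lintegral_densityRate_le h ha ht)
    (le_four_mul (hB.lintegral_density_le ht)) (le_four_mul (hB.lintegral_density_sq_le ht))

lemma Controlled.lintegral_density_rate_le :
    ∫⁻ p, ‖pairing k (density Ψ t) (densityRate Ψ t) p‖ₑ ≤ bilinearBound χ C (4 * B) :=
  lintegral_enorm_pairing_le_right hχ hkC (measurable_density h (Icc_subset_Ioi_zero ha ht))
    (measurable_densityRate h (Icc_subset_Ioi_zero ha ht))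
    (le_four_mul (hB.lintegral_density_le ht)) (hB.lintegral_densityRate_le h ha ht)
    (le_four_mul (hB.lintegral_density_sq_le ht))

variable (hk : Measurable k)
include hk

lemma Controlled.integrable_density_density :
    Integrable (pairing k (density Ψ t) (density Ψ t)) :=
  have ht0 := Icc_subset_Ioi_zero ha ht
  ⟨(measurable_pairing hk (measurable_density h ht0)
    (measurable_density h ht0)).aestronglyMeasurable,
  (hB.lintegral_density_density_le hχ ha h ht hkC).trans_lt
    (bilinearBound_ne_top hχ (by finiteness)).lt_top⟩

lemma Controlled.integrable_rate_density :
    Integrable (pairing k (densityRate Ψ t) (density Ψ t)) :=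
  have ht0 := Icc_subset_Ioi_zero ha ht
  ⟨(measurable_pairing hk (measurable_densityRate h ht0)
    (measurable_density h ht0)).aestronglyMeasurable,
  (hB.lintegral_rate_density_le hχ ha h ht hkC).trans_lt
    (bilinearBound_ne_top hχ (by finiteness)).lt_top⟩

lemma Controlled.integrable_density_rate :
    Integrable (pairing k (density Ψ t) (densityRate Ψ t)) :=
  have ht0 := Icc_subset_Ioi_zero ha ht
  ⟨(measurable_pairing hk (measurable_density h ht0)
    (measurable_densityRate h ht0)).aestronglyMeasurable,
  (hB.lintegral_density_rate_le hχ ha h ht hkC).trans_lt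
    (bilinearBound_ne_top hχ (by finiteness)).lt_top⟩

end Pairing

section Regularity

variable {χ : ℝ → ℝ} (hχ : IsDecreasingCutoff χ) {Ψ : ℝ × E3 → ℂ} (h : ContDiffOn ℝ ∞ Ψ posTime)
  {w : ℝ → ℝ} (hw : ContDiffOn ℝ 1 w (Ioi 0)) {a b : ℝ}
include hχ hw

lemma exists_abs_kernels_le (ha : 1 ≤ a) : ∃ C : ℝ, ∀ t ∈ Icc a b, ∀ x : E3,
    |kernel χ w t x| ≤ C * (potential χ x + 1) ∧
      |kernelDeriv χ w t x| ≤ C * (potential χ x + 1) := by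
  have hpos : Icc a b ⊆ Ioi 0 := Icc_subset_Ioi_zero ha
  have hwc := hw.continuousOn.mono hpos
  obtain ⟨C₁, hC₁0, hC₁⟩ := exists_abs_kernel_le hχ ha hwc
  obtain ⟨C₂, hC₂0, hC₂⟩ := exists_abs_kernelDeriv_le hχ ha hwc
    ((hw.continuousOn_deriv_of_isOpen isOpen_Ioi le_rfl).mono hpos)
  refine ⟨C₁ + C₂, fun t ht x => ⟨(hC₁ t ht x).trans ?_, (hC₂ t ht x).trans ?_⟩⟩
  · have hv := hχ.potential_nonneg x
    gcongr <;> linarith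
  · have hv := hχ.potential_nonneg x
    gcongr
    linarith

include h

lemma hasDerivAt_pairing_density {t : ℝ} (ht : 0 < t) (p : E3 × E3) :
    HasDerivAt (fun s => 1 / 2 * pairing (kernel χ w s) (density Ψ s) (density Ψ s) p)
      (interactionRate χ w Ψ t p) t := by
  have hw' : DifferentiableAt ℝ w t :=
    (hw.contDiffAt (Ioi_mem_nhds ht)).differentiableAt one_ne_zero
  refine (((hasDerivAt_kernel hχ ht hw' (p.1 - p.2)).mul ((hasDerivAt_density h ht p.1).mul
    (hasDerivAt_density h ht p.2))).const_mul (1 / 2)).congr_deriv ?_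
  simp only [interactionRate, pairing, Pi.mul_apply]
  ring

lemma continuousOn_interactionRate (p : E3 × E3) :
    ContinuousOn (fun t => interactionRate χ w Ψ t p) (Ioi 0) := by
  have hkernel : ContinuousOn (fun t => kernel χ w t (p.1 - p.2)) (Ioi 0) := fun t ht =>
    (hasDerivAt_kernel hχ ht ((hw.contDiffAt (Ioi_mem_nhds ht)).differentiableAt one_ne_zero)
      (p.1 - p.2)).continuousAt.continuousWithinAt
  have hkernel' := continuousOn_kernelDeriv hχ hw.continuousOn
    (hw.continuousOn_deriv_of_isOpen isOpen_Ioi le_rfl) (p.1 - p.2)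
  have hslice : ∀ {f : ℝ × E3 → ℝ}, ContinuousOn f posTime → ∀ y,
      ContinuousOn (fun t => f (t, y)) (Ioi 0) := fun hf y =>
    hf.comp (by fun_prop) fun t ht => mem_posTime ht y
  have h1 := hslice (continuousOn_density h) p.1
  have h2 := hslice (continuousOn_density h) p.2
  have h3 := hslice (continuousOn_densityRate h) p.1
  have h4 := hslice (continuousOn_densityRate h) p.2
  unfold interactionRate pairing
  fun_prop

omit h

lemma aestronglyMeasurable_kernel {X : Type*} [MeasurableSpace X] [TopologicalSpace X]
    [BorelSpace X] [SecondCountableTopology X] {μ : Measure X} [SFinite μ] (ha : 0 ≤ a)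
    {g : X → E3} (hg : Continuous g) :
    AEStronglyMeasurable (fun q : ℝ × X => kernel χ w q.1 (g q.2))
      ((volume.restrict (Ioc a b)).prod μ) := by
  have hv := hχ.measurable_potential
  have hw1 : ContinuousOn (fun q : ℝ × X => w q.1) (Ioi 0 ×ˢ univ) :=
    hw.continuousOn.comp continuousOn_fst fun q hq => hq.1
  have hmeas : Measurable fun q : ℝ × X => q.1 ^ 2 * potential χ (q.1 • g q.2) := by fun_prop
  exact (aestronglyMeasurable_prod_of_continuousOn ha hw1).mul hmeas.aestronglyMeasurable

lemma aestronglyMeasurable_kernelDeriv {X : Type*} [MeasurableSpace X] [TopologicalSpace X]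
    [BorelSpace X] [SecondCountableTopology X] {μ : Measure X} [SFinite μ] (ha : 0 ≤ a)
    {g : X → E3} (hg : Continuous g) :
    AEStronglyMeasurable (fun q : ℝ × X => kernelDeriv χ w q.1 (g q.2))
      ((volume.restrict (Ioc a b)).prod μ) := by
  have hw1 : ContinuousOn (fun q : ℝ × X => w q.1) (Ioi 0 ×ˢ univ) :=
    hw.continuousOn.comp continuousOn_fst fun q hq => hq.1
  have hw2 : ContinuousOn (fun q : ℝ × X => deriv w q.1) (Ioi 0 ×ˢ univ) :=
    (hw.continuousOn_deriv_of_isOpen isOpen_Ioi le_rfl).comp continuousOn_fst fun q hq => hq.1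
  have hχ1 := hχ.smooth.continuous
  have hχ2 := hχ.continuous_deriv
  have hinv : Measurable fun q : ℝ × X => ‖g q.2‖⁻¹ := by fun_prop
  have hr : Continuous fun q : ℝ × X => q.1 * ‖g q.2‖ := by fun_prop
  have hg' : Continuous fun q : ℝ × X => ‖g q.2‖ := by fun_prop
  simp only [kernelDeriv, div_eq_mul_inv]
  exact (aestronglyMeasurable_prod_of_continuousOn ha
    ((((hw2.mul continuousOn_fst).add hw1).mul (hχ1.comp hr).continuousOn).add
      ((hw1.mul continuousOn_fst).mul ((hχ2.comp hr).mul hg').continuousOn))).mul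
    hinv.aestronglyMeasurable

include h

lemma aestronglyMeasurable_interactionRate (ha : 0 ≤ a) :
    AEStronglyMeasurable (fun q : ℝ × (E3 × E3) => interactionRate χ w Ψ q.1 q.2)
      ((volume.restrict (Ioc a b)).prod volume) := by
  have hsub : Continuous fun p : E3 × E3 => p.1 - p.2 := by fun_prop
  have hslice : ∀ {f : ℝ × E3 → ℝ}, ContinuousOn f posTime → ∀ {g : E3 × E3 → E3}, Continuous g →
      AEStronglyMeasurable (fun q : ℝ × (E3 × E3) => f (q.1, g q.2))
        ((volume.restrict (Ioc a b)).prod volume) := fun hf g hg =>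
    aestronglyMeasurable_prod_of_continuousOn ha
      (hf.comp (by fun_prop) fun q hq => mem_posTime hq.1 (g q.2))
  have hkernel := aestronglyMeasurable_kernel (μ := volume) (b := b) hχ hw ha hsub
  have hkernel' := aestronglyMeasurable_kernelDeriv (μ := volume) (b := b) hχ hw ha hsub
  have h1 := hslice (continuousOn_density h) continuous_fst
  have h2 := hslice (continuousOn_density h) continuous_snd
  have h3 := hslice (continuousOn_densityRate h) continuous_fst
  have h4 := hslice (continuousOn_densityRate h) continuous_snd
  exact ((hkernel'.mul (h1.mul h2)).const_mul _).add
    (((hkernel.mul (h3.mul h2)).add (hkernel.mul (h1.mul h4))).const_mul _)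

end Regularity

section InteractionBalance

variable {χ : ℝ → ℝ} (hχ : IsDecreasingCutoff χ) {Ψ : ℝ × E3 → ℂ} {a b : ℝ} (ha : 1 ≤ a)
  {B : ℝ≥0} (hB : Controlled Ψ a b B) (h : ContDiffOn ℝ ∞ Ψ posTime) {w : ℝ → ℝ} {t C : ℝ}
include hχ ha hB h

lemma Controlled.lintegral_interactionRate_le (ht : t ∈ Icc a b)
    (hk : ∀ x, |kernel χ w t x| ≤ C * (potential χ x + 1))
    (hk' : ∀ x, |kernelDeriv χ w t x| ≤ C * (potential χ x + 1)) :
    ∫⁻ p, ‖interactionRate χ w Ψ t p‖ₑ ≤ 3 * bilinearBound χ C (4 * B) := by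
  have hhalf : ∀ x : ℝ, ‖1 / 2 * x‖ₑ ≤ ‖x‖ₑ := fun x => by
    rw [enorm_le_iff_norm_le, norm_mul]
    exact mul_le_of_le_one_left (norm_nonneg x) (by norm_num)
  have hdd := (hB.integrable_density_density hχ ha h ht hk'
    (measurable_kernelDeriv hχ t)).aestronglyMeasurable.enorm
  have hrd := (hB.integrable_rate_density hχ ha h ht hk
    (measurable_kernel hχ t)).aestronglyMeasurable.enorm
  calc ∫⁻ p, ‖interactionRate χ w Ψ t p‖ₑ
      ≤ ∫⁻ p, (‖pairing (kernelDeriv χ w t) (density Ψ t) (density Ψ t) p‖ₑ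
          + (‖pairing (kernel χ w t) (densityRate Ψ t) (density Ψ t) p‖ₑ
            + ‖pairing (kernel χ w t) (density Ψ t) (densityRate Ψ t) p‖ₑ)) :=
        lintegral_mono fun p => (enorm_add_le _ _).trans
          (add_le_add (hhalf _) ((hhalf _).trans (enorm_add_le _ _)))
    _ ≤ bilinearBound χ C (4 * B) + (bilinearBound χ C (4 * B) + bilinearBound χ C (4 * B)) := by
        rw [lintegral_add_left' hdd, lintegral_add_left' hrd]
        gcongr
        · exact hB.lintegral_density_density_le hχ ha h ht hk'
        · exact hB.lintegral_rate_density_le hχ ha h ht hk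
        · exact hB.lintegral_density_rate_le hχ ha h ht hk
    _ = 3 * bilinearBound χ C (4 * B) := by ring

lemma Controlled.integrable_scaledField_mul_densityRate (ht : t ∈ Icc a b) :
    Integrable fun y => scaledField χ Ψ (t, y) * densityRate Ψ t y :=
  integrable_convolution_mul (hB.integrable_rate_density hχ ha h ht (C := 1)
    (fun x => by
      rw [Function.comp_apply, abs_of_nonneg (hχ.potential_nonneg _), one_mul]
      linarith [hχ.potential_smul_le (ha.trans ht.1) x])
    (hχ.measurable_potential.comp (measurable_const_smul t)))

variable (hw : ContDiffOn ℝ 1 w (Ioi 0))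
include hw

lemma Controlled.integrable_interactionRate :
    Integrable (fun q : ℝ × (E3 × E3) => interactionRate χ w Ψ q.1 q.2)
      ((volume.restrict (Ioc a b)).prod volume) := by
  obtain ⟨C, hC⟩ := exists_abs_kernels_le (b := b) hχ hw ha
  have hbound := bilinearBound_ne_top (A := 4 * B) (C := C) hχ (by finiteness)
  exact integrable_prod_of_lintegral_le
    (aestronglyMeasurable_interactionRate hχ h hw (zero_le_one.trans ha)) (by finiteness)
    fun t ht => hB.lintegral_interactionRate_le hχ ha h (Ioc_subset_Icc_self ht)
      (fun x => (hC t (Ioc_subset_Icc_self ht) x).1) fun x => (hC t (Ioc_subset_Icc_self ht) x).2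

lemma Controlled.interaction_balance (hab : a ≤ b) :
    interaction (kernel χ w b) Ψ b - interaction (kernel χ w a) Ψ a =
      ∫ q, interactionRate χ w Ψ q.1 q.2 ∂((volume.restrict (Ioc a b)).prod volume) := by
  obtain ⟨C, hC⟩ := exists_abs_kernels_le (b := b) hχ hw ha
  have hint : ∀ t ∈ Icc a b, Integrable fun p =>
      1 / 2 * pairing (kernel χ w t) (density Ψ t) (density Ψ t) p := fun t ht =>
    (hB.integrable_density_density hχ ha h ht (fun x => (hC t ht x).1)
      (measurable_kernel hχ t)).const_mul _
  rw [interaction, interaction, ← integral_const_mul, ← integral_const_mul]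
  exact integral_sub_integral_eq (F := fun t p =>
      1 / 2 * pairing (kernel χ w t) (density Ψ t) (density Ψ t) p) hab
    (fun p t ht => hasDerivAt_pairing_density hχ h hw (Icc_subset_Ioi_zero ha ht) p)
    (fun p => (continuousOn_interactionRate hχ h hw p).mono (Icc_subset_Ioi_zero ha))
    (hB.integrable_interactionRate hχ ha h hw) (hint a ⟨le_rfl, hab⟩) (hint b ⟨hab, le_rfl⟩)

lemma Controlled.integral_interactionRate (ht : t ∈ Icc a b) :
    ∫ p, interactionRate χ w Ψ t p = interaction (kernelDeriv χ w t) Ψ t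
      + w t * (t ^ 2 * ∫ y, scaledField χ Ψ (t, y) * densityRate Ψ t y) := by
  obtain ⟨C, hC⟩ := exists_abs_kernels_le (b := b) hχ hw ha
  have hdd := hB.integrable_density_density hχ ha h ht (fun x => (hC t ht x).2)
    (measurable_kernelDeriv hχ t)
  have hrd := hB.integrable_rate_density hχ ha h ht (fun x => (hC t ht x).1)
    (measurable_kernel hχ t)
  have hdr := hB.integrable_density_rate hχ ha h ht (fun x => (hC t ht x).1)
    (measurable_kernel hχ t)
  have hsymm : ∫ p, pairing (kernel χ w t) (density Ψ t) (densityRate Ψ t) p =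
      ∫ p, pairing (kernel χ w t) (densityRate Ψ t) (density Ψ t) p :=
    integral_pairing_comm fun x => by rw [kernel, smul_neg, potential_neg, kernel]
  have hfield : ∫ p, pairing (kernel χ w t) (densityRate Ψ t) (density Ψ t) p =
      w t * (t ^ 2 * ∫ y, scaledField χ Ψ (t, y) * densityRate Ψ t y) := by
    rw [integral_pairing hrd, ← integral_const_mul, ← integral_const_mul]
    refine integral_congr_ae (ae_of_all _ fun y => ?_)
    simp only [kernel, scaledField, mul_assoc, integral_const_mul]
  simp only [interactionRate]
  rw [integral_add (hdd.const_mul _) ((hrd.fun_add hdr).const_mul _), integral_const_mul,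
    integral_const_mul, integral_add hrd hdr, hsymm, hfield, interaction]
  ring

end InteractionBalance

section EnergyLaw

variable {χ : ℝ → ℝ} (hχ : IsDecreasingCutoff χ) {Ψ : ℝ × E3 → ℂ} {a b : ℝ} (ha : 1 ≤ a)
  {B : ℝ≥0} (hB : Controlled Ψ a b B) (h : IsScaledSolution χ Ψ) {w : ℝ → ℝ}
  (hw : ContDiffOn ℝ 1 w (Ioi 0))
include hχ ha hB h hw

lemma Controlled.integral_kineticSource_add_interactionRate {t : ℝ} (ht : t ∈ Icc a b) :
    (∫ y, kineticSource χ w Ψ (t, y)) + ∫ p, interactionRate χ w Ψ t p =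
      deriv w t * kinetic Ψ t + interaction (kernelDeriv χ w t) Ψ t := by
  have hK := hB.integrable_kineticDensity h.smooth ha ht
  have hI := hB.integrable_scaledField_mul_densityRate hχ ha h.smooth ht
  simp only [kineticSource]
  rw [integral_sub (hK.const_mul _) ((hI.const_mul _).const_mul _), integral_const_mul,
    integral_const_mul, integral_const_mul, hB.integral_interactionRate hχ ha h.smooth hw ht,
    kinetic]
  ring

lemma Controlled.integrableOn_energyRate : IntegrableOn
    (fun t => deriv w t * kinetic Ψ t + interaction (kernelDeriv χ w t) Ψ t) (Ioc a b) :=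
  ((hB.integrable_kineticSource ha hw hχ h).integral_prod_left.add
    (hB.integrable_interactionRate hχ ha h.smooth hw).integral_prod_left).congr
      ((ae_restrict_mem measurableSet_Ioc).mono fun _ ht =>
        hB.integral_kineticSource_add_interactionRate hχ ha h hw (Ioc_subset_Icc_self ht))

lemma Controlled.energy_law (hab : a ≤ b) :
    (w b * kinetic Ψ b + interaction (kernel χ w b) Ψ b)
      - (w a * kinetic Ψ a + interaction (kernel χ w a) Ψ a) =
      ∫ t in Ioc a b, (deriv w t * kinetic Ψ t + interaction (kernelDeriv χ w t) Ψ t) := by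
  have hK := hB.integrable_kineticSource ha hw hχ h
  have hI := hB.integrable_interactionRate hχ ha h.smooth hw
  calc _ = (∫ z, kineticSource χ w Ψ z ∂(slab a b))
        + ∫ q, interactionRate χ w Ψ q.1 q.2 ∂((volume.restrict (Ioc a b)).prod volume) := by
        rw [← hB.kinetic_balance ha hw hχ h hab, ← hB.interaction_balance hχ ha h.smooth hw hab]
        ring
    _ = ∫ t in Ioc a b, ((∫ y, kineticSource χ w Ψ (t, y))
        + ∫ p, interactionRate χ w Ψ t p) := by
        rw [slab, integral_prod _ hK, integral_prod _ hI,
          ← integral_add hK.integral_prod_left hI.integral_prod_left]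
    _ = _ := setIntegral_congr_fun measurableSet_Ioc fun t ht =>
        hB.integral_kineticSource_add_interactionRate hχ ha h hw (Ioc_subset_Icc_self ht)

end EnergyLaw

/-! ### Growth of the transformed solution -/

section Sign

variable {k : E3 → ℝ} {Ψ : ℝ × E3 → ℂ} {t : ℝ}

lemma density_nonneg (Ψ : ℝ × E3 → ℂ) (t : ℝ) (y : E3) : 0 ≤ density Ψ t y := sq_nonneg _

lemma kinetic_nonneg (Ψ : ℝ × E3 → ℂ) (t : ℝ) : 0 ≤ kinetic Ψ t :=
  integral_nonneg fun _ => Finset.sum_nonneg fun _ _ => sq_nonneg _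

lemma pairing_density_nonneg (hk : ∀ x, 0 ≤ k x) (Ψ : ℝ × E3 → ℂ) (t : ℝ) (p : E3 × E3) :
    0 ≤ pairing k (density Ψ t) (density Ψ t) p :=
  mul_nonneg (hk _) (mul_nonneg (density_nonneg _ _ _) (density_nonneg _ _ _))

lemma interaction_nonneg (hk : ∀ x, 0 ≤ k x) (Ψ : ℝ × E3 → ℂ) (t : ℝ) : 0 ≤ interaction k Ψ t :=
  mul_nonneg (by norm_num) (integral_nonneg (pairing_density_nonneg hk Ψ t))

lemma interaction_nonpos (hk : ∀ x, k x ≤ 0) (Ψ : ℝ × E3 → ℂ) (t : ℝ) : interaction k Ψ t ≤ 0 :=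
  mul_nonpos_of_nonneg_of_nonpos (by norm_num) (integral_nonpos fun _ =>
    mul_nonpos_of_nonpos_of_nonneg (hk _)
      (mul_nonneg (density_nonneg _ _ _) (density_nonneg _ _ _)))

lemma lintegral_pairing_density_le (hk : Measurable k) (hk0 : ∀ x, 0 ≤ k x) (hki : Integrable k)
    (hΨ : Measurable (density Ψ t)) {X : ℝ} (hX : 0 ≤ X)
    (hfour : ∫⁻ y, ‖Ψ (t, y)‖ₑ ^ 4 ≤ ENNReal.ofReal X) :
    ∫⁻ p, ENNReal.ofReal (pairing k (density Ψ t) (density Ψ t) p) ≤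
      ENNReal.ofReal (2 * ((∫ x, k x) * X)) := by
  have hsq : ∀ y, ENNReal.ofReal (density Ψ t y) ^ 2 = ‖Ψ (t, y)‖ₑ ^ 4 := fun y => by
    rw [density, ENNReal.ofReal_pow (norm_nonneg _), ofReal_norm, ← pow_mul]
  calc ∫⁻ p, ENNReal.ofReal (pairing k (density Ψ t) (density Ψ t) p)
      = ∫⁻ p : E3 × E3, ENNReal.ofReal (k (p.1 - p.2)) *
          (ENNReal.ofReal (density Ψ t p.1) * ENNReal.ofReal (density Ψ t p.2)) := by
        refine lintegral_congr fun p => ?_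
        rw [pairing, ENNReal.ofReal_mul (hk0 _), ENNReal.ofReal_mul (density_nonneg _ _ _)]
    _ ≤ 2 * (∫⁻ x, ENNReal.ofReal (k x)) * ∫⁻ y, ENNReal.ofReal (density Ψ t y) ^ 2 :=
        lintegral_kernel_sq_le hk.ennreal_ofReal hΨ.ennreal_ofReal
    _ ≤ 2 * ENNReal.ofReal (∫ x, k x) * ENNReal.ofReal X := by
        rw [lintegral_congr hsq, ofReal_integral_eq_lintegral_ofReal hki (ae_of_all _ hk0)]
        gcongr
    _ = ENNReal.ofReal (2 * ((∫ x, k x) * X)) := by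
        rw [← mul_assoc 2, ENNReal.ofReal_mul' hX, ENNReal.ofReal_mul zero_le_two,
          ENNReal.ofReal_ofNat]

lemma interaction_le (hk : Measurable k) (hk0 : ∀ x, 0 ≤ k x) (hki : Integrable k)
    (hΨ : Measurable (density Ψ t)) {X : ℝ} (hX : 0 ≤ X)
    (hfour : ∫⁻ y, ‖Ψ (t, y)‖ₑ ^ 4 ≤ ENNReal.ofReal X) : interaction k Ψ t ≤ (∫ x, k x) * X := by
  have hI : 0 ≤ ∫ x, k x := integral_nonneg hk0
  have hle : ∫ p, pairing k (density Ψ t) (density Ψ t) p ≤ 2 * ((∫ x, k x) * X) := by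
    rw [integral_eq_lintegral_of_nonneg_ae (ae_of_all _ (pairing_density_nonneg hk0 Ψ t))
      (measurable_pairing hk hΨ hΨ).aestronglyMeasurable]
    exact ENNReal.toReal_le_of_le_ofReal (by positivity)
      (lintegral_pairing_density_le hk hk0 hki hΨ hX hfour)
  rw [interaction]
  linarith

end Sign

/-- A solution of the transformed equation for which the energy law holds on every interval
`[1, T]`, with mass at most `M` and initial energy at most `E`. -/
structure IsBoundedScaledSolution (χ : ℝ → ℝ) (M E : ℝ) (Ψ : ℝ × E3 → ℂ) : Prop
    extends IsScaledSolution χ Ψ where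
  controlled : ∀ T, ∃ B, Controlled Ψ 1 T B
  mass : ∀ t, 1 ≤ t → ∫⁻ y, ‖Ψ (t, y)‖ₑ ^ 2 ≤ ENNReal.ofReal M
  energy : kinetic Ψ 1 + interaction (potential χ) Ψ 1 ≤ E

lemma kernel_at_one (χ : ℝ → ℝ) {w : ℝ → ℝ} (hw : w 1 = 1) : kernel χ w 1 = potential χ := by
  funext x
  simp only [kernel, hw, one_pow, one_mul, one_smul]

lemma IsDecreasingCutoff.kernel_nonneg {χ w : ℝ → ℝ} (hχ : IsDecreasingCutoff χ) {t : ℝ}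
    (hw : 0 ≤ w t) (x : E3) : 0 ≤ kernel χ w t x :=
  mul_nonneg hw (mul_nonneg (sq_nonneg t) (hχ.potential_nonneg _))

lemma integral_mul_potential_smul (χ : ℝ → ℝ) {t : ℝ} (ht : 0 < t) :
    ∫ x, t * potential χ (t • x) = t ^ (-2 : ℝ) * ∫ x, potential χ x := by
  rw [integral_const_mul, Measure.integral_comp_smul_of_nonneg _ _ _ (hR := ht.le),
    finrank_euclideanSpace, Fintype.card_fin, smul_eq_mul, Real.rpow_neg ht.le, Real.rpow_two]
  field_simp

namespace IsBoundedScaledSolution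

variable {χ : ℝ → ℝ} (hχ : IsDecreasingCutoff χ) {M E : ℝ} {Ψ : ℝ × E3 → ℂ}
  (h : IsBoundedScaledSolution χ M E Ψ) {t : ℝ} (ht : 1 ≤ t)

include h ht in
lemma lintegral_pow_six_le :
    ∫⁻ y, ‖Ψ (t, y)‖ₑ ^ 6 ≤ sobolevConst * ENNReal.ofReal (kinetic Ψ t) ^ 3 := by
  have ht0 : 0 < t := zero_lt_one.trans_le ht
  obtain ⟨B, hB⟩ := h.controlled t
  refine (lintegral_enorm_pow_six_le ((contDiff_slice h.smooth ht0).of_le (by simp))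
    ((h.mass t ht).trans_lt ENNReal.ofReal_lt_top).ne).trans_eq ?_
  rw [kinetic, ofReal_integral_eq_lintegral_ofReal
    (hB.integrable_kineticDensity h.smooth le_rfl ⟨ht, le_rfl⟩)
    (ae_of_all _ fun y => Finset.sum_nonneg fun j _ => sq_nonneg _)]
  simp only [partialDeriv, fderiv_slice h.smooth (by simp : (∞ : WithTop ℕ∞) ≠ 0) ht0]
  rfl

include hχ h

lemma energy_nonneg : 0 ≤ E :=
  (add_nonneg (kinetic_nonneg _ _) (interaction_nonneg hχ.potential_nonneg _ _)).trans h.energy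

include ht

lemma weighted_kinetic_le {w : ℝ → ℝ} (hw : ContDiffOn ℝ 1 w (Ioi 0)) (hw1 : w 1 = 1)
    (hwt : 0 ≤ w t) : w t * kinetic Ψ t ≤
      E + ∫ s in Ioc 1 t, (deriv w s * kinetic Ψ s + interaction (kernelDeriv χ w s) Ψ s) := by
  obtain ⟨B, hB⟩ := h.controlled t
  have hlaw := hB.energy_law hχ le_rfl h.toIsScaledSolution hw ht
  rw [kernel_at_one χ hw1, hw1, one_mul] at hlaw
  linarith [h.energy, interaction_nonneg (hχ.kernel_nonneg hwt) Ψ t]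

-- The weight `1/s` makes both terms of the energy law nonpositive, the second because `χ' ≤ 0`.
lemma kinetic_le_linear : kinetic Ψ t ≤ E * t := by
  have ht0 : 0 < t := zero_lt_one.trans_le ht
  have hw : ContDiffOn ℝ 1 (fun s : ℝ => s⁻¹) (Ioi 0) :=
    contDiffOn_id.inv fun s hs => ne_of_gt hs
  have hneg : ∫ s in Ioc 1 t, (deriv (fun s : ℝ => s⁻¹) s * kinetic Ψ s
      + interaction (kernelDeriv χ (fun s => s⁻¹) s) Ψ s) ≤ 0 := by
    refine setIntegral_nonpos measurableSet_Ioc fun s hs => ?_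
    have hs0 : 0 < s := zero_lt_one.trans hs.1
    rw [deriv_inv]
    exact add_nonpos
      (mul_nonpos_of_nonpos_of_nonneg (neg_nonpos.2 (by positivity)) (kinetic_nonneg _ _))
      (interaction_nonpos (kernelDeriv_inv_nonpos hχ hs0) _ _)
  have hle := h.weighted_kinetic_le hχ ht hw inv_one (inv_nonneg.2 ht0.le)
  rw [← div_le_iff₀ ht0, div_eq_inv_mul]
  linarith

lemma lintegral_pow_four_le : ∫⁻ y, ‖Ψ (t, y)‖ₑ ^ 4 ≤
    ENNReal.ofReal (√(M * (sobolevConst * E ^ 3)) * t ^ (3 / 2 : ℝ)) := by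
  have ht0 : 0 < t := zero_lt_one.trans_le ht
  have hE := h.energy_nonneg hχ
  have hroot : √(M * (sobolevConst * (E * t) ^ 3)) =
      √(M * (sobolevConst * E ^ 3)) * t ^ (3 / 2 : ℝ) := by
    have hsq : t ^ 3 = (t ^ (3 / 2 : ℝ)) ^ 2 := by
      rw [← Real.rpow_natCast (t ^ (3 / 2 : ℝ)), ← Real.rpow_mul ht0.le]
      norm_num
    rw [mul_pow, ← mul_assoc (sobolevConst : ℝ), ← mul_assoc M, hsq,
      Real.sqrt_mul' _ (sq_nonneg _), Real.sqrt_sq (by positivity)]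
  rw [← hroot]
  refine lintegral_pow_four_le_sqrt
    (continuous_slice h.smooth.continuousOn ht0).enorm.measurable.aemeasurable ?_
  rw [ENNReal.ofReal_mul' (by positivity), ENNReal.ofReal_mul (by positivity),
    ENNReal.ofReal_pow (by positivity), ENNReal.ofReal_coe_nnreal]
  gcongr
  · exact h.mass t ht
  · exact (h.lintegral_pow_six_le ht).trans (by gcongr; exact h.kinetic_le_linear hχ ht)

lemma interaction_kernelDeriv_one_le :
    interaction (kernelDeriv χ (fun _ => 1) t) Ψ t ≤
      interaction (fun x => t * potential χ (t • x)) Ψ t := by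
  have ht0 : 0 < t := zero_lt_one.trans_le ht
  have htI : t ∈ Icc 1 t := ⟨ht, le_rfl⟩
  obtain ⟨B, hB⟩ := h.controlled t
  obtain ⟨C, hC⟩ := exists_abs_kernels_le (b := t) hχ (w := fun _ => (1 : ℝ)) contDiffOn_const
    le_rfl
  have hk : Measurable fun x => t * potential χ (t • x) := by
    have := hχ.measurable_potential
    fun_prop
  have hkC : ∀ x, |t * potential χ (t • x)| ≤ t * (potential χ x + 1) := fun x => by
    rw [abs_of_nonneg (mul_nonneg ht0.le (hχ.potential_nonneg _))]
    exact mul_le_mul_of_nonneg_left ((hχ.potential_smul_le ht x).trans (by simp)) ht0.le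
  refine mul_le_mul_of_nonneg_left (integral_mono
    (hB.integrable_density_density hχ le_rfl h.smooth htI (fun x => (hC t htI x).2)
      (measurable_kernelDeriv hχ t))
    (hB.integrable_density_density hχ le_rfl h.smooth htI hkC hk) fun p => ?_) (by norm_num)
  exact mul_le_mul_of_nonneg_right (kernelDeriv_one_le hχ ht0 _)
    (mul_nonneg (density_nonneg _ _ _) (density_nonneg _ _ _))

lemma interaction_kernelDeriv_one_le_rpow :
    interaction (kernelDeriv χ (fun _ => 1) t) Ψ t ≤
      (∫ x, potential χ x) * √(M * (sobolevConst * E ^ 3)) * t ^ (-(1 / 2) : ℝ) := by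
  have ht0 : 0 < t := zero_lt_one.trans_le ht
  calc interaction (kernelDeriv χ (fun _ => 1) t) Ψ t
      ≤ interaction (fun x => t * potential χ (t • x)) Ψ t :=
        h.interaction_kernelDeriv_one_le hχ ht
    _ ≤ (∫ x, t * potential χ (t • x)) * (√(M * (sobolevConst * E ^ 3)) * t ^ (3 / 2 : ℝ)) := by
        refine interaction_le ?_ (fun x => mul_nonneg ht0.le (hχ.potential_nonneg _))
          ((hχ.integrable_potential.comp_smul ht0.ne').const_mul t)
          (measurable_density h.smooth ht0) (by positivity) (h.lintegral_pow_four_le hχ ht)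
        have := hχ.measurable_potential
        fun_prop
    _ = _ := by
        rw [integral_mul_potential_smul χ ht0, show (-(1 / 2) : ℝ) = -2 + 3 / 2 by norm_num,
          Real.rpow_add ht0]
        ring

lemma kinetic_le_sqrt : kinetic Ψ t ≤
    (E + 2 * ((∫ x, potential χ x) * √(M * (sobolevConst * E ^ 3)))) * t ^ (1 / 2 : ℝ) := by
  set c := (∫ x, potential χ x) * √(M * (sobolevConst * E ^ 3))
  have hc : 0 ≤ c := mul_nonneg (integral_nonneg hχ.potential_nonneg) (Real.sqrt_nonneg _)
  have hrate : ∫ s in Ioc 1 t, (deriv (fun _ : ℝ => (1 : ℝ)) s * kinetic Ψ s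
      + interaction (kernelDeriv χ (fun _ => 1) s) Ψ s) ≤ 2 * c * t ^ (1 / 2 : ℝ) - 2 * c := by
    obtain ⟨B, hB⟩ := h.controlled t
    have hint : IntervalIntegrable (fun s : ℝ => c * s ^ (-(1 / 2) : ℝ)) volume 1 t :=
      (intervalIntegral.intervalIntegrable_rpow' (by norm_num)).const_mul _
    refine (setIntegral_mono_on
      (hB.integrableOn_energyRate hχ le_rfl h.toIsScaledSolution contDiffOn_const)
      ((intervalIntegrable_iff_integrableOn_Ioc_of_le ht).1 hint) measurableSet_Ioc
      fun s hs => ?_).trans_eq ?_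
    · rw [deriv_const, zero_mul, zero_add]
      exact h.interaction_kernelDeriv_one_le_rpow hχ hs.1.le
    · rw [← intervalIntegral.integral_of_le ht, intervalIntegral.integral_const_mul,
        integral_rpow (Or.inl (by norm_num)), Real.one_rpow]
      norm_num
      ring
  have hle := h.weighted_kinetic_le hχ ht contDiffOn_const rfl zero_le_one
  have hE : E ≤ E * t ^ (1 / 2 : ℝ) :=
    le_mul_of_one_le_right (h.energy_nonneg hχ) (Real.one_le_rpow ht (by norm_num))
  rw [one_mul] at hle
  linarith

end IsBoundedScaledSolution

/-! ### The solution on space-time -/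

/-- A time-dependent function as a function on space-time. -/
def spacetime (φ : ℝ → E3 → ℂ) (z : ℝ × E3) : ℂ := φ z.1 z.2

/-- Uniform `H²` bounds on the time interval `(0, T]`, for the solution seen on space-time. -/
structure SobolevBound (φ : ℝ → E3 → ℂ) (T : ℝ) (B : ℝ≥0) : Prop where
  zero : ∀ t ∈ Ioc 0 T, ∫⁻ x, ‖φ t x‖ₑ ^ 2 ≤ B
  one : ∀ t ∈ Ioc 0 T, ∀ j, ∫⁻ x, ‖dx j (spacetime φ) (t, x)‖ₑ ^ 2 ≤ B
  two : ∀ t ∈ Ioc 0 T, ∫⁻ x, ‖lap (spacetime φ) (t, x)‖ₑ ^ 2 ≤ B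

namespace IsGlobalSmoothSolution

variable {v : E3 → ℝ} {φ₀ : E3 → ℂ} {φ : ℝ → E3 → ℂ} (hφ : IsGlobalSmoothSolution v φ₀ φ)
include hφ

lemma contDiffOn_spacetime : ContDiffOn ℝ ∞ (spacetime φ) posTime :=
  hφ.smooth.mono (prod_mono Ioi_subset_Ici_self le_rfl)

section Slice

variable {t : ℝ} (ht : 0 < t)
include ht

lemma contDiff_slice : ContDiff ℝ ∞ (φ t) :=
  Hartree.contDiff_slice hφ.contDiffOn_spacetime ht

lemma continuous_slice : Continuous (φ t) := (hφ.contDiff_slice ht).continuous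

lemma partialDeriv_eq (j : Fin 3) (x : E3) :
    partialDeriv j (φ t) x = dx j (spacetime φ) (t, x) :=
  fderiv_slice hφ.contDiffOn_spacetime (by simp) ht x j

lemma iteratedFDeriv_two_eq (j : Fin 3) (x : E3) :
    iteratedFDeriv ℝ 2 (φ t) x ![EuclideanSpace.single j 1, EuclideanSpace.single j 1] =
      dx j (dx j (spacetime φ)) (t, x) := by
  have hd : Differentiable ℝ (fderiv ℝ (φ t)) :=
    ((hφ.contDiff_slice ht).fderiv_right (m := ∞) (by simp)).differentiable (by simp)
  have hdx : (fun y => dx j (spacetime φ) (t, y)) =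
      fun y => fderiv ℝ (φ t) y (EuclideanSpace.single j 1) :=
    funext fun y => (hφ.partialDeriv_eq ht j y).symm
  rw [iteratedFDeriv_two_apply, dx,
    ← fderiv_slice (contDiffOn_dx hφ.contDiffOn_spacetime j) (by simp) ht, hdx,
    fderiv_clm_apply (hd x) (differentiableAt_const _)]
  simp

lemma laplacian_eq (x : E3) : Laplacian.laplacian (φ t) x = lap (spacetime φ) (t, x) := by
  rw [InnerProductSpace.laplacian_eq_iteratedFDeriv_orthonormalBasis (φ t)
    (EuclideanSpace.basisFun (Fin 3) ℝ), lap]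
  refine Finset.sum_congr rfl fun j _ => ?_
  rw [← hφ.iteratedFDeriv_two_eq ht, EuclideanSpace.basisFun_apply]

lemma enorm_dx_le (j : Fin 3) (x : E3) :
    ‖dx j (spacetime φ) (t, x)‖ₑ ≤ ‖iteratedFDeriv ℝ 1 (φ t) x‖ₑ := by
  rw [enorm_le_iff_norm_le, ← hφ.partialDeriv_eq ht, norm_iteratedFDeriv_one, partialDeriv]
  simpa using (fderiv ℝ (φ t) x).le_opNorm (EuclideanSpace.single j 1)

lemma enorm_lap_le (x : E3) :
    ‖lap (spacetime φ) (t, x)‖ₑ ≤ 3 * ‖iteratedFDeriv ℝ 2 (φ t) x‖ₑ := by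
  have hterm : ∀ j, ‖dx j (dx j (spacetime φ)) (t, x)‖ₑ ≤ ‖iteratedFDeriv ℝ 2 (φ t) x‖ₑ :=
    fun j => by
      rw [enorm_le_iff_norm_le, ← hφ.iteratedFDeriv_two_eq ht]
      refine ((iteratedFDeriv ℝ 2 (φ t) x).le_opNorm _).trans_eq ?_
      simp [Fin.prod_univ_two]
  calc ‖lap (spacetime φ) (t, x)‖ₑ ≤ ∑ _j : Fin 3, ‖iteratedFDeriv ℝ 2 (φ t) x‖ₑ :=
        (enorm_sum_le _ _).trans (Finset.sum_le_sum fun j _ => hterm j)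
    _ = 3 * ‖iteratedFDeriv ℝ 2 (φ t) x‖ₑ := by simp

end Slice

lemma equation_spacetime {z : ℝ × E3} (hz : z ∈ posTime) :
    Complex.I * dt (spacetime φ) z + lap (spacetime φ) z
      - (meanField v (φ z.1) z.2 : ℂ) * spacetime φ z = 0 := by
  have hd : HasDerivAt (fun s => φ s z.2) (dt (spacetime φ) z) z.1 :=
    hasDerivAt_slice hφ.contDiffOn_spacetime (by simp) hz.1 z.2
  have h := hφ.equation z.1 hz.1 z.2
  rwa [hφ.laplacian_eq hz.1, hd.deriv] at h

lemma exists_sobolevBound (T : ℝ) : ∃ B, SobolevBound φ T B := by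
  obtain ⟨B, hB⟩ := hφ.sobolev T
  have hk : ∀ t ∈ Ioc 0 T, ∀ k ≤ 2,
      ∫⁻ x, ‖iteratedFDeriv ℝ k (φ t) x‖ₑ ^ 2 ≤ ENNReal.ofReal B ^ 2 := fun t ht k hk => by
    rw [lintegral_enorm_pow _ two_ne_zero]
    gcongr
    exact hB t (Ioc_subset_Icc_self ht) k hk
  have hcoe : ((9 * B.toNNReal ^ 2 : ℝ≥0) : ℝ≥0∞) = 9 * ENNReal.ofReal B ^ 2 := by
    push_cast
    rfl
  have hle : ENNReal.ofReal B ^ 2 ≤ 9 * ENNReal.ofReal B ^ 2 :=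
    le_mul_of_one_le_left zero_le (by norm_num)
  refine ⟨9 * B.toNNReal ^ 2, fun t ht => ?_, fun t ht j => ?_, fun t ht => ?_⟩ <;> rw [hcoe]
  · refine (lintegral_mono fun x => ?_).trans ((hk t ht 0 zero_le_two).trans hle)
    gcongr
    rw [enorm_le_iff_norm_le, norm_iteratedFDeriv_zero]
  · refine (lintegral_mono fun x => ?_).trans ((hk t ht 1 one_le_two).trans hle)
    gcongr
    exact hφ.enorm_dx_le ht.1 j x
  · calc ∫⁻ x, ‖lap (spacetime φ) (t, x)‖ₑ ^ 2
        ≤ ∫⁻ x, 9 * ‖iteratedFDeriv ℝ 2 (φ t) x‖ₑ ^ 2 := by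
          refine lintegral_mono fun x => (pow_le_pow_left' (hφ.enorm_lap_le ht.1 x) 2).trans_eq ?_
          rw [mul_pow]
          norm_num
      _ ≤ 9 * ENNReal.ofReal B ^ 2 := by
          rw [lintegral_const_mul' _ _ (by finiteness)]
          gcongr
          exact hk t ht 2 le_rfl

end IsGlobalSmoothSolution

lemma SobolevBound.mono {φ : ℝ → E3 → ℂ} {s T : ℝ} {B : ℝ≥0} (hB : SobolevBound φ T B)
    (hs : s ≤ T) : SobolevBound φ s B where
  zero t ht := hB.zero t ⟨ht.1, ht.2.trans hs⟩
  one t ht := hB.one t ⟨ht.1, ht.2.trans hs⟩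
  two t ht := hB.two t ⟨ht.1, ht.2.trans hs⟩

/-! ### Propagation of weighted mass -/

lemma lintegral_kineticDensity_le {Φ : ℝ × E3 → ℂ} (h : ContDiffOn ℝ ∞ Φ posTime) {t : ℝ}
    (ht : 0 < t) {B : ℝ≥0∞} (hB : ∀ j, ∫⁻ x, ‖dx j Φ (t, x)‖ₑ ^ 2 ≤ B) :
    ∫⁻ x, ‖kineticDensity Φ (t, x)‖ₑ ≤ 3 * B := by
  calc ∫⁻ x, ‖kineticDensity Φ (t, x)‖ₑ ≤ ∫⁻ x, ∑ j, ‖dx j Φ (t, x)‖ₑ ^ 2 := by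
        refine lintegral_mono fun x => (enorm_sum_le _ _).trans_eq ?_
        simp only [enorm_norm_sq]
    _ = ∑ j, ∫⁻ x, ‖dx j Φ (t, x)‖ₑ ^ 2 :=
        lintegral_finsetSum _ fun j _ => (continuous_slice
          (contDiffOn_dx h j).continuousOn ht).enorm.measurable.pow_const 2
    _ ≤ ∑ _j : Fin 3, B := Finset.sum_le_sum fun j _ => hB j
    _ = 3 * B := by simp

lemma neg_mul_massCurrent_le {c d r : ℝ} (hc : 0 ≤ c) (hd : |d| ≤ c * r) (Φ : ℝ × E3 → ℂ)
    (j : Fin 3) (z : ℝ × E3) :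
    -(d * massCurrent Φ j z) ≤ c * (r ^ 2 * ‖Φ z‖ ^ 2 + ‖dx j Φ z‖ ^ 2) := by
  have hcur : |massCurrent Φ j z| ≤ 2 * (‖Φ z‖ * ‖dx j Φ z‖) := by
    rw [massCurrent, abs_mul, abs_neg, abs_two]
    gcongr
    exact (Complex.abs_im_le_norm _).trans_eq (by simp)
  calc -(d * massCurrent Φ j z) ≤ |d| * |massCurrent Φ j z| := by
        rw [← abs_mul]
        exact neg_le_abs _
    _ ≤ (c * r) * (2 * (‖Φ z‖ * ‖dx j Φ z‖)) :=
        mul_le_mul hd hcur (abs_nonneg _) ((abs_nonneg d).trans hd)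
    _ = c * (2 * (r * ‖Φ z‖) * ‖dx j Φ z‖) := by ring
    _ ≤ c * ((r * ‖Φ z‖) ^ 2 + ‖dx j Φ z‖ ^ 2) := by
        gcongr
        exact two_mul_le_add_sq _ _
    _ = c * (r ^ 2 * ‖Φ z‖ ^ 2 + ‖dx j Φ z‖ ^ 2) := by rw [mul_pow]

lemma lintegral_enorm_sq_mul_enorm_sq_le {ρ : ℕ → E3 → ℝ} {g : E3 → ℝ} {u : E3 → ℂ} {C : ℕ → ℝ}
    {m : ℝ} (hu : Continuous u) (hρ : ∀ n, Continuous fun x => ρ n x ^ 2)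
    (hρc : ∀ n, HasCompactSupport fun x => ρ n x ^ 2)
    (hlim : ∀ x, Tendsto (fun n => ρ n x) atTop (𝓝 (g x)))
    (hle : ∀ n, ∫ x, ρ n x ^ 2 * ‖u x‖ ^ 2 ≤ C n) (hC : Tendsto C atTop (𝓝 m)) :
    ∫⁻ x, ‖g x‖ₑ ^ 2 * ‖u x‖ₑ ^ 2 ≤ ENNReal.ofReal m := by
  have hcont : ∀ n, Continuous fun x => ρ n x ^ 2 * ‖u x‖ ^ 2 := fun n =>
    (hρ n).mul (hu.norm.pow 2)
  have hofReal : ∀ n, ∫⁻ x, ENNReal.ofReal (ρ n x ^ 2 * ‖u x‖ ^ 2) ≤ ENNReal.ofReal (C n) :=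
    fun n => by
      rw [← ofReal_integral_eq_lintegral_ofReal
        ((hcont n).integrable_of_hasCompactSupport (hρc n).mul_right)
        (ae_of_all _ fun x => by positivity)]
      exact ENNReal.ofReal_le_ofReal (hle n)
  calc ∫⁻ x, ‖g x‖ₑ ^ 2 * ‖u x‖ₑ ^ 2
      = ∫⁻ x, liminf (fun n => ENNReal.ofReal (ρ n x ^ 2 * ‖u x‖ ^ 2)) atTop := by
        refine lintegral_congr fun x => ?_
        rw [(ENNReal.tendsto_ofReal (((hlim x).pow 2).mul_const (‖u x‖ ^ 2))).liminf_eq,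
          ENNReal.ofReal_mul (sq_nonneg _), ENNReal.ofReal_pow (norm_nonneg _), ofReal_norm,
          ← Real.enorm_of_nonneg (sq_nonneg (g x)), enorm_pow]
    _ ≤ liminf (fun n => ∫⁻ x, ENNReal.ofReal (ρ n x ^ 2 * ‖u x‖ ^ 2)) atTop :=
        lintegral_liminf_le fun n => (hcont n).measurable.ennreal_ofReal
    _ ≤ liminf (fun n => ENNReal.ofReal (C n)) atTop :=
        liminf_le_liminf (Eventually.of_forall hofReal)
    _ = ENNReal.ofReal m := (ENNReal.tendsto_ofReal hC).liminf_eq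

namespace IsGlobalSmoothSolution

variable {v : E3 → ℝ} {φ₀ : E3 → ℂ} {φ : ℝ → E3 → ℂ} (hφ : IsGlobalSmoothSolution v φ₀ φ)
include hφ

section KineticDensity

variable {a T : ℝ} {B : ℝ≥0} (hB : SobolevBound φ T B) (ha : 0 < a)
include hB ha

lemma integrable_kineticDensity :
    Integrable (kineticDensity (spacetime φ)) (slab a T) :=
  integrable_prod_of_lintegral_le
    (aestronglyMeasurable_prod_of_continuousOn ha.le
      (contDiffOn_kineticDensity hφ.contDiffOn_spacetime).continuousOn)
    (C := 3 * B) (by finiteness) fun t ht => lintegral_kineticDensity_le hφ.contDiffOn_spacetime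
      (ha.trans ht.1) (hB.one t ⟨ha.trans ht.1, ht.2⟩)

lemma integral_kineticDensity_le (haT : a ≤ T) :
    ∫ z, kineticDensity (spacetime φ) z ∂(slab a T) ≤ 3 * B * T := by
  have hslice : ∀ t ∈ Ioc a T, ‖∫ x, kineticDensity (spacetime φ) (t, x)‖ ≤ 3 * B := fun t ht => by
    have hle : ∫⁻ x, ‖kineticDensity (spacetime φ) (t, x)‖ₑ ≤ ((3 * B : ℝ≥0) : ℝ≥0∞) :=
      lintegral_kineticDensity_le hφ.contDiffOn_spacetime (ha.trans ht.1)
        (hB.one t ⟨ha.trans ht.1, ht.2⟩)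
    exact enorm_le_coe.1 ((enorm_integral_le_lintegral_enorm _).trans hle)
  rw [slab, integral_prod _ (hφ.integrable_kineticDensity hB ha)]
  calc ∫ t in Ioc a T, ∫ x, kineticDensity (spacetime φ) (t, x)
      ≤ 3 * B * volume.real (Ioc a T) := (le_abs_self _).trans
        (norm_setIntegral_le_of_norm_le_const measure_Ioc_lt_top hslice)
    _ = 3 * B * (T - a) := by rw [Real.volume_real_Ioc_of_le haT]
    _ ≤ 3 * B * T := by gcongr; linarith

end KineticDensity

section Weight

variable {ρ : E3 → ℝ} {c : ℝ} (hc : 0 ≤ c)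
  (hd : ∀ x j, |fderiv ℝ (fun y => ρ y ^ 2) x (EuclideanSpace.single j 1)| ≤ c * ρ x)
include hc hd

-- The decay rate `3c` of the time weight absorbs the `ρ² ‖φ‖²` produced by Young's inequality.
lemma weighted_mass_source_le {z : ℝ × E3} (hz : z ∈ posTime) :
    ρ z.2 ^ 2 * source (fun z => Real.exp (-(3 * c * z.1)) * ‖spacetime φ z‖ ^ 2)
        (fun j z => Real.exp (-(3 * c * z.1)) * massCurrent (spacetime φ) j z) z
      - ∑ j, fderiv ℝ (fun y => ρ y ^ 2) z.2 (EuclideanSpace.single j 1)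
          * (Real.exp (-(3 * c * z.1)) * massCurrent (spacetime φ) j z)
      ≤ c * kineticDensity (spacetime φ) z := by
  have hs := hφ.contDiffOn_spacetime
  set w : ℝ → ℝ := fun t => Real.exp (-(3 * c * t)) with hw
  have hderiv : deriv w z.1 = -(3 * c) * w z.1 := by
    have h : HasDerivAt w (-(3 * c) * w z.1) z.1 := by
      simpa [hw, mul_comm] using ((hasDerivAt_id z.1).const_mul (3 * c)).neg.exp
    exact h.deriv
  have hw1 : w z.1 ≤ 1 := Real.exp_le_one_iff.2 (neg_nonpos.2 (mul_nonneg (by positivity) hz.1.le))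
  have hsource := source_time_mul (w := w) (by fun_prop) (contDiffOn_norm_sq hs)
    (contDiffOn_massCurrent hs) (by simp) hz
  rw [source_mass_eq_zero hs hz (hφ.equation_spacetime hz), mul_zero, add_zero, hderiv] at hsource
  rw [hsource, sub_eq_add_neg, ← Finset.sum_neg_distrib]
  have hcurrent : ∀ j, -(fderiv ℝ (fun y => ρ y ^ 2) z.2 (EuclideanSpace.single j 1)
      * (w z.1 * massCurrent (spacetime φ) j z)) ≤
      w z.1 * (c * (ρ z.2 ^ 2 * ‖spacetime φ z‖ ^ 2 + ‖dx j (spacetime φ) z‖ ^ 2)) := fun j => by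
    rw [mul_left_comm, ← mul_neg]
    gcongr
    exact neg_mul_massCurrent_le hc (hd z.2 j) _ j z
  calc ρ z.2 ^ 2 * (-(3 * c) * w z.1 * ‖spacetime φ z‖ ^ 2)
        + ∑ j, -(fderiv ℝ (fun y => ρ y ^ 2) z.2 (EuclideanSpace.single j 1)
          * (w z.1 * massCurrent (spacetime φ) j z))
      ≤ ρ z.2 ^ 2 * (-(3 * c) * w z.1 * ‖spacetime φ z‖ ^ 2) + ∑ j : Fin 3,
        w z.1 * (c * (ρ z.2 ^ 2 * ‖spacetime φ z‖ ^ 2 + ‖dx j (spacetime φ) z‖ ^ 2)) := by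
        gcongr with j
        exact hcurrent j
    _ = w z.1 * (c * kineticDensity (spacetime φ) z) := by
        rw [← Finset.mul_sum, ← Finset.mul_sum, Finset.sum_add_distrib, kineticDensity]
        simp only [Finset.sum_const, Finset.card_univ, Fintype.card_fin, nsmul_eq_mul]
        push_cast
        ring
    _ ≤ c * kineticDensity (spacetime φ) z :=
        mul_le_of_le_one_left (mul_nonneg hc (Finset.sum_nonneg fun j _ => sq_nonneg _)) hw1

variable (hρ : ContDiff ℝ 1 fun x => ρ x ^ 2) (hρc : HasCompactSupport fun x => ρ x ^ 2)
  {T : ℝ} {B : ℝ≥0} (hB : SobolevBound φ T B)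
include hρ hρc hB

lemma weighted_mass_le {a : ℝ} (ha : 0 < a) (haT : a ≤ T) :
    ∫ x, ρ x ^ 2 * ‖φ T x‖ ^ 2 ≤
      Real.exp (3 * c * T) * ((∫ x, ρ x ^ 2 * ‖φ a x‖ ^ 2) + c * (3 * B * T)) := by
  have hs := hφ.contDiffOn_spacetime
  set w : ℝ → ℝ := fun t => Real.exp (-(3 * c * t)) with hw
  have hF : ContDiffOn ℝ 1 (fun z => w z.1 * ‖spacetime φ z‖ ^ 2) posTime :=
    contDiffOn_time_mul (by fun_prop) ((contDiffOn_norm_sq hs).of_le (by simp))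
  have hG : ∀ j, ContDiffOn ℝ 1 (fun z => w z.1 * massCurrent (spacetime φ) j z) posTime :=
    fun j => contDiffOn_time_mul (by fun_prop) ((contDiffOn_massCurrent hs j).of_le (by simp))
  have hbalance := (weighted_balance hF hG ha haT hρ hρc).trans_le (integral_mono_ae
    (integrable_weighted_source hF hG ha hρ hρc)
    ((hφ.integrable_kineticDensity hB ha).const_mul c)
    ((ae_slab_mem_posTime ha.le).mono fun z hz => hφ.weighted_mass_source_le hc hd hz))
  simp only [spacetime, mul_left_comm (ρ _ ^ 2) (w _), integral_const_mul] at hbalance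
  have hgrad : c * ∫ z, kineticDensity (spacetime φ) z ∂(slab a T) ≤ c * (3 * B * T) :=
    mul_le_mul_of_nonneg_left (hφ.integral_kineticDensity_le hB ha haT) hc
  have hinit : w a * ∫ x, ρ x ^ 2 * ‖φ a x‖ ^ 2 ≤ ∫ x, ρ x ^ 2 * ‖φ a x‖ ^ 2 :=
    mul_le_of_le_one_left (integral_nonneg fun x => by positivity)
      (Real.exp_le_one_iff.2 (neg_nonpos.2 (by positivity)))
  have hexp : Real.exp (3 * c * T) * w T = 1 := by rw [hw, ← Real.exp_add, add_neg_cancel,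
    Real.exp_zero]
  calc ∫ x, ρ x ^ 2 * ‖φ T x‖ ^ 2
      = Real.exp (3 * c * T) * (w T * ∫ x, ρ x ^ 2 * ‖φ T x‖ ^ 2) := by
        rw [← mul_assoc, hexp, one_mul]
    _ ≤ _ := by
        gcongr
        linarith

lemma weighted_mass_le_initial (hT : 0 < T) :
    ∫ x, ρ x ^ 2 * ‖φ T x‖ ^ 2 ≤
      Real.exp (3 * c * T) * ((∫ x, ρ x ^ 2 * ‖φ₀ x‖ ^ 2) + c * (3 * B * T)) := by
  have hcont : ContinuousOn (fun t => ∫ x, ρ x ^ 2 * ‖φ t x‖ ^ 2) (Ici 0) := by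
    refine continuousOn_integral_of_compact_support hρc.isCompact
      (((hρ.continuous.comp continuous_snd).continuousOn).mul
        (hφ.smooth.continuousOn.norm.pow 2)) fun t x _ hx => ?_
    rw [image_eq_zero_of_notMem_tsupport (f := fun x => ρ x ^ 2) hx, zero_mul]
  have hlim : Tendsto (fun t => ∫ x, ρ x ^ 2 * ‖φ t x‖ ^ 2) (𝓝[>] 0)
      (𝓝 (∫ x, ρ x ^ 2 * ‖φ₀ x‖ ^ 2)) := by
    rw [← hφ.initial]
    exact (hcont 0 self_mem_Ici).mono Ioi_subset_Ici_self
  refine ge_of_tendsto ((hlim.add_const _).const_mul _) ?_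
  filter_upwards [Ioc_mem_nhdsGT hT] with a ha
  exact hφ.weighted_mass_le hc hd hρ hρc hB ha.1 ha.2

end Weight

end IsGlobalSmoothSolution

lemma abs_fderiv_cutoff_apply_single_le (n : ℕ) (x : E3) (j : Fin 3) :
    |fderiv ℝ (cutoff n) x (EuclideanSpace.single j 1)| ≤ ‖fderiv ℝ (cutoff n) x‖ := by
  simpa using (fderiv ℝ (cutoff n) x).le_opNorm (EuclideanSpace.single j 1)

lemma abs_fderiv_cutoff_sq_le (n : ℕ) (x : E3) (j : Fin 3) :
    |fderiv ℝ (fun y : E3 => cutoff n y ^ 2) x (EuclideanSpace.single j 1)| ≤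
      2 * (bumpSlope E3 / (n + 1)) * cutoff n x := by
  have hderiv : HasFDerivAt (fun y : E3 => cutoff n y ^ 2) _ x :=
    (((contDiff_cutoff (k := 1) n).differentiable (by simp) x).hasFDerivAt).pow 2
  have happly : fderiv ℝ (fun y : E3 => cutoff n y ^ 2) x (EuclideanSpace.single j 1) =
      2 * fderiv ℝ (cutoff n) x (EuclideanSpace.single j 1) * cutoff n x := by
    rw [hderiv.fderiv]
    simp only [Nat.add_one_sub_one, pow_one, nsmul_eq_mul, Nat.cast_ofNat,
      smul_apply, smul_eq_mul]
    ring
  rw [happly, abs_mul, abs_mul, abs_two, abs_of_nonneg (cutoff_nonneg n x)]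
  gcongr
  · exact cutoff_nonneg n x
  · exact (abs_fderiv_cutoff_apply_single_le n x j).trans (norm_fderiv_cutoff_le n x)

lemma abs_fderiv_norm_mul_cutoff_sq_le (n : ℕ) (x : E3) (j : Fin 3) :
    |fderiv ℝ (fun y : E3 => (‖y‖ * cutoff n y) ^ 2) x (EuclideanSpace.single j 1)| ≤
      2 * (1 + 2 * bumpSlope E3) * (‖x‖ * cutoff n x) := by
  set d := fderiv ℝ (cutoff n) x (EuclideanSpace.single j 1)
  have hcut : HasFDerivAt (fun y : E3 => cutoff n y ^ 2) _ x :=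
    (((contDiff_cutoff (k := 1) n).differentiable (by simp) x).hasFDerivAt).pow 2
  have hprod : HasFDerivAt (fun y : E3 => ‖y‖ ^ 2 * cutoff n y ^ 2) _ x :=
    (hasStrictFDerivAt_norm_sq x).hasFDerivAt.mul hcut
  have happly : fderiv ℝ (fun y : E3 => (‖y‖ * cutoff n y) ^ 2) x (EuclideanSpace.single j 1) =
      2 * (x j * cutoff n x + ‖x‖ * (‖x‖ * d)) * cutoff n x := by
    simp only [mul_pow]
    rw [hprod.fderiv]
    simp only [Nat.add_one_sub_one, pow_one, nsmul_eq_mul, Nat.cast_ofNat,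
      add_apply, smul_apply, smul_eq_mul,
      coe_innerSL_apply, EuclideanSpace.inner_single_right, Real.ringHom_apply, one_mul, d]
    ring
  have hx : |x j * cutoff n x| ≤ ‖x‖ := by
    rw [abs_mul, abs_of_nonneg (cutoff_nonneg n x)]
    exact (mul_le_of_le_one_right (abs_nonneg _) (cutoff_le_one n x)).trans (PiLp.norm_apply_le x j)
  have hslope : |‖x‖ * (‖x‖ * d)| ≤ ‖x‖ * (2 * bumpSlope E3) := by
    rw [abs_mul, abs_mul, abs_norm]
    refine mul_le_mul_of_nonneg_left ?_ (norm_nonneg x)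
    exact (mul_le_mul_of_nonneg_left (abs_fderiv_cutoff_apply_single_le n x j)
      (norm_nonneg x)).trans (norm_mul_norm_fderiv_cutoff_le n x)
  rw [happly, abs_mul, abs_mul, abs_two, abs_of_nonneg (cutoff_nonneg n x)]
  calc 2 * |x j * cutoff n x + ‖x‖ * (‖x‖ * d)| * cutoff n x
      ≤ 2 * (‖x‖ + ‖x‖ * (2 * bumpSlope E3)) * cutoff n x := by
        gcongr
        · exact cutoff_nonneg n x
        · exact (abs_add_le _ _).trans (add_le_add hx hslope)
    _ = 2 * (1 + 2 * bumpSlope E3) * (‖x‖ * cutoff n x) := by ring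

lemma contDiff_norm_mul_cutoff_sq (n : ℕ) :
    ContDiff ℝ 1 fun x : E3 => (‖x‖ * cutoff n x) ^ 2 := by
  simp only [mul_pow]
  exact (contDiff_norm_sq ℝ).mul ((contDiff_cutoff (k := 1) n).pow 2)

lemma hasCompactSupport_mul_cutoff_sq (f : E3 → ℝ) (n : ℕ) :
    HasCompactSupport fun x : E3 => (f x * cutoff n x) ^ 2 :=
  (hasCompactSupport_cutoff n).mono fun x hx hx0 => hx (by simp [hx0])

namespace IsGlobalSmoothSolution

variable {v : E3 → ℝ} {φ₀ : E3 → ℂ} {φ : ℝ → E3 → ℂ} (hφ : IsGlobalSmoothSolution v φ₀ φ)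
include hφ

lemma lintegral_enorm_sq_le {t : ℝ} (ht : 0 < t) {m : ℝ} (hm0 : 0 ≤ m)
    (hm : ∫⁻ x, ‖φ₀ x‖ₑ ^ 2 ≤ ENNReal.ofReal m) : ∫⁻ x, ‖φ t x‖ₑ ^ 2 ≤ ENNReal.ofReal m := by
  obtain ⟨B, hB⟩ := hφ.exists_sobolevBound t
  have hsmooth : ∀ n, ContDiff ℝ 1 fun x : E3 => cutoff n x ^ 2 := fun n =>
    (contDiff_cutoff (k := 1) n).pow 2
  have hsupp : ∀ n, HasCompactSupport fun x : E3 => cutoff n x ^ 2 := fun n => by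
    simpa using hasCompactSupport_mul_cutoff_sq 1 n
  have hinit : ∀ n, ∫ x, cutoff n x ^ 2 * ‖φ₀ x‖ ^ 2 ≤ m := fun n => by
    refine (le_abs_self _).trans ((ENNReal.ofReal_le_ofReal_iff hm0).1 ?_)
    rw [← Real.enorm_eq_ofReal_abs]
    refine (enorm_integral_le_lintegral_enorm _).trans ((lintegral_mono fun x => ?_).trans hm)
    rw [enorm_mul, enorm_norm_sq, enorm_pow]
    refine mul_le_of_le_one_left zero_le (pow_le_one₀ zero_le ?_)
    rw [← ofReal_norm]
    exact ENNReal.ofReal_le_one.2 (norm_cutoff_le_one n x)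
  set c : ℕ → ℝ := fun n => 2 * (bumpSlope E3 / (n + 1)) with hc
  have hclim : Tendsto c atTop (𝓝 0) := by
    have h := (tendsto_one_div_add_atTop_nhds_zero_nat (𝕜 := ℝ)).const_mul (2 * bumpSlope E3)
    rw [mul_zero] at h
    exact h.congr fun n => by simp only [hc]; ring
  have hlim : Tendsto (fun n => Real.exp (3 * c n * t) * (m + c n * (3 * B * t))) atTop (𝓝 m) := by
    have hcont : Continuous fun r : ℝ => Real.exp (3 * r * t) * (m + r * (3 * B * t)) := by
      fun_prop
    have h := (hcont.tendsto 0).comp hclim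
    rwa [mul_zero, zero_mul, Real.exp_zero, one_mul, zero_mul, add_zero] at h
  have hle : ∀ n, ∫ x, cutoff n x ^ 2 * ‖φ t x‖ ^ 2 ≤
      Real.exp (3 * c n * t) * (m + c n * (3 * B * t)) := fun n => by
    have hcn : 0 ≤ c n := mul_nonneg zero_le_two (div_nonneg bumpSlope_nonneg (by positivity))
    refine (hφ.weighted_mass_le_initial hcn (abs_fderiv_cutoff_sq_le n) (hsmooth n)
      (hsupp n) hB ht).trans ?_
    gcongr
    exact hinit n
  simpa using lintegral_enorm_sq_mul_enorm_sq_le (g := 1) (hφ.continuous_slice ht)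
    (fun n => (hsmooth n).continuous) hsupp tendsto_cutoff hle hlim

lemma exists_lintegral_moment_le (h1 : Integrable fun x => ‖x‖ ^ 2 * ‖φ 1 x‖ ^ 2) (T : ℝ) :
    ∃ Q : ℝ≥0, ∀ t ∈ Icc 1 T, ∫⁻ x, ‖x‖ₑ ^ 2 * ‖φ t x‖ₑ ^ 2 ≤ Q := by
  obtain ⟨B, hB⟩ := hφ.exists_sobolevBound T
  set c : ℝ := 2 * (1 + 2 * bumpSlope E3)
  have hc : 0 ≤ c := by have := bumpSlope_nonneg (V := E3); positivity
  set q := ∫ x, ‖x‖ ^ 2 * ‖φ 1 x‖ ^ 2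
  have hinit : ∀ n, ∫ x, (‖x‖ * cutoff n x) ^ 2 * ‖φ 1 x‖ ^ 2 ≤ q := fun n => by
    refine integral_mono_of_nonneg (ae_of_all _ fun x => by positivity) h1
      (ae_of_all _ fun x => ?_)
    dsimp only
    gcongr
    · exact mul_nonneg (norm_nonneg x) (cutoff_nonneg n x)
    · exact mul_le_of_le_one_right (norm_nonneg x) (cutoff_le_one n x)
  refine ⟨(Real.exp (3 * c * T) * (q + c * (3 * B * T))).toNNReal, fun t ht => ?_⟩
  have ht0 : 0 < t := one_pos.trans_le ht.1
  have hle : ∀ n, ∫ x, (‖x‖ * cutoff n x) ^ 2 * ‖φ t x‖ ^ 2 ≤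
      Real.exp (3 * c * T) * (q + c * (3 * B * T)) := fun n => by
    refine (hφ.weighted_mass_le hc (abs_fderiv_norm_mul_cutoff_sq_le n)
      (contDiff_norm_mul_cutoff_sq n) (hasCompactSupport_mul_cutoff_sq _ n) (hB.mono ht.2)
      one_pos ht.1).trans ?_
    gcongr
    · exact ht.2
    · exact hinit n
    · exact ht.2
  have hlim : ∀ x : E3, Tendsto (fun n => ‖x‖ * cutoff n x) atTop (𝓝 ‖x‖) := fun x => by
    simpa using (tendsto_cutoff x).const_mul ‖x‖
  have hfatou := lintegral_enorm_sq_mul_enorm_sq_le (hφ.continuous_slice ht0)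
    (fun n => (contDiff_norm_mul_cutoff_sq n).continuous)
    (hasCompactSupport_mul_cutoff_sq _) hlim hle tendsto_const_nhds
  simp only [enorm_norm] at hfatou
  exact hfatou

end IsGlobalSmoothSolution

/-! ### The transform of a solution -/

lemma ofReal_pow_finrank_mul_lintegral_comp_smul {F : Type*} [NormedAddCommGroup F]
    [NormedSpace ℝ F] [FiniteDimensional ℝ F] [MeasurableSpace F] [BorelSpace F]
    (μ : Measure F) [μ.IsAddHaarMeasure] {t : ℝ} (ht : 0 < t) (g : F → ℝ≥0∞) :
    ENNReal.ofReal (t ^ Module.finrank ℝ F) * ∫⁻ y, g (t • y) ∂μ = ∫⁻ x, g x ∂μ := by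
  have hme : MeasurableEmbedding (fun y : F => t • y) :=
    (Homeomorph.smulOfNeZero t ht.ne').measurableEmbedding
  rw [← hme.lintegral_map, Measure.map_addHaar_smul μ ht.ne', lintegral_smul_measure,
    abs_of_nonneg (by positivity), smul_eq_mul, ← mul_assoc,
    ← ENNReal.ofReal_mul (by positivity), mul_inv_cancel₀ (by positivity), ENNReal.ofReal_one,
    one_mul]

section Dilation

variable (f : ℝ × E3 → ℂ) {t : ℝ} (ht : 0 < t)
include ht

lemma lintegral_ofReal_cube_mul_comp_smul (g : E3 → ℝ≥0∞) :
    ∫⁻ y, ENNReal.ofReal (t ^ 3) * g (t • y) = ∫⁻ x, g x := by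
  rw [lintegral_const_mul' _ _ ENNReal.ofReal_ne_top]
  simpa only [finrank_euclideanSpace_fin] using
    ofReal_pow_finrank_mul_lintegral_comp_smul volume ht g

lemma norm_sq_pseudoconformal (y : E3) :
    ‖pseudoconformal f (t, y)‖ ^ 2 = t ^ 3 * ‖f (t, t • y)‖ ^ 2 := by
  rw [pseudoconformal, norm_mul, mul_pow, norm_sq_modulation (mem_posTime ht y)]
  rfl

lemma enorm_sq_pseudoconformal (y : E3) :
    ‖pseudoconformal f (t, y)‖ₑ ^ 2 = ENNReal.ofReal (t ^ 3) * ‖f (t, t • y)‖ₑ ^ 2 := by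
  rw [← ofReal_norm, ← ENNReal.ofReal_pow (norm_nonneg _), norm_sq_pseudoconformal f ht,
    ENNReal.ofReal_mul (by positivity), ENNReal.ofReal_pow (norm_nonneg _), ofReal_norm]

lemma lintegral_pow_pseudoconformal (k : ℕ) :
    ∫⁻ y, ‖pseudoconformal f (t, y)‖ₑ ^ (2 * (k + 1)) =
      ENNReal.ofReal (t ^ 3) ^ k * ∫⁻ x, ‖f (t, x)‖ₑ ^ (2 * (k + 1)) := by
  rw [← lintegral_const_mul' _ _ (by finiteness), ← lintegral_ofReal_cube_mul_comp_smul ht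
    fun x => ENNReal.ofReal (t ^ 3) ^ k * ‖f (t, x)‖ₑ ^ (2 * (k + 1))]
  refine lintegral_congr fun y => ?_
  rw [pow_mul, enorm_sq_pseudoconformal f ht]
  ring

lemma lintegral_sq_pseudoconformal :
    ∫⁻ y, ‖pseudoconformal f (t, y)‖ₑ ^ 2 = ∫⁻ x, ‖f (t, x)‖ₑ ^ 2 := by
  simpa using lintegral_pow_pseudoconformal f ht 0

lemma lintegral_smul_pseudoconformal_sq_le {m g : E3 → ℝ}
    (hg : ∀ y, ‖m y‖ * ‖f (t, t • y)‖ ≤ g (t • y)) :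
    ∫⁻ y, ‖m y • pseudoconformal f (t, y)‖ₑ ^ 2 ≤ eLpNorm g 2 volume ^ 2 := by
  have hsq : ∫⁻ x, ‖g x‖ₑ ^ 2 = eLpNorm g 2 volume ^ 2 := lintegral_enorm_pow g two_ne_zero
  rw [← hsq, ← lintegral_ofReal_cube_mul_comp_smul ht fun x => ‖g x‖ₑ ^ 2]
  refine lintegral_mono fun y => ?_
  rw [enorm_smul, mul_pow, enorm_sq_pseudoconformal f ht, mul_left_comm, ← mul_pow, ← enorm_smul]
  gcongr
  rw [enorm_le_iff_norm_le, norm_smul]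
  exact (hg y).trans (le_abs_self _)

end Dilation

lemma scaledField_pseudoconformal (χ : ℝ → ℝ) (φ : ℝ → E3 → ℂ) {t : ℝ} (ht : 0 < t) (y : E3) :
    scaledField χ (pseudoconformal (spacetime φ)) (t, y) =
      meanField (potential χ) (φ t) (t • y) := by
  have hscale := Measure.integral_comp_smul_of_nonneg (volume : Measure E3)
    (fun x => potential χ (t • y - x) * ‖φ t x‖ ^ 2) t (hR := ht.le)
  rw [finrank_euclideanSpace_fin, smul_eq_mul] at hscale
  have hpt : ∀ x, potential χ (t • (y - x)) * ‖pseudoconformal (spacetime φ) (t, x)‖ ^ 2 =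
      t ^ 3 * (potential χ (t • y - t • x) * ‖φ t (t • x)‖ ^ 2) := fun x => by
    rw [norm_sq_pseudoconformal _ ht, smul_sub, spacetime]
    ring
  simp only [scaledField, density, meanField, hpt]
  rw [integral_const_mul, hscale, ← mul_assoc, mul_inv_cancel₀ (by positivity), one_mul]

lemma eLpNorm_two_le_sqrt {α F : Type*} [MeasurableSpace α] {μ : Measure α}
    [NormedAddCommGroup F] {f : α → F} {B : ℝ≥0} (hf : ∫⁻ x, ‖f x‖ₑ ^ 2 ∂μ ≤ B) :
    eLpNorm f 2 μ ≤ NNReal.sqrt B := by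
  have hpow : ∫⁻ x, ‖f x‖ₑ ^ 2 ∂μ = eLpNorm f 2 μ ^ 2 := lintegral_enorm_pow f two_ne_zero
  rw [← ENNReal.pow_le_pow_left_iff two_ne_zero, ← hpow, ← ENNReal.coe_pow, NNReal.sq_sqrt]
  exact hf

lemma enorm_meanField_le {χ : ℝ → ℝ} (hχ : IsDecreasingCutoff χ) (u : E3 → ℂ) (x : E3) :
    ‖meanField (potential χ) u x‖ₑ ≤
      (∫⁻ x : E3, ‖potential χ x‖ₑ ^ 2) + ∫⁻ x, ‖u x‖ₑ ^ 4 := by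
  have hv := hχ.measurable_potential
  refine (enorm_integral_le_lintegral_enorm _).trans ?_
  simp only [enorm_mul]
  refine (lintegral_mul_le_sq_add_sq (by fun_prop)).trans ?_
  rw [lintegral_sub_left_eq_self (fun y => ‖potential χ y‖ₑ ^ 2)]
  simp only [enorm_norm_sq, ← pow_mul, Nat.reduceMul, le_refl]

lemma norm_le_norm_smul {F : Type*} [SeminormedAddCommGroup F] [NormedSpace ℝ F] {t : ℝ}
    (ht : 1 ≤ t) (y : F) : ‖y‖ ≤ ‖t • y‖ := by
  rw [norm_smul, Real.norm_of_nonneg (by linarith)]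
  exact le_mul_of_one_le_left (norm_nonneg _) ht

section Pointwise

variable (f : ℝ × E3 → ℂ)

lemma norm_conjDx_le (j : Fin 3) {z : ℝ × E3} (hz : z ∈ posTime) :
    ‖conjDx j f z‖ ≤ ‖z.2‖ * ‖f z‖ + z.1 * ‖dx j f z‖ := by
  have hj : ‖z.2 j / 2‖ ≤ ‖z.2‖ := by
    have := PiLp.norm_apply_le z.2 j
    rw [norm_div, Real.norm_ofNat]
    linarith [norm_nonneg (z.2 j)]
  refine (norm_add_le _ _).trans (add_le_add ?_ ?_)
  · rw [norm_mul, norm_neg, norm_mul, Complex.norm_I, one_mul, Complex.norm_real]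
    gcongr
  · rw [norm_mul, Complex.norm_real, Real.norm_of_nonneg (le_of_lt hz.1)]

variable {t : ℝ} (ht : 1 ≤ t) (y : E3)
include ht

lemma norm_conjDt_le :
    ‖conjDt f (t, t • y)‖ ≤ (2 + ‖y‖ ^ 2) * ‖f (t, t • y)‖ + ‖dt f (t, t • y)‖
      + ‖y‖ * ∑ j, ‖dx j f (t, t • y)‖ := by
  have ht0 : 0 < t := by linarith
  have hzero : ‖((3 / (2 * t) : ℝ) : ℂ)‖ ≤ 2 := by
    rw [Complex.norm_real, Real.norm_of_nonneg (by positivity), div_le_iff₀ (by positivity)]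
    linarith
  have htwo : ‖Complex.I * ((‖t • y‖ ^ 2 / (4 * t ^ 2) : ℝ) : ℂ)‖ ≤ ‖y‖ ^ 2 := by
    rw [norm_mul, Complex.norm_I, one_mul, Complex.norm_real, Real.norm_of_nonneg (by positivity),
      norm_smul, Real.norm_of_nonneg ht0.le, div_le_iff₀ (by positivity)]
    nlinarith [sq_nonneg (t * ‖y‖)]
  have hdx : ∀ j, ‖(((t • y) j / t : ℝ) : ℂ) * dx j f (t, t • y)‖ ≤
      ‖y‖ * ‖dx j f (t, t • y)‖ := fun j => by
    rw [norm_mul, Complex.norm_real, PiLp.smul_apply, smul_eq_mul, mul_div_cancel_left₀ _ ht0.ne']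
    gcongr
    exact PiLp.norm_apply_le y j
  rw [Finset.mul_sum]
  refine (norm_add_le _ _).trans (add_le_add ((norm_add_le _ _).trans
    (add_le_add_left ?_ _)) ((norm_sum_le _ _).trans (Finset.sum_le_sum fun j _ => hdx j)))
  rw [norm_mul]
  gcongr
  exact (norm_sub_le _ _).trans (add_le_add hzero htwo)

lemma norm_inv_mul_norm_conjDt_le :
    ‖(1 + ‖y‖)⁻¹‖ * ‖conjDt f (t, t • y)‖ ≤ 2 * ‖f (t, t • y)‖ + ‖t • y‖ * ‖f (t, t • y)‖
      + ‖dt f (t, t • y)‖ + ∑ j, ‖dx j f (t, t • y)‖ := by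
  have hy := norm_nonneg y
  have hty := norm_le_norm_smul ht y
  have hzero : (2 + ‖y‖ ^ 2) * ‖f (t, t • y)‖ ≤
      (1 + ‖y‖) * ((2 + ‖t • y‖) * ‖f (t, t • y)‖) := by
    rw [← mul_assoc]
    gcongr
    nlinarith
  have hdt : ‖dt f (t, t • y)‖ ≤ (1 + ‖y‖) * ‖dt f (t, t • y)‖ :=
    le_mul_of_one_le_left (norm_nonneg _) (by linarith)
  have hdx : ‖y‖ * ∑ j, ‖dx j f (t, t • y)‖ ≤ (1 + ‖y‖) * ∑ j, ‖dx j f (t, t • y)‖ := by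
    gcongr
    linarith
  rw [Real.norm_of_nonneg (by positivity), inv_mul_le_iff₀ (by positivity)]
  linarith [norm_conjDt_le f ht y]

end Pointwise

lemma eLpNorm_norm_add_mul_norm_le {α F G : Type*} [MeasurableSpace α] {μ : Measure α}
    [NormedAddCommGroup F] [NormedAddCommGroup G] {f : α → F} {g : α → G}
    (hf : AEStronglyMeasurable f μ) (hg : AEStronglyMeasurable g μ) {p : ℝ≥0∞} (hp : 1 ≤ p)
    (c : ℝ≥0) :
    eLpNorm (fun x => ‖f x‖ + c * ‖g x‖) p μ ≤ eLpNorm f p μ + c * eLpNorm g p μ := by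
  refine (eLpNorm_add_le hf.norm (hg.norm.const_mul _) hp).trans_eq ?_
  rw [eLpNorm_norm]
  congr 1
  have hsmul := eLpNorm_const_smul (c : ℝ) (fun x => ‖g x‖) p μ
  rwa [eLpNorm_norm, NNReal.enorm_eq] at hsmul

/-- Uniform bounds on `[1, T]` for a time-dependent function and its first derivatives, with one
moment in space. They are what the pseudoconformal transform turns into `Controlled`. -/
structure MomentBound (φ : ℝ → E3 → ℂ) (T : ℝ) (R : ℝ≥0) : Prop where
  zero : ∀ t ∈ Icc 1 T, eLpNorm (φ t) 2 volume ≤ R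
  moment : ∀ t ∈ Icc 1 T, eLpNorm (fun x => ‖x‖ * ‖φ t x‖) 2 volume ≤ R
  grad : ∀ t ∈ Icc 1 T, ∀ j, eLpNorm (fun x => dx j (spacetime φ) (t, x)) 2 volume ≤ R
  time : ∀ t ∈ Icc 1 T, eLpNorm (fun x => dt (spacetime φ) (t, x)) 2 volume ≤ R
  four : ∀ t ∈ Icc 1 T, ∫⁻ x, ‖φ t x‖ₑ ^ 4 ≤ R

namespace IsGlobalSmoothSolution

section Mass

variable {v : E3 → ℝ} {φ₀ : E3 → ℂ} {φ : ℝ → E3 → ℂ} (hφ : IsGlobalSmoothSolution v φ₀ φ)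
include hφ

lemma continuous_lap {t : ℝ} (ht : 0 < t) : Continuous fun x => lap (spacetime φ) (t, x) :=
  Hartree.continuous_slice (continuousOn_finsetSum _ fun j _ =>
    (contDiffOn_dx (contDiffOn_dx hφ.contDiffOn_spacetime j) j).continuousOn) ht

lemma exists_lintegral_pow_four_le (T : ℝ) :
    ∃ X : ℝ≥0, ∀ t ∈ Ioc 0 T, ∫⁻ x, ‖φ t x‖ₑ ^ 4 ≤ X := by
  obtain ⟨B, hB⟩ := hφ.exists_sobolevBound T
  refine ⟨(√(B * (sobolevConst * (3 * B) ^ 3) : ℝ≥0)).toNNReal, fun t ht => ?_⟩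
  have hs := hφ.contDiff_slice ht.1
  have hzero := hB.zero t ht
  have hgrad : ∫⁻ x, ENNReal.ofReal (∑ j, ‖partialDeriv j (φ t) x‖ ^ 2) ≤ 3 * B := by
    refine le_trans (lintegral_mono fun x => ?_)
      (lintegral_kineticDensity_le hφ.contDiffOn_spacetime ht.1 (hB.one t ht))
    simp only [hφ.partialDeriv_eq ht.1]
    exact Real.ofReal_le_enorm _
  have hsix : ∫⁻ x, ‖φ t x‖ₑ ^ 6 ≤ sobolevConst * (3 * B) ^ 3 :=
    (lintegral_enorm_pow_six_le (hs.of_le (by simp)) (ne_top_of_le_ne_top ENNReal.coe_ne_top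
      hzero)).trans (by gcongr)
  refine lintegral_pow_four_le_sqrt hs.continuous.enorm.aemeasurable ?_
  rw [ENNReal.ofReal_coe_nnreal]
  push_cast
  exact mul_le_mul' hzero hsix

end Mass

variable {χ : ℝ → ℝ} (hχ : IsDecreasingCutoff χ) {φ₀ : E3 → ℂ} {φ : ℝ → E3 → ℂ}
  (hφ : IsGlobalSmoothSolution (potential χ) φ₀ φ)
include hφ

lemma equation_pseudoconformal {z : ℝ × E3} (hz : z ∈ posTime) :
    Complex.I * dt (pseudoconformal (spacetime φ)) z
      + ((z.1 ^ 2 : ℝ) : ℂ)⁻¹ * lap (pseudoconformal (spacetime φ)) z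
      - (scaledField χ (pseudoconformal (spacetime φ)) z : ℂ)
        * pseudoconformal (spacetime φ) z = 0 := by
  have heq := hφ.equation_spacetime (dilation_mem hz)
  have hfield : scaledField χ (pseudoconformal (spacetime φ)) z =
      meanField (potential χ) (φ (dilation z).1) (dilation z).2 :=
    scaledField_pseudoconformal χ φ hz.1 z.2
  rw [schrodinger_pseudoconformal hφ.contDiffOn_spacetime hz, hfield, pseudoconformal]
  linear_combination modulation z * heq

lemma dt_eq {z : ℝ × E3} (hz : z ∈ posTime) :
    dt (spacetime φ) z = Complex.I * (lap (spacetime φ) z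
      - (meanField (potential χ) (φ z.1) z.2 : ℂ) * spacetime φ z) := by
  linear_combination (-Complex.I) * hφ.equation_spacetime hz
    + dt (spacetime φ) z * Complex.I_mul_I

include hχ

lemma exists_norm_dt_le (T : ℝ) : ∃ c : ℝ≥0, ∀ t ∈ Ioc 0 T, ∀ x,
    ‖dt (spacetime φ) (t, x)‖ ≤ ‖lap (spacetime φ) (t, x)‖ + c * ‖φ t x‖ := by
  obtain ⟨X, hX⟩ := hφ.exists_lintegral_pow_four_le T
  lift ∫⁻ x : E3, ‖potential χ x‖ₑ ^ 2 to ℝ≥0 using hχ.lintegral_potential_sq_ne_top with V hV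
  refine ⟨V + X, fun t ht x => ?_⟩
  have hfield : ‖meanField (potential χ) (φ t) x‖₊ ≤ V + X := by
    rw [← ENNReal.coe_le_coe, ENNReal.coe_add, hV]
    exact (enorm_meanField_le hχ (φ t) x).trans (add_le_add_right (hX t ht) _)
  rw [hφ.dt_eq (mem_posTime ht.1 x), norm_mul, Complex.norm_I, one_mul]
  refine (norm_sub_le _ _).trans (add_le_add_right ?_ _)
  rw [norm_mul, Complex.norm_real]
  exact mul_le_mul_of_nonneg_right hfield (norm_nonneg _)

lemma exists_eLpNorm_dt_le (T : ℝ) : ∃ R : ℝ≥0, ∀ t ∈ Ioc 0 T,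
    eLpNorm (fun x => dt (spacetime φ) (t, x)) 2 volume ≤ R := by
  obtain ⟨B, hB⟩ := hφ.exists_sobolevBound T
  obtain ⟨c, hc⟩ := hφ.exists_norm_dt_le hχ T
  refine ⟨NNReal.sqrt B + c * NNReal.sqrt B, fun t ht => ?_⟩
  calc eLpNorm (fun x => dt (spacetime φ) (t, x)) 2 volume
      ≤ eLpNorm (fun x => ‖lap (spacetime φ) (t, x)‖ + c * ‖φ t x‖) 2 volume :=
        eLpNorm_mono_real (hc t ht)
    _ ≤ eLpNorm (fun x => lap (spacetime φ) (t, x)) 2 volume + c * eLpNorm (φ t) 2 volume :=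
        eLpNorm_norm_add_mul_norm_le (hφ.continuous_lap ht.1).aestronglyMeasurable
          (hφ.continuous_slice ht.1).aestronglyMeasurable one_le_two c
    _ ≤ _ := by
        push_cast
        gcongr
        exacts [eLpNorm_two_le_sqrt (hB.two t ht), eLpNorm_two_le_sqrt (hB.zero t ht)]

lemma exists_momentBound (h1 : Integrable fun x => ‖x‖ ^ 2 * ‖φ 1 x‖ ^ 2) (T : ℝ) :
    ∃ R, MomentBound φ T R := by
  obtain ⟨B, hB⟩ := hφ.exists_sobolevBound T
  obtain ⟨Q, hQ⟩ := hφ.exists_lintegral_moment_le h1 T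
  obtain ⟨X, hX⟩ := hφ.exists_lintegral_pow_four_le T
  obtain ⟨D, hD⟩ := hφ.exists_eLpNorm_dt_le hχ T
  have hmem : ∀ t ∈ Icc 1 T, t ∈ Ioc 0 T := fun t ht => ⟨one_pos.trans_le ht.1, ht.2⟩
  refine ⟨NNReal.sqrt B ⊔ NNReal.sqrt Q ⊔ X ⊔ D, fun t ht => ?_, fun t ht => ?_,
    fun t ht j => ?_, fun t ht => ?_, fun t ht => ?_⟩
  · exact (eLpNorm_two_le_sqrt (hB.zero t (hmem t ht))).trans (by simp)
  · have hmoment : ∫⁻ x, ‖‖x‖ * ‖φ t x‖‖ₑ ^ 2 ≤ Q := by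
      simpa only [enorm_mul, enorm_norm, mul_pow] using hQ t ht
    exact (eLpNorm_two_le_sqrt hmoment).trans (by simp)
  · exact (eLpNorm_two_le_sqrt (hB.one t (hmem t ht) j)).trans (by simp)
  · exact (hD t (hmem t ht)).trans (by simp)
  · exact (hX t (hmem t ht)).trans (by simp)

end IsGlobalSmoothSolution

namespace MomentBound

variable {φ : ℝ → E3 → ℂ} {T : ℝ} {R : ℝ≥0} (hR : MomentBound φ T R)
  {t : ℝ} (ht : t ∈ Icc 1 T)
include hR ht

lemma lintegral_pow_four_pseudoconformal_le :
    ∫⁻ y, ‖pseudoconformal (spacetime φ) (t, y)‖ₑ ^ 4 ≤ ((T ^ 3).toNNReal * R : ℝ≥0) := by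
  have ht0 : 0 < t := one_pos.trans_le ht.1
  have hscale := lintegral_pow_pseudoconformal (spacetime φ) ht0 1
  rw [pow_one] at hscale
  refine hscale.trans_le ?_
  push_cast
  gcongr
  exacts [ENNReal.ofReal_le_ofReal (pow_le_pow_left₀ ht0.le ht.2 3), hR.four t ht]

variable (hs : ContDiffOn ℝ ∞ (spacetime φ) posTime)
include hs

lemma lintegral_weighted_pseudoconformal_le :
    ∫⁻ y, ‖(1 + ‖y‖) • pseudoconformal (spacetime φ) (t, y)‖ₑ ^ 2 ≤ ((2 * R) ^ 2 : ℝ≥0) := by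
  have ht0 : 0 < t := one_pos.trans_le ht.1
  have hφ : Continuous (φ t) := continuous_slice hs.continuousOn ht0
  have hg : eLpNorm (fun x => ‖φ t x‖ + ‖x‖ * ‖φ t x‖) 2 volume ≤ 2 * R := by
    refine (eLpNorm_add_le hφ.norm.aestronglyMeasurable
      (continuous_norm.mul hφ.norm).aestronglyMeasurable one_le_two).trans ?_
    rw [eLpNorm_norm, two_mul]
    exact add_le_add (hR.zero t ht) (hR.moment t ht)
  refine (lintegral_smul_pseudoconformal_sq_le _ ht0 fun y => ?_).trans (pow_le_pow_left' hg 2)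
  rw [Real.norm_of_nonneg (by positivity), ← one_add_mul]
  gcongr
  exacts [norm_le_norm_smul ht.1 y, le_rfl]

lemma lintegral_dx_pseudoconformal_le (j : Fin 3) :
    ∫⁻ y, ‖dx j (pseudoconformal (spacetime φ)) (t, y)‖ₑ ^ 2 ≤
      ((R + T.toNNReal * R) ^ 2 : ℝ≥0) := by
  have ht0 : 0 < t := one_pos.trans_le ht.1
  have hφ : Continuous (φ t) := continuous_slice hs.continuousOn ht0
  have hdx := continuous_slice (contDiffOn_dx hs j).continuousOn ht0
  have hg : eLpNorm (fun x => ‖‖x‖ * ‖φ t x‖‖ + T.toNNReal * ‖dx j (spacetime φ) (t, x)‖) 2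
      volume ≤ R + T.toNNReal * R := by
    refine (eLpNorm_norm_add_mul_norm_le (continuous_norm.mul hφ.norm).aestronglyMeasurable
      hdx.aestronglyMeasurable one_le_two _).trans ?_
    gcongr
    exacts [hR.moment t ht, hR.grad t ht j]
  have hconj : ∫⁻ y, ‖dx j (pseudoconformal (spacetime φ)) (t, y)‖ₑ ^ 2 =
      ∫⁻ y, ‖(1 : ℝ) • pseudoconformal (conjDx j (spacetime φ)) (t, y)‖ₑ ^ 2 := by
    simp only [dx_pseudoconformal hs (mem_posTime ht0 _), one_smul]
  rw [hconj]
  refine (lintegral_smul_pseudoconformal_sq_le _ ht0 fun y => ?_).trans (pow_le_pow_left' hg 2)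
  rw [norm_one, one_mul, norm_mul, norm_norm, norm_norm, Real.coe_toNNReal _ (ht0.le.trans ht.2)]
  refine (norm_conjDx_le _ j (mem_posTime ht0 _)).trans (add_le_add_right ?_ _)
  exact mul_le_mul_of_nonneg_right ht.2 (norm_nonneg _)

lemma eLpNorm_conjDt_majorant_le :
    eLpNorm (fun x => 2 * ‖φ t x‖ + ‖x‖ * ‖φ t x‖ + ‖dt (spacetime φ) (t, x)‖
      + ∑ j, ‖dx j (spacetime φ) (t, x)‖) 2 volume ≤ (7 * R : ℝ≥0) := by
  have ht0 : 0 < t := one_pos.trans_le ht.1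
  have hφ : Continuous (φ t) := continuous_slice hs.continuousOn ht0
  have hdt := (continuous_slice (contDiffOn_dt hs).continuousOn ht0).norm
  have hdx := fun j => (continuous_slice (contDiffOn_dx hs j).continuousOn ht0).norm
  have hmoment : Continuous fun x => ‖x‖ * ‖φ t x‖ := continuous_norm.mul hφ.norm
  have hdouble : Continuous fun x => 2 * ‖φ t x‖ := hφ.norm.const_mul 2
  have hzero : eLpNorm (fun x => 2 * ‖φ t x‖) 2 volume ≤ 2 * R := by
    simp only [two_mul]
    refine (eLpNorm_add_le hφ.norm.aestronglyMeasurable hφ.norm.aestronglyMeasurable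
      one_le_two).trans ?_
    rw [eLpNorm_norm]
    exact add_le_add (hR.zero t ht) (hR.zero t ht)
  have htime : eLpNorm (fun x => ‖dt (spacetime φ) (t, x)‖) 2 volume ≤ R := by
    rw [eLpNorm_norm]
    exact hR.time t ht
  have hgrad : eLpNorm (fun x => ∑ j, ‖dx j (spacetime φ) (t, x)‖) 2 volume ≤ 3 * R := by
    rw [← Finset.sum_fn]
    refine (eLpNorm_sum_le (fun j _ => (hdx j).aestronglyMeasurable) one_le_two).trans ?_
    simp only [eLpNorm_norm]
    exact (Finset.sum_le_sum fun j _ => hR.grad t ht j).trans_eq (by simp)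
  refine (eLpNorm_add_le ((hdouble.add hmoment).add hdt).aestronglyMeasurable
    (continuous_finsetSum _ fun j _ => hdx j).aestronglyMeasurable one_le_two).trans ?_
  refine (add_le_add ((eLpNorm_add_le (hdouble.add hmoment).aestronglyMeasurable
    hdt.aestronglyMeasurable one_le_two).trans (add_le_add ((eLpNorm_add_le
      hdouble.aestronglyMeasurable hmoment.aestronglyMeasurable one_le_two).trans
        (add_le_add hzero (hR.moment t ht))) htime)) hgrad).trans_eq ?_
  push_cast
  ring

lemma lintegral_dt_pseudoconformal_le :
    ∫⁻ y, ‖(1 + ‖y‖)⁻¹ • dt (pseudoconformal (spacetime φ)) (t, y)‖ₑ ^ 2 ≤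
      ((7 * R) ^ 2 : ℝ≥0) := by
  have ht0 : 0 < t := one_pos.trans_le ht.1
  have hconj : ∫⁻ y, ‖(1 + ‖y‖)⁻¹ • dt (pseudoconformal (spacetime φ)) (t, y)‖ₑ ^ 2 =
      ∫⁻ y, ‖(1 + ‖y‖)⁻¹ • pseudoconformal (conjDt (spacetime φ)) (t, y)‖ₑ ^ 2 := by
    simp only [dt_pseudoconformal hs (mem_posTime ht0 _)]
  rw [hconj]
  exact (lintegral_smul_pseudoconformal_sq_le _ ht0
    (norm_inv_mul_norm_conjDt_le (spacetime φ) ht.1)).trans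
      (pow_le_pow_left' (hR.eLpNorm_conjDt_majorant_le ht hs) 2)

end MomentBound

lemma IsGlobalSmoothSolution.exists_controlled {χ : ℝ → ℝ} (hχ : IsDecreasingCutoff χ)
    {φ₀ : E3 → ℂ} {φ : ℝ → E3 → ℂ} (hφ : IsGlobalSmoothSolution (potential χ) φ₀ φ)
    (h1 : Integrable fun x => ‖x‖ ^ 2 * ‖φ 1 x‖ ^ 2) (T : ℝ) :
    ∃ B, Controlled (pseudoconformal (spacetime φ)) 1 T B := by
  obtain ⟨R, hR⟩ := hφ.exists_momentBound hχ h1 T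
  have hs := hφ.contDiffOn_spacetime
  refine ⟨(2 * R) ^ 2 ⊔ (R + T.toNNReal * R) ^ 2 ⊔ (7 * R) ^ 2 ⊔ (T ^ 3).toNNReal * R,
    fun t ht => ?_, fun t ht j => ?_, fun t ht => ?_, fun t ht => ?_⟩
  · refine (hR.lintegral_weighted_pseudoconformal_le ht hs).trans (ENNReal.coe_le_coe.2 ?_)
    simp only [le_sup_iff, le_refl, true_or]
  · refine (hR.lintegral_dx_pseudoconformal_le ht hs j).trans (ENNReal.coe_le_coe.2 ?_)
    simp only [le_sup_iff, le_refl, true_or, or_true]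
  · refine (hR.lintegral_dt_pseudoconformal_le ht hs).trans (ENNReal.coe_le_coe.2 ?_)
    simp only [le_sup_iff, le_refl, true_or, or_true]
  · exact (hR.lintegral_pow_four_pseudoconformal_le ht).trans (ENNReal.coe_le_coe.2 le_sup_right)

/-! ### The pseudoconformal energy at time one -/

lemma norm_sq_galilean (a d : ℂ) (r : ℝ) :
    ‖-(Complex.I * ((r / 2 : ℝ) : ℂ)) * a + d‖ ^ 2 = r ^ 2 / 4 * ‖a‖ ^ 2
      + r * (1 / (2 * Complex.I) * (a * conj d - conj a * d)).re + ‖d‖ ^ 2 := by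
  have hI : 1 / (2 * Complex.I) = ((-(1 / 2) : ℝ) : ℂ) * Complex.I := by
    rw [one_div, mul_inv, Complex.inv_I]
    push_cast
    ring
  rw [hI]
  simp only [Complex.sq_norm, Complex.normSq_apply, Complex.add_re, Complex.add_im,
    Complex.sub_re, Complex.sub_im, Complex.mul_re, Complex.mul_im, Complex.neg_re,
    Complex.neg_im, Complex.I_re, Complex.I_im, Complex.ofReal_re, Complex.ofReal_im,
    Complex.conj_re, Complex.conj_im]
  ring

lemma continuousOn_conjDx {f : ℝ × E3 → ℂ} (hf : ContDiffOn ℝ ∞ f posTime) (j : Fin 3) :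
    ContinuousOn (conjDx j f) posTime := by
  have hdx := (contDiffOn_dx hf j).continuousOn
  have hf' := hf.continuousOn
  unfold conjDx
  fun_prop

lemma kineticDensity_pseudoconformal {f : ℝ × E3 → ℂ} (hf : ContDiffOn ℝ ∞ f posTime) {t : ℝ}
    (ht : 0 < t) (y : E3) : kineticDensity (pseudoconformal f) (t, y) =
      t ^ 3 * ∑ j, ‖conjDx j f (t, t • y)‖ ^ 2 := by
  simp only [kineticDensity, dx_pseudoconformal hf (mem_posTime ht y),
    norm_sq_pseudoconformal _ ht, Finset.mul_sum]

lemma norm_sq_mul_norm_sq_le (f : ℝ × E3 → ℂ) (z : ℝ × E3) : ‖z.2‖ ^ 2 * ‖f z‖ ^ 2 ≤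
    8 * ((∑ j, ‖conjDx j f z‖ ^ 2) + z.1 ^ 2 * kineticDensity f z) := by
  rw [kineticDensity, EuclideanSpace.real_norm_sq_eq, Finset.sum_mul, Finset.mul_sum,
    ← Finset.sum_add_distrib, Finset.mul_sum]
  refine Finset.sum_le_sum fun j _ => ?_
  have hcoord : ‖(z.1 : ℂ) * dx j f z - conjDx j f z‖ = |z.2 j| / 2 * ‖f z‖ := by
    rw [conjDx, sub_add_cancel_right, ← neg_mul, neg_neg, norm_mul, norm_mul, Complex.norm_I,
      one_mul, Complex.norm_real, Real.norm_eq_abs, abs_div, abs_two]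
  have hsub : |z.2 j| / 2 * ‖f z‖ ≤ |z.1| * ‖dx j f z‖ + ‖conjDx j f z‖ := by
    rw [← hcoord, ← Real.norm_eq_abs, ← Complex.norm_real, ← norm_mul]
    exact norm_sub_le _ _
  calc z.2 j ^ 2 * ‖f z‖ ^ 2 = 4 * (|z.2 j| / 2 * ‖f z‖) ^ 2 := by
        rw [mul_pow, div_pow, sq_abs]
        ring
    _ ≤ 4 * (|z.1| * ‖dx j f z‖ + ‖conjDx j f z‖) ^ 2 := by gcongr
    _ ≤ 4 * (2 * ((|z.1| * ‖dx j f z‖) ^ 2 + ‖conjDx j f z‖ ^ 2)) := by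
        gcongr
        exact add_sq_le
    _ = _ := by
        rw [mul_pow, sq_abs]
        ring

lemma meanField_nonneg {v : E3 → ℝ} (hv : ∀ x, 0 ≤ v x) (f : E3 → ℂ) (x : E3) :
    0 ≤ meanField v f x :=
  integral_nonneg fun _ => mul_nonneg (hv _) (sq_nonneg _)

namespace IsGlobalSmoothSolution

section Density

variable {v : E3 → ℝ} {φ₀ : E3 → ℂ} {φ : ℝ → E3 → ℂ} (hφ : IsGlobalSmoothSolution v φ₀ φ)
  {t : ℝ} (ht : 0 < t)
include hφ ht

lemma pseudoconformalDensity_eq (x : E3) :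
    pseudoconformalDensity v φ t x = ∑ j, ‖conjDx j (spacetime φ) (t, x)‖ ^ 2
      + t ^ 2 * (meanField v (φ t) x * massDensity (φ t) x) := by
  have hconj : ∀ j, ‖conjDx j (spacetime φ) (t, x)‖ ^ 2 = x j ^ 2 / 4 * ‖φ t x‖ ^ 2
      + t * (x j * momentumDensity j (φ t) x) + t ^ 2 * ‖partialDeriv j (φ t) x‖ ^ 2 := fun j => by
    rw [momentumDensity, hφ.partialDeriv_eq ht]
    refine (norm_sq_galilean (φ t x) (t * dx j (spacetime φ) (t, x)) (x j)).trans ?_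
    rw [norm_mul, Complex.norm_real, mul_pow, Real.norm_eq_abs, sq_abs, map_mul,
      Complex.conj_ofReal, ← mul_left_comm (t : ℂ), ← mul_left_comm (t : ℂ), ← mul_sub,
      ← mul_left_comm (t : ℂ), Complex.re_ofReal_mul]
    ring
  simp only [hconj, pseudoconformalDensity, energyDensity, stressTrace, massDensity,
    EuclideanSpace.real_norm_sq_eq, Fin.sum_univ_three]
  ring

lemma integrable_sum_norm_sq_conjDx (hv : ∀ x, 0 ≤ v x)
    (hi : Integrable (pseudoconformalDensity v φ t)) :
    Integrable fun x => ∑ j, ‖conjDx j (spacetime φ) (t, x)‖ ^ 2 := by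
  refine hi.mono' (continuous_finsetSum _ fun j _ => (Hartree.continuous_slice
    (continuousOn_conjDx hφ.contDiffOn_spacetime j) ht).norm.pow 2).aestronglyMeasurable
      (ae_of_all _ fun x => ?_)
  rw [Real.norm_of_nonneg (by positivity), hφ.pseudoconformalDensity_eq ht]
  have hW := meanField_nonneg hv (φ t) x
  rw [massDensity]
  exact le_add_of_nonneg_right (by positivity)

lemma integrable_kineticDensity_slice :
    Integrable fun x => kineticDensity (spacetime φ) (t, x) := by
  obtain ⟨B, hB⟩ := hφ.exists_sobolevBound t
  exact ⟨(Hartree.continuous_slice (contDiffOn_kineticDensity hφ.contDiffOn_spacetime).continuousOn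
    ht).aestronglyMeasurable, (lintegral_kineticDensity_le hφ.contDiffOn_spacetime ht
      (hB.one t ⟨ht, le_rfl⟩)).trans_lt (by finiteness)⟩

lemma integrable_moment (hv : ∀ x, 0 ≤ v x)
    (hi : Integrable (pseudoconformalDensity v φ t)) :
    Integrable fun x => ‖x‖ ^ 2 * ‖φ t x‖ ^ 2 :=
  (((hφ.integrable_sum_norm_sq_conjDx ht hv hi).add
    ((hφ.integrable_kineticDensity_slice ht).const_mul (t ^ 2))).const_mul 8).mono'
      ((continuous_norm.pow 2).mul
        ((hφ.contDiff_slice ht).continuous.norm.pow 2)).aestronglyMeasurable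
      (ae_of_all _ fun x => by
        rw [Real.norm_of_nonneg (by positivity)]
        exact norm_sq_mul_norm_sq_le (spacetime φ) (t, x))

end Density

variable {χ : ℝ → ℝ} (hχ : IsDecreasingCutoff χ) {φ₀ : E3 → ℂ} {φ : ℝ → E3 → ℂ}
  (hφ : IsGlobalSmoothSolution (potential χ) φ₀ φ)
  (hi : Integrable (pseudoconformalDensity (potential χ) φ 1))
include hχ hφ hi

lemma energy_one_eq : kinetic (pseudoconformal (spacetime φ)) 1
    + interaction (potential χ) (pseudoconformal (spacetime φ)) 1 =
      pseudoconformalEnergy (potential χ) φ 1 := by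
  obtain ⟨B, hB⟩ := hφ.exists_controlled hχ (hφ.integrable_moment one_pos hχ.potential_nonneg hi) 1
  have hs := contDiffOn_pseudoconformal hφ.contDiffOn_spacetime
  have hpair := hB.integrable_density_density hχ le_rfl hs ⟨le_rfl, le_rfl⟩ (C := 1) (fun x => by
    rw [abs_of_nonneg (hχ.potential_nonneg x)]
    linarith) hχ.measurable_potential
  have hdensity : density (pseudoconformal (spacetime φ)) 1 = fun y => ‖φ 1 y‖ ^ 2 := by
    funext y
    rw [density, norm_sq_pseudoconformal _ one_pos, one_smul, one_pow, one_mul, spacetime]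
  have hinter : interaction (potential χ) (pseudoconformal (spacetime φ)) 1 =
      ∫ x, meanField (potential χ) (φ 1) x * massDensity (φ 1) x := by
    rw [interaction, integral_pairing hpair, ← integral_const_mul, hdensity]
    simp only [meanField, massDensity, mul_left_comm]
  have hmean : Integrable fun x => meanField (potential χ) (φ 1) x * massDensity (φ 1) x := by
    have hconv := (integrable_convolution_mul hpair).const_mul (1 / 2)
    rw [hdensity] at hconv
    simpa only [meanField, massDensity, mul_left_comm] using hconv
  have hkin := hφ.integrable_sum_norm_sq_conjDx one_pos hχ.potential_nonneg hi
  simp only [hinter, kinetic, kineticDensity_pseudoconformal hφ.contDiffOn_spacetime one_pos,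
    one_smul, one_pow, one_mul, pseudoconformalEnergy, hφ.pseudoconformalDensity_eq one_pos]
  exact (integral_add hkin hmean).symm

lemma isBoundedScaledSolution_pseudoconformal {M E : ℝ}
    (hM : eLpNorm φ₀ 2 volume ≤ ENNReal.ofReal M)
    (hE : pseudoconformalEnergy (potential χ) φ 1 ≤ E) :
    IsBoundedScaledSolution χ (max M 0 ^ 2) E (pseudoconformal (spacetime φ)) where
  smooth := contDiffOn_pseudoconformal hφ.contDiffOn_spacetime
  equation _ hz := hφ.equation_pseudoconformal hz
  controlled T :=
    hφ.exists_controlled hχ (hφ.integrable_moment one_pos hχ.potential_nonneg hi) T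
  mass t ht := by
    have ht0 : 0 < t := one_pos.trans_le ht
    have hmass : ∫⁻ x, ‖φ₀ x‖ₑ ^ 2 ≤ ENNReal.ofReal (max M 0 ^ 2) := by
      rw [lintegral_enorm_pow _ two_ne_zero, ENNReal.ofReal_pow (le_max_right _ _)]
      exact pow_le_pow_left' (hM.trans (ENNReal.ofReal_le_ofReal (le_max_left _ _))) 2
    rw [lintegral_sq_pseudoconformal _ ht0]
    exact hφ.lintegral_enorm_sq_le ht0 (sq_nonneg _) hmass
  energy := (hφ.energy_one_eq hχ hi).trans_le hE

end IsGlobalSmoothSolution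

/-! ### Decay of the solution -/

/-- The constant in the bound for `∫ |φ|⁶`. -/
def sixthPowerConst (χ : ℝ → ℝ) (M E : ℝ) : ℝ :=
  sobolevConst * (max E 0 + 2 * ((∫ x, potential χ x)
    * √(max M 0 ^ 2 * (sobolevConst * max E 0 ^ 3)))) ^ 3

lemma sixthPowerConst_nonneg {χ : ℝ → ℝ} (hχ : IsDecreasingCutoff χ) (M E : ℝ) :
    0 ≤ sixthPowerConst χ M E := by
  have hV : 0 ≤ ∫ x, potential χ x := integral_nonneg hχ.potential_nonneg
  rw [sixthPowerConst]
  positivity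

namespace IsGlobalSmoothSolution

variable {χ : ℝ → ℝ} (hχ : IsDecreasingCutoff χ) {M E : ℝ} {φ₀ : E3 → ℂ} {φ : ℝ → E3 → ℂ}
  (hφ : IsGlobalSmoothSolution (potential χ) φ₀ φ)
  (hM : eLpNorm φ₀ 2 volume ≤ ENNReal.ofReal M)
  (hi : Integrable (pseudoconformalDensity (potential χ) φ 1))
  (hE : pseudoconformalEnergy (potential χ) φ 1 ≤ E) {t : ℝ} (ht : 1 ≤ t)
include hχ hφ hM hi hE ht

lemma lintegral_pow_six_pseudoconformal_le :
    ∫⁻ y, ‖pseudoconformal (spacetime φ) (t, y)‖ₑ ^ 6 ≤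
      ENNReal.ofReal (sixthPowerConst χ M E * (t ^ (1 / 2 : ℝ)) ^ 3) := by
  have h := hφ.isBoundedScaledSolution_pseudoconformal hχ hi hM hE
  have hK := kinetic_nonneg (pseudoconformal (spacetime φ)) t
  have hkin := h.kinetic_le_sqrt hχ ht
  rw [← max_eq_left (h.energy_nonneg hχ)] at hkin
  refine (h.lintegral_pow_six_le ht).trans ?_
  rw [← ENNReal.ofReal_pow hK, ← ENNReal.ofReal_coe_nnreal, ← ENNReal.ofReal_mul (by positivity)]
  refine ENNReal.ofReal_le_ofReal ?_
  rw [sixthPowerConst, mul_assoc, ← mul_pow]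
  gcongr

lemma lintegral_pow_six_le :
    ∫⁻ x, ‖φ t x‖ₑ ^ 6 ≤ ENNReal.ofReal (sixthPowerConst χ M E * t ^ (-(9 / 2) : ℝ)) := by
  have ht0 : 0 < t := one_pos.trans_le ht
  have hexp : (t ^ (1 / 2 : ℝ)) ^ 3 = (t ^ 3) ^ 2 * t ^ (-(9 / 2) : ℝ) := by
    rw [← Real.rpow_natCast, ← Real.rpow_natCast, ← Real.rpow_natCast, ← Real.rpow_mul ht0.le,
      ← Real.rpow_mul ht0.le, ← Real.rpow_add ht0]
    norm_num
  have hcancel : ENNReal.ofReal (t ^ 3) ^ 2 ≠ 0 :=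
    pow_ne_zero _ (ENNReal.ofReal_pos.2 (by positivity)).ne'
  refine (ENNReal.mul_le_mul_iff_right hcancel (by finiteness)).1 ?_
  calc ENNReal.ofReal (t ^ 3) ^ 2 * ∫⁻ x, ‖φ t x‖ₑ ^ 6
      = ∫⁻ y, ‖pseudoconformal (spacetime φ) (t, y)‖ₑ ^ 6 :=
        (lintegral_pow_pseudoconformal (spacetime φ) ht0 2).symm
    _ ≤ _ := hφ.lintegral_pow_six_pseudoconformal_le hχ hM hi hE ht
    _ = _ := by
        rw [← ENNReal.ofReal_pow (by positivity), ← ENNReal.ofReal_mul (by positivity), hexp,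
          mul_left_comm]

lemma eLpNorm_six_le : eLpNorm (φ t) 6 volume ≤
    ENNReal.ofReal (sixthPowerConst χ M E ^ (1 / 6 : ℝ) * t ^ (-(3 / 4) : ℝ)) := by
  have ht0 : 0 < t := one_pos.trans_le ht
  have hD := sixthPowerConst_nonneg hχ M E
  have h := hφ.lintegral_pow_six_le hχ hM hi hE ht
  rw [lintegral_enorm_pow _ (by norm_num)] at h
  refine (ENNReal.pow_le_pow_left_iff (n := 6) (by norm_num)).1 (h.trans_eq ?_)
  rw [← ENNReal.ofReal_pow (by positivity), mul_pow, ← Real.rpow_mul_natCast hD,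
    ← Real.rpow_mul_natCast ht0.le]
  norm_num

lemma eLpNorm_four_le : eLpNorm (φ t) 4 volume ≤
    ENNReal.ofReal ((max M 0 ^ 2 * sixthPowerConst χ M E) ^ (1 / 8 : ℝ)
      * t ^ (-(9 / 16) : ℝ)) := by
  have ht0 : 0 < t := one_pos.trans_le ht
  have hD := sixthPowerConst_nonneg hχ M E
  have hsix := hφ.lintegral_pow_six_le hχ hM hi hE ht
  have hmass := (hφ.isBoundedScaledSolution_pseudoconformal hχ hi hM hE).mass t ht
  rw [lintegral_sq_pseudoconformal _ ht0] at hmass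
  have h := (sq_lintegral_pow_four_le
    (hφ.contDiff_slice ht0).continuous.enorm.measurable.aemeasurable).trans
      (mul_le_mul' hmass hsix)
  rw [lintegral_enorm_pow _ (by norm_num), ← pow_mul, ← ENNReal.ofReal_mul (by positivity)] at h
  refine (ENNReal.pow_le_pow_left_iff (n := 4 * 2) (by norm_num)).1 (h.trans_eq ?_)
  rw [← ENNReal.ofReal_pow (by positivity), mul_pow, ← Real.rpow_mul_natCast (by positivity),
    ← Real.rpow_mul_natCast ht0.le]
  norm_num [mul_assoc]

end IsGlobalSmoothSolution

lemma lintegral_Ioi_one_sq_le {f : ℝ → ℝ≥0∞} {A a : ℝ} (ha : 1 < 2 * a)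
    (hf : ∀ t, 1 ≤ t → f t ≤ ENNReal.ofReal (A * t ^ (-a))) :
    ∫⁻ t in Ioi (1 : ℝ), f t ^ 2 ≤ ENNReal.ofReal (A ^ 2 * (2 * a - 1)⁻¹) := by
  have hexp : -(2 * a) < -1 := by linarith
  have hsq : ∀ t ∈ Ioi (1 : ℝ), f t ^ 2 ≤ ENNReal.ofReal (A ^ 2 * t ^ (-(2 * a))) := fun t ht => by
    have hpow : (A * t ^ (-a)) ^ 2 = A ^ 2 * t ^ (-(2 * a)) := by
      rw [mul_pow, ← Real.rpow_mul_natCast (zero_le_one.trans ht.le), Nat.cast_ofNat, neg_mul,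
        mul_comm a]
    refine (pow_le_pow_left' (hf t ht.le) 2).trans ?_
    rw [← hpow, ← sq_abs (A * _), ENNReal.ofReal_pow (abs_nonneg _)]
    exact pow_le_pow_left' (ENNReal.ofReal_le_ofReal (le_abs_self _)) 2
  calc ∫⁻ t in Ioi (1 : ℝ), f t ^ 2
      ≤ ∫⁻ t in Ioi (1 : ℝ), ENNReal.ofReal (A ^ 2 * t ^ (-(2 * a))) :=
        setLIntegral_mono' measurableSet_Ioi hsq
    _ = ENNReal.ofReal (∫ t in Ioi (1 : ℝ), A ^ 2 * t ^ (-(2 * a))) :=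
        (ofReal_integral_eq_lintegral_ofReal
          ((integrableOn_Ioi_rpow_of_lt hexp one_pos).const_mul _)
          ((ae_restrict_mem measurableSet_Ioi).mono fun t ht =>
            mul_nonneg (sq_nonneg A) (Real.rpow_nonneg (one_pos.trans ht).le _))).symm
    _ = _ := by
        rw [integral_const_mul, integral_Ioi_rpow_of_lt hexp one_pos, Real.one_rpow,
          neg_div, ← div_neg, one_div, neg_add, neg_neg, ← sub_eq_add_neg]

end Hartree

end

theorem theorem4 (χ : ℝ → ℝ) (hχ : Hartree.IsDecreasingCutoff χ) (M E : ℝ) :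
    ∃ C : ℝ, ∀ (φ₀ : Hartree.E3 → ℂ) (φ : ℝ → Hartree.E3 → ℂ),
      Hartree.IsGlobalSmoothSolution (Hartree.potential χ) φ₀ φ →
      eLpNorm φ₀ 2 volume ≤ ENNReal.ofReal M →
      Integrable (Hartree.pseudoconformalDensity (Hartree.potential χ) φ 1) volume →
      Hartree.pseudoconformalEnergy (Hartree.potential χ) φ 1 ≤ E →
        (∀ t : ℝ, 1 ≤ t →
          eLpNorm (φ t) 6 volume ≤ ENNReal.ofReal (C * t ^ (-(3 / 4) : ℝ))) ∧
        (∀ t : ℝ, 1 ≤ t →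
          eLpNorm (φ t) 4 volume ≤ ENNReal.ofReal (C * t ^ (-(9 / 16) : ℝ))) ∧
        (∫⁻ t in Ioi (1 : ℝ), eLpNorm (φ t) 6 volume ^ 2) ≤ ENNReal.ofReal C ∧
        (∫⁻ t in Ioi (1 : ℝ), eLpNorm (φ t) 4 volume ^ 2) ≤ ENNReal.ofReal C := by
  set A := Hartree.sixthPowerConst χ M E ^ (1 / 6 : ℝ)
  set B := (max M 0 ^ 2 * Hartree.sixthPowerConst χ M E) ^ (1 / 8 : ℝ)
  set C := max (max A B) (max (A ^ 2 * (2 * (3 / 4) - 1)⁻¹) (B ^ 2 * (2 * (9 / 16) - 1)⁻¹))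
  have hA : A ≤ C := (le_max_left _ _).trans (le_max_left _ _)
  have hB : B ≤ C := (le_max_right _ _).trans (le_max_left _ _)
  refine ⟨C, fun φ₀ φ hφ hM hi hE => ?_⟩
  have h6 := fun (t : ℝ) (ht : 1 ≤ t) => hφ.eLpNorm_six_le hχ hM hi hE ht
  have h4 := fun (t : ℝ) (ht : 1 ≤ t) => hφ.eLpNorm_four_le hχ hM hi hE ht
  refine ⟨fun t ht => (h6 t ht).trans (ENNReal.ofReal_le_ofReal ?_),
    fun t ht => (h4 t ht).trans (ENNReal.ofReal_le_ofReal ?_),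
    (Hartree.lintegral_Ioi_one_sq_le (by norm_num) h6).trans (ENNReal.ofReal_le_ofReal ?_),
    (Hartree.lintegral_Ioi_one_sq_le (by norm_num) h4).trans (ENNReal.ofReal_le_ofReal ?_)⟩
  · exact mul_le_mul_of_nonneg_right hA (Real.rpow_nonneg (zero_le_one.trans ht) _)
  · exact mul_le_mul_of_nonneg_right hB (Real.rpow_nonneg (zero_le_one.trans ht) _)
  · exact (le_max_left _ _).trans (le_max_right _ _)
  · exact (le_max_right _ _).trans (le_max_right _ _)
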